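/- Let $N\ge 2$ and let $\Omega\subset\mathbb{R}^N$ be an open set (connectedness is not needed) with the cone property: there is a finite closed cone $K$ such that every $x\in\Omega$ is the vertex of a finite cone contained in $\Omega$ and congruent to $K$. For functions on $\overline\Omega$ write $f\ll g$ if $\inf_{\overline\Omega}(g-f)>0$, and put $h^*:=\frac{Nh}{N-h}$ for $h<N$. Let $p,q,a:\overline\Omega\to\mathbb{R}$ be Lipschitz functions such that - $1<\inf_{\overline\Omega}p$, $p(x)<q(x)$ for all $x\in\overline\Omega$, and $\sup_{\overline\Omega}q<N$; - $q\ll \frac{N+1}{N}\,p$; - $a\ge 0$ on $\overline\Omega$ and $a$ is bounded. For $x\in\overline\Omega$ and $t\ge 0$ set $$\mathcal{H}(x,t):=t^{p(x)}+a(x)t^{q(x)},\qquad \mathcal{G}^*(x,t):=t^{p^*(x)}+a(x)^{q^*(x)/q(x)}\,t^{q^*(x)}.$$ For $\Psi\in\{\mathcal{H},\mathcal{G}^*\}$ let $L^{\Psi}(\Omega)$ be the space of measurable $u:\Omega\to\mathbb{R}$ with $\rho_\Psi(u):=\int_\Omega\Psi(x,|u|)\,dx<\infty$, with the norm $\|u\|_\Psi:=\inf\{\tau>0:\rho_\Psi(u/\tau)\le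 1\}$, and let $W^{1,\mathcal{H}}(\Omega)$ be the space of weakly differentiable $u\in L^{\mathcal{H}}(\Omega)$ with $|\nabla u|\in L^{\mathcal{H}}(\Omega)$, with the norm $\|u\|_{W^{1,\mathcal{H}}(\Omega)}:=\inf\{\tau>0:\rho_{\mathcal{H}}(|\nabla u|/\tau)+\rho_{\mathcal{H}}(u/\tau)\le 1\}$. Then $W^{1,\mathcal{H}}(\Omega)\hookrightarrow L^{\mathcal{G}^*}(\Omega)$ continuously: there is a constant $C>0$ such that every $u\in W^{1,\mathcal{H}}(\Omega)$ belongs to $L^{\mathcal{G}^*}(\Omega)$ and $\|u\|_{\mathcal{G}^*}\le C\|u\|_{W^{1,\mathcal{H}}(\Omega)}$. Moreover, there is a constant $C_1>0$ such that $$\int_\Omega\mathcal{G}^*(x,|u|)\,dx\le C_1\left[\int_\Omega\mathcal{H}(x,|\nabla u|)\,dx+\int_\Omega\mathcal{H}(x,|u|)\,dx+1\right]^{(q^*)^+}\qquad\text{for all }u\in W^{1,\mathcal{H}}(\Omega),$$ where $(q^*)^+:=\sup_{\overline\Omega}q^*$. -/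

import Mathlib

open MeasureTheory
open scoped ENNReal ContDiff

namespace DoublePhase

/-- The finite (closed) cone with vertex `x`, axis direction `v`, height `ρ` and aperture
angle `κ`. -/
def finiteCone {N : ℕ} (x v : EuclideanSpace ℝ (Fin N)) (ρ κ : ℝ) :
    Set (EuclideanSpace ℝ (Fin N)) :=
  {y | y = x ∨ (0 < ‖y - x‖ ∧ ‖y - x‖ ≤ ρ ∧ InnerProductGeometry.angle (y - x) v ≤ κ / 2)}

/-- The cone property: every point of `Ω` is the vertex of a finite cone contained in `Ω` and
congruent to one fixed finite cone (i.e. with fixed height and aperture). -/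
def ConeProperty {N : ℕ} (Ω : Set (EuclideanSpace ℝ (Fin N))) : Prop :=
  ∃ ρ κ : ℝ, 0 < ρ ∧ 0 < κ ∧ κ ≤ Real.pi ∧
    ∀ x ∈ Ω, ∃ v : EuclideanSpace ℝ (Fin N), v ≠ 0 ∧ finiteCone x v ρ κ ⊆ Ω

/-- `f ≪ g` : the infimum of `g - f` over the closure of `Ω` is positive. -/
def StrictlyBelow {N : ℕ} (Ω : Set (EuclideanSpace ℝ (Fin N)))
    (f g : EuclideanSpace ℝ (Fin N) → ℝ) : Prop :=
  ∃ δ : ℝ, 0 < δ ∧ ∀ x ∈ closure Ω, δ ≤ g x - f x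

/-- The class `C₊` of continuous functions `m` on the closure of `Ω` with
`1 < inf m ≤ sup m < ∞`. -/
def MemCPlus {N : ℕ} (Ω : Set (EuclideanSpace ℝ (Fin N)))
    (m : EuclideanSpace ℝ (Fin N) → ℝ) : Prop :=
  ContinuousOn m (closure Ω) ∧ StrictlyBelow Ω (fun _ => 1) m ∧ BddAbove (m '' closure Ω)

/-- The class `C^{0,1}` of Lipschitz functions on the closure of `Ω`. -/
def IsLipschitz {N : ℕ} (Ω : Set (EuclideanSpace ℝ (Fin N)))
    (m : EuclideanSpace ℝ (Fin N) → ℝ) : Prop :=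
  ∃ K : NNReal, LipschitzOnWith K m (closure Ω)

/-- The standing assumption on the data `p, q, a`. -/
structure AssumptionA {N : ℕ} (Ω : Set (EuclideanSpace ℝ (Fin N)))
    (p q a : EuclideanSpace ℝ (Fin N) → ℝ) : Prop where
  two_le : 2 ≤ N
  p_mem : MemCPlus Ω p
  q_mem : MemCPlus Ω q
  p_lip : IsLipschitz Ω p
  q_lip : IsLipschitz Ω q
  p_lt_q : ∀ x ∈ closure Ω, p x < q x
  q_lt : ∀ x ∈ closure Ω, q x < N
  q_below : StrictlyBelow Ω q (fun x => p x * ((N + 1 : ℝ) / N))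
  a_nonneg : ∀ x ∈ closure Ω, 0 ≤ a x
  a_bdd : BddAbove (a '' Ω)
  a_lip : IsLipschitz Ω a

/-- The critical Sobolev exponent `h* = N h / (N - h)`. -/
noncomputable def critExp (N : ℕ) (h : ℝ) : ℝ := N * h / (N - h)

/-- `ℋ(x,t) = t^{p(x)} + a(x) t^{q(x)}`. -/
noncomputable def fnH {N : ℕ} (p q a : EuclideanSpace ℝ (Fin N) → ℝ)
    (x : EuclideanSpace ℝ (Fin N)) (t : ℝ) : ℝ :=
  t ^ p x + a x * t ^ q x

/-- `𝒢*(x,t) = t^{p*(x)} + a(x)^{q*(x)/q(x)} t^{q*(x)}`. -/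
noncomputable def fnGstar {N : ℕ} (p q a : EuclideanSpace ℝ (Fin N) → ℝ)
    (x : EuclideanSpace ℝ (Fin N)) (t : ℝ) : ℝ :=
  t ^ critExp N (p x) + a x ^ (critExp N (q x) / q x) * t ^ critExp N (q x)

/-- The modular `ρ_Ψ(u) = ∫_Ω Ψ(x,|u(x)|) dx`, with values in `[0,∞]`. -/
noncomputable def modular {N : ℕ} (Ω : Set (EuclideanSpace ℝ (Fin N)))
    (Ψ : EuclideanSpace ℝ (Fin N) → ℝ → ℝ) (u : EuclideanSpace ℝ (Fin N) → ℝ) : ℝ≥0∞ :=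
  ∫⁻ x in Ω, ENNReal.ofReal (Ψ x |u x|)

/-- Membership in the Musielak–Orlicz space `L^Ψ(Ω)`. -/
def MemL {N : ℕ} (Ω : Set (EuclideanSpace ℝ (Fin N)))
    (Ψ : EuclideanSpace ℝ (Fin N) → ℝ → ℝ) (u : EuclideanSpace ℝ (Fin N) → ℝ) : Prop :=
  AEMeasurable u (volume.restrict Ω) ∧ modular Ω Ψ u < ⊤

/-- The Luxemburg norm `inf {τ > 0 : ρ(u/τ) ≤ 1}` given by a modular `ρ`
(with value `∞` if there is no such `τ`). -/
noncomputable def luxemburg {N : ℕ} (ρ : (EuclideanSpace ℝ (Fin N) → ℝ) → ℝ≥0∞)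
    (u : EuclideanSpace ℝ (Fin N) → ℝ) : ℝ≥0∞ :=
  ⨅ (τ : ℝ) (_ : 0 < τ) (_ : ρ (fun x => u x / τ) ≤ 1), ENNReal.ofReal τ

/-- The norm of `L^Ψ(Ω)`. -/
noncomputable def normL {N : ℕ} (Ω : Set (EuclideanSpace ℝ (Fin N)))
    (Ψ : EuclideanSpace ℝ (Fin N) → ℝ → ℝ) (u : EuclideanSpace ℝ (Fin N) → ℝ) : ℝ≥0∞ :=
  luxemburg (modular Ω Ψ) u

/-- `g` is a weak (distributional) gradient of `u` on the open set `Ω`. -/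
def IsWeakGradient {N : ℕ} (Ω : Set (EuclideanSpace ℝ (Fin N)))
    (u : EuclideanSpace ℝ (Fin N) → ℝ)
    (g : EuclideanSpace ℝ (Fin N) → EuclideanSpace ℝ (Fin N)) : Prop :=
  LocallyIntegrableOn u Ω ∧ LocallyIntegrableOn g Ω ∧
    ∀ φ : EuclideanSpace ℝ (Fin N) → ℝ, ContDiff ℝ ∞ φ → HasCompactSupport φ →
      tsupport φ ⊆ Ω → ∀ i : Fin N,
        ∫ x in Ω, u x * fderiv ℝ φ x (EuclideanSpace.single i 1) = -∫ x in Ω, g x i * φ x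

/-- `u` is weakly differentiable on `Ω`. -/
def WeaklyDifferentiable {N : ℕ} (Ω : Set (EuclideanSpace ℝ (Fin N)))
    (u : EuclideanSpace ℝ (Fin N) → ℝ) : Prop :=
  ∃ g, IsWeakGradient Ω u g

open Classical in
/-- The weak gradient `∇u` of a weakly differentiable function `u` on `Ω`; it is unique up to
a null set, see `IsWeakGradient.ae_eq`. -/
noncomputable def weakGrad {N : ℕ} (Ω : Set (EuclideanSpace ℝ (Fin N)))
    (u : EuclideanSpace ℝ (Fin N) → ℝ) :
    EuclideanSpace ℝ (Fin N) → EuclideanSpace ℝ (Fin N) :=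
  if h : WeaklyDifferentiable Ω u then h.choose else 0

/-- On an open set, weak gradients are unique almost everywhere. -/
theorem IsWeakGradient.ae_eq {N : ℕ} {Ω : Set (EuclideanSpace ℝ (Fin N))} (hΩ : IsOpen Ω)
    {u : EuclideanSpace ℝ (Fin N) → ℝ}
    {g h : EuclideanSpace ℝ (Fin N) → EuclideanSpace ℝ (Fin N)}
    (hg : IsWeakGradient Ω u g) (hh : IsWeakGradient Ω u h) :
    ∀ᵐ x ∂volume.restrict Ω, g x = h x := by
  have key : ∀ i : Fin N, ∀ᵐ x ∂volume, x ∈ Ω → g x i - h x i = 0 := by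
    intro i
    have hc : ∀ {k : EuclideanSpace ℝ (Fin N) → EuclideanSpace ℝ (Fin N)},
        LocallyIntegrableOn k Ω → LocallyIntegrableOn (fun x => k x i) Ω := by
      intro k hk x hx
      obtain ⟨s, hs, hks⟩ := hk x hx
      exact ⟨s, hs, (EuclideanSpace.proj (𝕜 := ℝ) i).integrable_comp hks⟩
    have hgi := hc hg.2.1
    have hhi := hc hh.2.1
    refine hΩ.ae_eq_zero_of_integral_contDiff_smul_eq_zero (hgi.sub hhi) ?_
    intro φ hφ hφc hφs
    have hz : ∀ k : EuclideanSpace ℝ (Fin N) → ℝ,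
        ∫ x, k x * φ x = ∫ x in Ω, k x * φ x := by
      intro k
      refine (setIntegral_eq_integral_of_forall_compl_eq_zero ?_).symm
      intro x hx
      rw [image_eq_zero_of_notMem_tsupport (fun hx' => hx (hφs hx')), mul_zero]
    have hint : ∀ {k : EuclideanSpace ℝ (Fin N) → ℝ}, LocallyIntegrableOn k Ω →
        IntegrableOn (fun x => k x * φ x) Ω := by
      intro k hk
      have h1 : IntegrableOn k (tsupport φ) := hk.integrableOn_compact_subset hφs hφc
      have h2 : IntegrableOn (fun x => k x * φ x) (tsupport φ) :=
        h1.mul_continuousOn hφ.continuous.continuousOn hφc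
      refine IntegrableOn.of_forall_sdiff_eq_zero h2 hΩ.measurableSet ?_
      intro x hx
      rw [image_eq_zero_of_notMem_tsupport hx.2, mul_zero]
    have e1 := hg.2.2 φ hφ hφc hφs i
    have e2 := hh.2.2 φ hφ hφc hφs i
    have e3 : ∫ x in Ω, g x i * φ x = ∫ x in Ω, h x i * φ x := by linarith
    have e4 : ∫ x, (g x i - h x i) * φ x = 0 := by
      rw [hz (fun x => g x i - h x i)]
      simp_rw [sub_mul]
      rw [integral_sub (hint hgi) (hint hhi), e3, sub_self]
    simpa [smul_eq_mul, mul_comm] using e4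
  rw [ae_restrict_iff' hΩ.measurableSet]
  filter_upwards [ae_all_iff.2 key] with x hx hxΩ
  ext i
  exact sub_eq_zero.1 (hx i hxΩ)

/-- Membership in the Musielak–Orlicz–Sobolev space `W^{1,Ψ}(Ω)`: `u ∈ L^Ψ(Ω)`, `u` is weakly
differentiable, and `|∇u| ∈ L^Ψ(Ω)`. -/
def MemW {N : ℕ} (Ω : Set (EuclideanSpace ℝ (Fin N)))
    (Ψ : EuclideanSpace ℝ (Fin N) → ℝ → ℝ) (u : EuclideanSpace ℝ (Fin N) → ℝ) : Prop :=
  MemL Ω Ψ u ∧ WeaklyDifferentiable Ω u ∧ MemL Ω Ψ (fun x => ‖weakGrad Ω u x‖)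

/-- The modular `∫_Ω Ψ(x,|∇u|) + Ψ(x,|u|) dx` of `W^{1,Ψ}(Ω)`. -/
noncomputable def modularW {N : ℕ} (Ω : Set (EuclideanSpace ℝ (Fin N)))
    (Ψ : EuclideanSpace ℝ (Fin N) → ℝ → ℝ) (u : EuclideanSpace ℝ (Fin N) → ℝ) : ℝ≥0∞ :=
  modular Ω Ψ (fun x => ‖weakGrad Ω u x‖) + modular Ω Ψ u

/-- The norm of `W^{1,Ψ}(Ω)`. -/
noncomputable def normW {N : ℕ} (Ω : Set (EuclideanSpace ℝ (Fin N)))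
    (Ψ : EuclideanSpace ℝ (Fin N) → ℝ → ℝ) (u : EuclideanSpace ℝ (Fin N) → ℝ) : ℝ≥0∞ :=
  luxemburg (modularW Ω Ψ) u

/-- The continuous embedding `W^{1,Ψ}(Ω) ↪ L^Φ(Ω)`. -/
def EmbedsContinuously {N : ℕ} (Ω : Set (EuclideanSpace ℝ (Fin N)))
    (Ψ Φ : EuclideanSpace ℝ (Fin N) → ℝ → ℝ) : Prop :=
  ∃ C : ℝ, 0 < C ∧ ∀ u : EuclideanSpace ℝ (Fin N) → ℝ, MemW Ω Ψ u →
    MemL Ω Φ u ∧ normL Ω Φ u ≤ ENNReal.ofReal C * normW Ω Ψ u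

end DoublePhase

namespace DoublePhase

theorem lintegral_comp_const_smul {N : ℕ} {h : EuclideanSpace ℝ (Fin N) → ℝ≥0∞}
    (hh : Measurable h) {t : ℝ} (ht : 0 < t) :
    ∫⁻ z, h (t • z) = ENNReal.ofReal ((t ^ N)⁻¹) * ∫⁻ z, h z := by
  have h1 := Measure.map_addHaar_smul (volume : Measure (EuclideanSpace ℝ (Fin N))) ht.ne'
  rw [← lintegral_map (f := h) (g := fun z => t • z) hh (by fun_prop), h1, lintegral_smul_measure,
    finrank_euclideanSpace_fin, abs_of_pos (by positivity), smul_eq_mul]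

theorem measurable_rieszKernel {N : ℕ} :
    Measurable fun z : EuclideanSpace ℝ (Fin N) => ‖z‖ₑ ^ (1 - (N : ℝ)) := by
  fun_prop

theorem lintegral_rieszKernel_ball_lt_top {N : ℕ} (hN : 2 ≤ N) :
    ∫⁻ z in Metric.ball (0 : EuclideanSpace ℝ (Fin N)) 1, ‖z‖ₑ ^ (1 - (N : ℝ)) < ⊤ := by
  have : Nonempty (Fin N) := ⟨⟨0, by omega⟩⟩
  have h := (integrableOn_fun_norm_addHaar (volume : Measure (EuclideanSpace ℝ (Fin N)))
    (f := fun r : ℝ => r ^ (1 - (N : ℝ))) (r := 1)).2 (by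
      rw [finrank_euclideanSpace_fin]
      refine (integrableOn_const (C := (1 : ℝ)) (by simp) : IntegrableOn _ _ _).congr_fun ?_
        measurableSet_Ioo
      intro y hy
      simp only [smul_eq_mul]
      rw [← Real.rpow_natCast, ← Real.rpow_add hy.1, Nat.cast_sub (by omega)]
      simp)
  have h2 := h.2
  rw [HasFiniteIntegral] at h2
  refine lt_of_le_of_lt (lintegral_mono_ae ?_) h2
  have h0 : ∀ᵐ z : EuclideanSpace ℝ (Fin N) ∂volume.restrict (Metric.ball 0 1), z ≠ 0 :=
    ae_restrict_of_ae (by simp [ae_iff])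
  filter_upwards [h0] with z hz
  rw [← ofReal_norm z, ENNReal.ofReal_rpow_of_pos (norm_pos_iff.2 hz)]
  rw [Real.enorm_eq_ofReal (by positivity)]

theorem lintegral_rieszKernel_ball {N : ℕ} {r : ℝ} (hr : 0 < r) :
    ∫⁻ z in Metric.ball (0 : EuclideanSpace ℝ (Fin N)) r, ‖z‖ₑ ^ (1 - (N : ℝ)) =
      ENNReal.ofReal r *
        ∫⁻ z in Metric.ball (0 : EuclideanSpace ℝ (Fin N)) 1, ‖z‖ₑ ^ (1 - (N : ℝ)) := by
  have hm : Measurable ((Metric.ball (0 : EuclideanSpace ℝ (Fin N)) r).indicator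
      fun z => ‖z‖ₑ ^ (1 - (N : ℝ))) := measurable_rieszKernel.indicator measurableSet_ball
  have h := lintegral_comp_const_smul hm hr
  have h2 : ∀ z : EuclideanSpace ℝ (Fin N), (Metric.ball (0 : EuclideanSpace ℝ (Fin N)) r).indicator
      (fun z => ‖z‖ₑ ^ (1 - (N : ℝ))) (r • z) = ENNReal.ofReal (r ^ (1 - (N : ℝ))) *
      (Metric.ball (0 : EuclideanSpace ℝ (Fin N)) 1).indicator
      (fun z => ‖z‖ₑ ^ (1 - (N : ℝ))) z := by
    intro z
    by_cases hz : z ∈ Metric.ball (0 : EuclideanSpace ℝ (Fin N)) 1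
    · have hz' : r • z ∈ Metric.ball (0 : EuclideanSpace ℝ (Fin N)) r := by
        simp only [mem_ball_zero_iff, norm_smul, Real.norm_eq_abs, abs_of_pos hr] at hz ⊢
        nlinarith
      rw [Set.indicator_of_mem hz, Set.indicator_of_mem hz', enorm_smul,
        Real.enorm_eq_ofReal hr.le, ENNReal.mul_rpow_of_ne_top (by simp) (by simp),
        ENNReal.ofReal_rpow_of_pos hr]
    · have hz' : r • z ∉ Metric.ball (0 : EuclideanSpace ℝ (Fin N)) r := by
        simp only [mem_ball_zero_iff, norm_smul, Real.norm_eq_abs, abs_of_pos hr] at hz ⊢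
        nlinarith
      rw [Set.indicator_of_notMem hz, Set.indicator_of_notMem hz', mul_zero]
  simp_rw [h2] at h
  rw [lintegral_const_mul _ (measurable_rieszKernel.indicator measurableSet_ball),
    lintegral_indicator measurableSet_ball, lintegral_indicator measurableSet_ball] at h
  have e : ENNReal.ofReal (r ^ N) * ENNReal.ofReal ((r ^ N)⁻¹) = 1 := by
    rw [← ENNReal.ofReal_mul (by positivity), mul_inv_cancel₀ (by positivity), ENNReal.ofReal_one]
  have e2 : ENNReal.ofReal (r ^ N) * ENNReal.ofReal (r ^ (1 - (N : ℝ))) = ENNReal.ofReal r := by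
    rw [← ENNReal.ofReal_mul (by positivity), ← Real.rpow_natCast, ← Real.rpow_add hr]
    simp
  rw [← one_mul (∫⁻ z in Metric.ball (0 : EuclideanSpace ℝ (Fin N)) r, _), ← e, mul_assoc, ← h,
    ← mul_assoc, e2]

theorem exists_lintegral_rieszKernel_le {N : ℕ} (hN : 2 ≤ N) : ∃ C : ℝ≥0∞, C ≠ ⊤ ∧
    ∀ (y : EuclideanSpace ℝ (Fin N)) (s : Set (EuclideanSpace ℝ (Fin N))), volume s ≠ ⊤ →
      MeasurableSet s → ∫⁻ x in s, ‖y - x‖ₑ ^ (1 - (N : ℝ)) ≤ C * volume s ^ (1 / (N : ℝ)) := by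
  have hN' : (2 : ℝ) ≤ N := by exact_mod_cast hN
  refine ⟨(∫⁻ z in Metric.ball (0 : EuclideanSpace ℝ (Fin N)) 1, ‖z‖ₑ ^ (1 - (N : ℝ))) + 1, ?_, ?_⟩
  · exact ENNReal.add_ne_top.2 ⟨(lintegral_rieszKernel_ball_lt_top hN).ne, by simp⟩
  intro y s hs hsm
  rcases eq_or_ne (volume s) 0 with h0 | h0
  · rw [setLIntegral_measure_zero _ _ h0]; simp
  set r : ℝ := (volume s).toReal ^ (1 / (N : ℝ)) with hr
  have hpos : 0 < (volume s).toReal := ENNReal.toReal_pos h0 hs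
  have hr0 : 0 < r := by positivity
  have hvol : volume s = ENNReal.ofReal (r ^ (N : ℝ)) := by
    rw [hr, ← Real.rpow_mul hpos.le, one_div, inv_mul_cancel₀ (by linarith), Real.rpow_one,
      ENNReal.ofReal_toReal hs]
  have hvr : volume s ^ (1 / (N : ℝ)) = ENNReal.ofReal r := by
    rw [hr, ← ENNReal.ofReal_rpow_of_pos hpos, ENNReal.ofReal_toReal hs]
  set k : EuclideanSpace ℝ (Fin N) → ℝ≥0∞ := fun x => ‖y - x‖ₑ ^ (1 - (N : ℝ))
  have hk : Measurable k := measurable_rieszKernel.comp (by fun_prop)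
  have h1 : ∫⁻ x in s ∩ Metric.ball y r, k x ≤
      ENNReal.ofReal r * ∫⁻ z in Metric.ball (0 : EuclideanSpace ℝ (Fin N)) 1,
        ‖z‖ₑ ^ (1 - (N : ℝ)) := by
    rw [← lintegral_rieszKernel_ball hr0]
    refine (lintegral_mono_set Set.inter_subset_right).trans ?_
    rw [← lintegral_indicator measurableSet_ball, ← lintegral_indicator measurableSet_ball,
      ← lintegral_sub_left_eq_self _ y]
    refine lintegral_mono fun x => le_of_eq ?_
    simp only [Set.indicator, k, sub_sub_cancel, Metric.mem_ball, dist_self_sub_left,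
      dist_zero_right]
  have h2 : ∫⁻ x in s \ Metric.ball y r, k x ≤ ENNReal.ofReal r := by
    calc ∫⁻ x in s \ Metric.ball y r, k x
        ≤ ∫⁻ x in s \ Metric.ball y r, ENNReal.ofReal (r ^ (1 - (N : ℝ))) := by
          refine setLIntegral_mono' (hsm.diff measurableSet_ball) ?_
          intro x hx
          have hx2 : r ≤ ‖y - x‖ := by
            have := hx.2
            rwa [Metric.mem_ball, not_lt, dist_comm, dist_eq_norm] at this
          simp only [k]
          rw [← ofReal_norm, ENNReal.ofReal_rpow_of_pos (hr0.trans_le hx2)]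
          exact ENNReal.ofReal_le_ofReal
            (Real.rpow_le_rpow_of_nonpos hr0 hx2 (by linarith))
      _ ≤ ENNReal.ofReal (r ^ (1 - (N : ℝ))) * volume s := by
          rw [setLIntegral_const]
          gcongr
          exact Set.sdiff_subset
      _ = ENNReal.ofReal r := by
          rw [hvol, ← ENNReal.ofReal_mul (by positivity), ← Real.rpow_add hr0]
          simp
  calc ∫⁻ x in s, k x = (∫⁻ x in s ∩ Metric.ball y r, k x) + ∫⁻ x in s \ Metric.ball y r, k x :=
        (lintegral_inter_add_sdiff _ _ measurableSet_ball).symm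
    _ ≤ _ := add_le_add h1 h2
    _ = _ := by rw [hvr, add_mul, one_mul, mul_comm (ENNReal.ofReal r)]

theorem exists_closedBall_subset_finiteCone {N : ℕ} {ρ κ : ℝ} (hρ : 0 < ρ) (hκ : 0 < κ)
    (hκπ : κ ≤ Real.pi) : ∃ c : ℝ, 0 < c ∧ ∀ x v : EuclideanSpace ℝ (Fin N), v ≠ 0 →
      ∀ z ∈ Metric.closedBall (x + (ρ / 2) • (‖v‖⁻¹ • v)) c, ‖z - x‖ ≤ ρ ∧
        ∀ t : ℝ, 0 < t → t ≤ 1 → x + t • (z - x) ∈ finiteCone x v ρ κ := by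
  have hc1 : Real.cos (κ / 2) < 1 := by
    rw [← Real.cos_zero]
    exact Real.cos_lt_cos_of_nonneg_of_le_pi le_rfl (by linarith) (by linarith)
  have hc0 : 0 ≤ Real.cos (κ / 2) := Real.cos_nonneg_of_mem_Icc ⟨by linarith, by linarith⟩
  obtain ⟨η, hη⟩ : ∃ η, η = (1 - Real.cos (κ / 2)) / 2 := ⟨_, rfl⟩
  have hη0 : 0 < η := by linarith
  refine ⟨ρ / 2 * η, by positivity, ?_⟩
  intro x v hv z hz
  have hv0 : 0 < ‖v‖ := norm_pos_iff.2 hv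
  obtain ⟨e, he⟩ : ∃ e, e = ‖v‖⁻¹ • v := ⟨_, rfl⟩
  have he1 : ‖e‖ = 1 := by rw [he, norm_smul, norm_inv, norm_norm, inv_mul_cancel₀ hv0.ne']
  obtain ⟨d, hd⟩ : ∃ d, d = z - x := ⟨_, rfl⟩
  have hdz : ‖d - (ρ / 2) • e‖ ≤ ρ / 2 * η := by
    rw [Metric.mem_closedBall, dist_eq_norm] at hz
    rwa [hd, he, sub_sub]
  have hin : ρ / 2 * (1 - η) ≤ inner ℝ d e := by
    have h1 : inner ℝ d e = inner ℝ (d - (ρ / 2) • e) e + ρ / 2 := by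
      rw [inner_sub_left, real_inner_smul_left, real_inner_self_eq_norm_sq, he1]; ring
    have h2 := abs_real_inner_le_norm (d - (ρ / 2) • e) e
    rw [he1, mul_one] at h2
    have := (abs_le.1 (h2.trans hdz)).1
    rw [h1]; linarith
  have hdn : ‖d‖ ≤ ρ / 2 * (1 + η) := by
    have h1 : ‖d‖ ≤ ‖d - (ρ / 2) • e‖ + ‖(ρ / 2) • e‖ := norm_le_norm_sub_add _ _
    rw [norm_smul, he1, Real.norm_eq_abs, abs_of_pos (by positivity), mul_one] at h1
    linarith
  have hdpos : 0 < ‖d‖ := by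
    rw [norm_pos_iff]
    rintro rfl
    rw [inner_zero_left] at hin
    nlinarith
  have hdρ : ‖d‖ ≤ ρ := by nlinarith
  have hang : InnerProductGeometry.angle d v ≤ κ / 2 := by
    have h0 : InnerProductGeometry.angle d v = InnerProductGeometry.angle d e := by
      rw [he, InnerProductGeometry.angle_smul_right_of_pos _ _ (by positivity)]
    rw [h0, InnerProductGeometry.angle, he1, mul_one,
      ← Real.arccos_cos (by linarith : 0 ≤ κ / 2) (by linarith)]
    refine Real.arccos_le_arccos ?_
    rw [le_div_iff₀ hdpos]
    have : Real.cos (κ / 2) = 1 - 2 * η := by linarith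
    calc Real.cos (κ / 2) * ‖d‖ ≤ Real.cos (κ / 2) * (ρ / 2 * (1 + η)) := by gcongr
      _ ≤ ρ / 2 * (1 - η) := by rw [this]; nlinarith [mul_pos hρ (mul_pos hη0 hη0)]
      _ ≤ _ := hin
  refine ⟨by rwa [← hd], fun t ht ht1 => Or.inr ?_⟩
  rw [← hd, add_sub_cancel_left, norm_smul, Real.norm_eq_abs, abs_of_pos ht,
    InnerProductGeometry.angle_smul_left_of_pos _ _ ht]
  exact ⟨by positivity, by nlinarith, hang⟩

theorem lintegral_inv_pow_le {N : ℕ} (hN : 2 ≤ N) {ρ : ℝ} (hρ : 0 < ρ)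
    (y : EuclideanSpace ℝ (Fin N)) :
    ∫⁻ t in Set.Ioc (0 : ℝ) 1, ENNReal.ofReal ((t ^ N)⁻¹) *
        (if ‖y‖ ≤ t * ρ then 1 else 0) ≤
      ENNReal.ofReal (ρ ^ ((N : ℝ) - 1)) * ‖y‖ₑ ^ (1 - (N : ℝ)) := by
  have hN' : (2 : ℝ) ≤ N := by exact_mod_cast hN
  rcases eq_or_ne y 0 with rfl | hy
  · rw [enorm_zero, ENNReal.zero_rpow_of_neg (by linarith), ENNReal.mul_top]
    · exact le_top
    · simpa using Real.rpow_pos_of_pos hρ _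
  have hy0 : 0 < ‖y‖ := norm_pos_iff.2 hy
  have hs : 0 < ‖y‖ / ρ := by positivity
  have hi := integral_Ioi_rpow_of_lt (a := -(N : ℝ)) (by linarith) hs
  have hint := integrableOn_Ioi_rpow_of_lt (a := -(N : ℝ)) (by linarith) hs
  calc ∫⁻ t in Set.Ioc (0 : ℝ) 1, ENNReal.ofReal ((t ^ N)⁻¹) * (if ‖y‖ ≤ t * ρ then 1 else 0)
      ≤ ∫⁻ t in Set.Ici (‖y‖ / ρ), ENNReal.ofReal (t ^ (-(N : ℝ))) := by
        rw [← lintegral_indicator measurableSet_Ioc, ← lintegral_indicator measurableSet_Ici]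
        refine lintegral_mono fun t => ?_
        by_cases ht : t ∈ Set.Ioc (0 : ℝ) 1
        · rw [Set.indicator_of_mem ht]
          by_cases h : ‖y‖ ≤ t * ρ
          · have h' : t ∈ Set.Ici (‖y‖ / ρ) := by
              rw [Set.mem_Ici, div_le_iff₀ hρ]; exact h
            rw [Set.indicator_of_mem h', if_pos h, mul_one, Real.rpow_neg ht.1.le,
              Real.rpow_natCast]
          · rw [if_neg h, mul_zero]; exact zero_le
        · rw [Set.indicator_of_notMem ht]; exact zero_le
    _ = ∫⁻ t in Set.Ioi (‖y‖ / ρ), ENNReal.ofReal (t ^ (-(N : ℝ))) := by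
        rw [Measure.restrict_congr_set Ioi_ae_eq_Ici]
    _ = ENNReal.ofReal (∫ t in Set.Ioi (‖y‖ / ρ), t ^ (-(N : ℝ))) := by
        rw [ofReal_integral_eq_lintegral_ofReal hint]
        filter_upwards [ae_restrict_mem measurableSet_Ioi] with t ht
        exact Real.rpow_nonneg (hs.le.trans (le_of_lt ht)) _
    _ ≤ _ := by
        rw [← ofReal_norm, ENNReal.ofReal_rpow_of_pos hy0,
          ← ENNReal.ofReal_mul (by positivity), hi]
        refine ENNReal.ofReal_le_ofReal ?_
        have e1 : -(N : ℝ) + 1 = 1 - N := by ring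
        rw [e1, Real.div_rpow hy0.le hρ.le, ← neg_div_neg_eq, neg_neg, neg_sub]
        have e2 : (ρ ^ (1 - (N : ℝ)))⁻¹ = ρ ^ ((N : ℝ) - 1) := by
          rw [← Real.rpow_neg hρ.le, neg_sub]
        rw [div_eq_mul_inv (‖y‖ ^ _), e2, mul_comm]
        exact div_le_self (by positivity) (by linarith)

theorem exists_enorm_le_lintegral_rieszKernel {N : ℕ} (hN : 2 ≤ N) {ρ κ : ℝ} (hρ : 0 < ρ)
    (hκ : 0 < κ) (hκπ : κ ≤ Real.pi) : ∃ C : ℝ≥0∞, C ≠ ⊤ ∧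
      ∀ (x v : EuclideanSpace ℝ (Fin N)) (K : Set (EuclideanSpace ℝ (Fin N)))
        (w : EuclideanSpace ℝ (Fin N) → ℝ), v ≠ 0 → ContDiff ℝ 1 w → MeasurableSet K →
        finiteCone x v ρ κ ⊆ K →
        ‖w x‖ₑ ≤ C * ∫⁻ y in K, ‖x - y‖ₑ ^ (1 - (N : ℝ)) * (‖fderiv ℝ w y‖ₑ + ‖w y‖ₑ) := by
  have hN' : (2 : ℝ) ≤ N := by exact_mod_cast hN
  obtain ⟨c, hc, hball⟩ := exists_closedBall_subset_finiteCone (N := N) hρ hκ hκπ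
  set V : ℝ≥0∞ := volume (Metric.closedBall (0 : EuclideanSpace ℝ (Fin N)) c) with hV
  have hV0 : V ≠ 0 := (Metric.measure_closedBall_pos volume _ hc).ne'
  have hVt : V ≠ ⊤ := measure_closedBall_lt_top.ne
  set R : ℝ≥0∞ := ENNReal.ofReal (ρ ^ ((N : ℝ) - 1)) with hR
  refine ⟨V⁻¹ * ((1 + ENNReal.ofReal ρ) * R), ?_, ?_⟩
  · exact ENNReal.mul_ne_top (ENNReal.inv_ne_top.2 hV0)
      (ENNReal.mul_ne_top (by simp) ENNReal.ofReal_ne_top)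
  intro x v K w hv hw hK hcone
  set B := Metric.closedBall (x + (ρ / 2) • (‖v‖⁻¹ • v)) c with hB
  have hBV : volume B = V := by rw [hB, hV, Measure.addHaar_closedBall_center]
  have hdw : Continuous (fderiv ℝ w) := hw.continuous_fderiv (by simp)
  have hwc : Continuous w := hw.continuous
  have hk : Measurable fun y : EuclideanSpace ℝ (Fin N) => ‖x - y‖ₑ ^ (1 - (N : ℝ)) :=
    measurable_rieszKernel.comp (by fun_prop)
  have hk1 : Measurable fun y => ‖x - y‖ₑ ^ (1 - (N : ℝ)) * ‖fderiv ℝ w y‖ₑ :=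
    hk.mul (by fun_prop)
  have hk2 : Measurable fun y => ‖x - y‖ₑ ^ (1 - (N : ℝ)) * ‖w y‖ₑ := hk.mul (by fun_prop)
  set h : EuclideanSpace ℝ (Fin N) → ℝ≥0∞ := K.indicator fun y => ‖fderiv ℝ w y‖ₑ with hh
  have hhm : Measurable h := (by fun_prop : Measurable fun y => ‖fderiv ℝ w y‖ₑ).indicator hK
  have hray : ∀ z ∈ B, ‖w x‖ₑ ≤ ‖w z‖ₑ +
      ENNReal.ofReal ρ * ∫⁻ t in Set.Ioc (0 : ℝ) 1, h (x + t • (z - x)) := by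
    intro z hz
    obtain ⟨hzx, hseg⟩ := hball x v hv z hz
    have hd : ∀ t : ℝ, HasDerivAt (fun t : ℝ => w (x + t • (z - x)))
        (fderiv ℝ w (x + t • (z - x)) (z - x)) t := by
      intro t
      have h1 : HasDerivAt (fun t : ℝ => x + t • (z - x)) (z - x) t := by
        simpa using ((hasDerivAt_id t).smul_const (z - x)).const_add x
      exact ((hw.differentiable (by simp)) (x + t • (z - x))).hasFDerivAt.comp_hasDerivAt t h1
    have hftc := intervalIntegral.integral_eq_sub_of_hasDerivAt (a := 0) (b := 1)
      (fun t _ => hd t) (by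
        apply Continuous.intervalIntegrable
        fun_prop)
    simp only [one_smul, zero_smul, add_zero, add_sub_cancel] at hftc
    have e : w x = w z - (w z - w x) := by ring
    rw [e]
    refine (enorm_sub_le).trans ?_
    gcongr
    rw [← hftc, intervalIntegral.integral_of_le zero_le_one]
    refine (enorm_integral_le_lintegral_enorm _).trans ?_
    rw [← lintegral_const_mul _ (by fun_prop)]
    refine setLIntegral_mono' measurableSet_Ioc ?_
    intro t ht
    rw [hh, Set.indicator_of_mem (hcone (hseg t ht.1 ht.2)), mul_comm]
    refine (ContinuousLinearMap.le_opENorm _ _).trans ?_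
    gcongr
    rw [← ofReal_norm]
    exact ENNReal.ofReal_le_ofReal hzx
  have hint : V * ‖w x‖ₑ ≤ (∫⁻ z in B, ‖w z‖ₑ) +
      ENNReal.ofReal ρ * ∫⁻ z in B, ∫⁻ t in Set.Ioc (0 : ℝ) 1, h (x + t • (z - x)) := by
    rw [← lintegral_const_mul _ (by fun_prop), ← lintegral_add_left (by fun_prop),
      mul_comm, ← hBV, ← setLIntegral_const]
    exact setLIntegral_mono' measurableSet_closedBall hray
  have hslice : ∀ t ∈ Set.Ioc (0 : ℝ) 1, ∫⁻ z in B, h (x + t • (z - x)) ≤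
      ∫⁻ y, ENNReal.ofReal ((t ^ N)⁻¹) * (if ‖y‖ ≤ t * ρ then 1 else 0) * h (x + y) := by
    intro t ht
    set G : EuclideanSpace ℝ (Fin N) → ℝ≥0∞ :=
      {y | ‖y‖ ≤ t * ρ}.indicator fun y => h (x + y) with hG
    have hGm : Measurable G := by
      refine (hhm.comp (by fun_prop)).indicator (measurableSet_le (by fun_prop) (by fun_prop))
    calc ∫⁻ z in B, h (x + t • (z - x)) ≤ ∫⁻ z in B, G (t • (z - x)) := by
          refine setLIntegral_mono' measurableSet_closedBall ?_
          intro z hz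
          rw [hG, Set.indicator_of_mem]
          rw [Set.mem_ofPred_eq, norm_smul, Real.norm_eq_abs, abs_of_pos ht.1]
          exact mul_le_mul_of_nonneg_left (hball x v hv z hz).1 ht.1.le
      _ ≤ ∫⁻ z, G (t • (z - x)) := setLIntegral_le_lintegral _ _
      _ = ∫⁻ z, G (t • z) := lintegral_sub_right_eq_self (fun z => G (t • z)) x
      _ = ENNReal.ofReal ((t ^ N)⁻¹) * ∫⁻ z, G z := lintegral_comp_const_smul hGm ht.1
      _ = _ := by
          rw [← lintegral_const_mul _ hGm]
          refine lintegral_congr fun y => ?_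
          rw [mul_assoc]
          congr 1
          simp only [hG, Set.indicator, Set.mem_ofPred_eq]
          split_ifs <;> simp
  have hgrad : ∫⁻ z in B, ∫⁻ t in Set.Ioc (0 : ℝ) 1, h (x + t • (z - x)) ≤
      R * ∫⁻ y in K, ‖x - y‖ₑ ^ (1 - (N : ℝ)) * ‖fderiv ℝ w y‖ₑ := by
    rw [lintegral_lintegral_swap (by
      refine Measurable.aemeasurable ?_
      exact hhm.comp (by fun_prop))]
    refine (setLIntegral_mono' measurableSet_Ioc hslice).trans ?_
    have hmeas : Measurable (fun p : ℝ × EuclideanSpace ℝ (Fin N) =>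
        ENNReal.ofReal ((p.1 ^ N)⁻¹) * (if ‖p.2‖ ≤ p.1 * ρ then (1 : ℝ≥0∞) else 0)) := by
      refine Measurable.mul (by fun_prop) ?_
      exact Measurable.ite (measurableSet_le (by fun_prop) (by fun_prop)) measurable_const
        measurable_const
    rw [lintegral_lintegral_swap (by
      refine Measurable.aemeasurable ?_
      exact Measurable.mul hmeas (hhm.comp (by fun_prop)))]
    calc _ = ∫⁻ y, (∫⁻ t in Set.Ioc (0 : ℝ) 1, ENNReal.ofReal ((t ^ N)⁻¹) *
          (if ‖y‖ ≤ t * ρ then 1 else 0)) * h (x + y) := by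
          refine lintegral_congr fun y => ?_
          rw [lintegral_mul_const]
          exact hmeas.comp (by fun_prop : Measurable fun t : ℝ => (t, y))
      _ ≤ ∫⁻ y, (R * ‖y‖ₑ ^ (1 - (N : ℝ))) * h (x + y) := by
          refine lintegral_mono fun y => ?_
          gcongr
          exact lintegral_inv_pow_le hN hρ y
      _ = ∫⁻ y, (R * ‖y - x‖ₑ ^ (1 - (N : ℝ))) * h y := by
          rw [← lintegral_sub_right_eq_self _ x]
          refine lintegral_congr fun y => ?_
          rw [add_sub_cancel]
      _ = _ := by
          rw [← lintegral_const_mul _ hk1, ← lintegral_indicator hK]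
          refine lintegral_congr fun y => ?_
          rw [hh]
          simp only [Set.indicator]
          split_ifs
          · rw [mul_assoc, enorm_sub_rev]
          · simp
  have hval : ∫⁻ z in B, ‖w z‖ₑ ≤ R * ∫⁻ y in K, ‖x - y‖ₑ ^ (1 - (N : ℝ)) * ‖w y‖ₑ := by
    have hBK : B ⊆ K := by
      intro z hz
      have := (hball x v hv z hz).2 1 one_pos le_rfl
      rw [one_smul, add_sub_cancel] at this
      exact hcone this
    rw [← lintegral_const_mul _ hk2]
    refine le_trans ?_ (lintegral_mono_set hBK)
    refine setLIntegral_mono' measurableSet_closedBall fun z hz => ?_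
    rw [← mul_assoc]
    refine le_mul_of_one_le_left zero_le ?_
    rcases eq_or_ne x z with rfl | hxz
    · rw [sub_self, enorm_zero, ENNReal.zero_rpow_of_neg (by linarith), ENNReal.mul_top]
      · exact le_top
      · simpa [hR] using Real.rpow_pos_of_pos hρ _
    · have h0 : 0 < ‖x - z‖ := norm_pos_iff.2 (sub_ne_zero.2 hxz)
      have h1 : ‖x - z‖ ≤ ρ := by rw [norm_sub_rev]; exact (hball x v hv z hz).1
      rw [hR, ← ofReal_norm, ENNReal.ofReal_rpow_of_pos h0, ← ENNReal.ofReal_mul (by positivity),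
        ENNReal.one_le_ofReal]
      calc (1 : ℝ) = ρ ^ ((N : ℝ) - 1) * ρ ^ (1 - (N : ℝ)) := by
            rw [← Real.rpow_add hρ]; simp
        _ ≤ _ := by
            gcongr ?_ * ?_
            exact Real.rpow_le_rpow_of_nonpos h0 h1 (by linarith)
  simp_rw [mul_add (‖x - _‖ₑ ^ (1 - (N : ℝ)))]
  rw [lintegral_add_left hk1]
  set I1 := ∫⁻ y in K, ‖x - y‖ₑ ^ (1 - (N : ℝ)) * ‖fderiv ℝ w y‖ₑ
  set I2 := ∫⁻ y in K, ‖x - y‖ₑ ^ (1 - (N : ℝ)) * ‖w y‖ₑ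
  calc ‖w x‖ₑ = V⁻¹ * (V * ‖w x‖ₑ) := by
        rw [← mul_assoc, ENNReal.inv_mul_cancel hV0 hVt, one_mul]
    _ ≤ V⁻¹ * (R * I2 + ENNReal.ofReal ρ * (R * I1)) := by
        gcongr
        exact hint.trans (by gcongr)
    _ ≤ V⁻¹ * ((1 + ENNReal.ofReal ρ) * (R * (I1 + I2))) := by
        gcongr
        rw [add_mul, one_mul]
        gcongr
        · exact le_add_self
        · exact le_self_add
    _ = _ := by ring

/-- `w` can be approximated on compact subsets of `Ω` by `C¹` functions whose `W^{1,1}` norms are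
asymptotically bounded by those of the pair `(w, F)`. -/
def HasC1Approx {N : ℕ} (Ω : Set (EuclideanSpace ℝ (Fin N))) (w : EuclideanSpace ℝ (Fin N) → ℝ)
    (F : EuclideanSpace ℝ (Fin N) → ℝ≥0∞) : Prop :=
  ∀ K ⊆ Ω, IsCompact K → ∃ W : ℕ → EuclideanSpace ℝ (Fin N) → ℝ,
    (∀ j, ContDiff ℝ 1 (W j)) ∧
    (∀ᵐ y ∂volume.restrict K, Filter.Tendsto (fun j => W j y) Filter.atTop (nhds (w y))) ∧
    Filter.limsup (fun j => ∫⁻ y in K, (‖fderiv ℝ (W j) y‖ₑ + ‖W j y‖ₑ)) Filter.atTop ≤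
      ∫⁻ y in K, (F y + ‖w y‖ₑ)

theorem isCompact_finiteCone {N : ℕ} {x v : EuclideanSpace ℝ (Fin N)} {ρ κ : ℝ} (hv : v ≠ 0)
    (hρ : 0 < ρ) (hκ : 0 < κ) (hκπ : κ ≤ Real.pi) : IsCompact (finiteCone x v ρ κ) := by
  have hv0 : 0 < ‖v‖ := norm_pos_iff.2 hv
  have e : finiteCone x v ρ κ = Metric.closedBall x ρ ∩
      {y | Real.cos (κ / 2) * (‖y - x‖ * ‖v‖) ≤ inner ℝ (y - x) v} := by
    ext y
    simp only [finiteCone, Set.mem_ofPred_eq, Set.mem_inter_iff, Metric.mem_closedBall,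
      dist_eq_norm]
    rcases eq_or_ne y x with rfl | hy
    · simp [hρ.le]
    · have h0 : 0 < ‖y - x‖ := norm_pos_iff.2 (sub_ne_zero.2 hy)
      simp only [hy, h0, false_or, true_and, and_congr_right_iff]
      intro _
      rw [← le_div_iff₀ (by positivity), InnerProductGeometry.angle]
      have hb := abs_le.1 (abs_real_inner_div_norm_mul_norm_le_one (y - x) v)
      constructor
      · intro h
        rw [← Real.cos_arccos hb.1 hb.2]
        exact Real.cos_le_cos_of_nonneg_of_le_pi (Real.arccos_nonneg _) (by linarith) h
      · intro h
        rw [← Real.arccos_cos (by linarith : 0 ≤ κ / 2) (by linarith)]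
        exact Real.arccos_le_arccos h
  rw [e]
  exact (isCompact_closedBall x ρ).inter_right (isClosed_le (by fun_prop) (by fun_prop))

theorem exists_compact_exhaustion {N : ℕ} {Ω : Set (EuclideanSpace ℝ (Fin N))}
    (hΩ : IsOpen Ω) : ∃ K : ℕ → Set (EuclideanSpace ℝ (Fin N)),
      (∀ n, IsCompact (K n)) ∧ Monotone K ∧ (∀ n, K n ⊆ Ω) ∧
      ∀ L ⊆ Ω, IsCompact L → ∃ n, L ⊆ K n := by
  refine ⟨fun n => Metric.closedBall 0 n ∩ {y | ((n : ℝ≥0∞) + 1)⁻¹ ≤ Metric.infEDist y Ωᶜ},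
    fun n => ?_, ?_, ?_, ?_⟩
  · exact (isCompact_closedBall _ _).inter_right
      (isClosed_le continuous_const Metric.continuous_infEDist)
  · intro m n hmn
    refine Set.inter_subset_inter (Metric.closedBall_subset_closedBall (by exact_mod_cast hmn)) ?_
    intro y hy
    refine le_trans (ENNReal.inv_le_inv.2 ?_) hy
    gcongr
  · rintro n y ⟨-, hy⟩
    by_contra h
    have h0 : Metric.infEDist y Ωᶜ = 0 := Metric.infEDist_zero_of_mem h
    have hy' : ((n : ℝ≥0∞) + 1)⁻¹ ≤ Metric.infEDist y Ωᶜ := hy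
    rw [h0, nonpos_iff_eq_zero, ENNReal.inv_eq_zero] at hy'
    exact ENNReal.add_ne_top.2 ⟨ENNReal.natCast_ne_top n, ENNReal.one_ne_top⟩ hy'
  · intro L hL hLc
    obtain ⟨R, hR⟩ := hLc.isBounded.subset_closedBall 0
    rcases L.eq_empty_or_nonempty with rfl | hne
    · exact ⟨0, Set.empty_subset _⟩
    obtain ⟨x, hx, hmin⟩ := hLc.exists_isMinOn hne
      (Metric.continuous_infEDist (s := Ωᶜ)).continuousOn
    have hpos : Metric.infEDist x Ωᶜ ≠ 0 := by
      rw [← pos_iff_ne_zero, Metric.infEDist_pos_iff_notMem_closure, hΩ.isClosed_compl.closure_eq]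
      exact fun h => h (hL hx)
    obtain ⟨n, hn⟩ := ENNReal.exists_inv_nat_lt hpos
    obtain ⟨m, hm⟩ := exists_nat_ge R
    refine ⟨max n m, fun y hy => ⟨?_, ?_⟩⟩
    · refine Metric.closedBall_subset_closedBall ?_ (hR hy)
      exact hm.trans (by exact_mod_cast le_max_right n m)
    · refine le_trans ?_ (hn.le.trans (hmin hy))
      refine ENNReal.inv_le_inv.2 ?_
      calc (n : ℝ≥0∞) ≤ ((max n m : ℕ) : ℝ≥0∞) := by exact_mod_cast le_max_left n m
        _ ≤ _ := le_self_add

theorem exists_lintegral_potential_le {N : ℕ} (hN : 2 ≤ N) : ∃ C : ℝ≥0∞, C ≠ ⊤ ∧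
    ∀ (T K : Set (EuclideanSpace ℝ (Fin N))) (f : EuclideanSpace ℝ (Fin N) → ℝ≥0∞),
      volume T ≠ ⊤ → MeasurableSet T → Measurable f →
      ∫⁻ x in T, ∫⁻ y in K, ‖x - y‖ₑ ^ (1 - (N : ℝ)) * f y ≤
        C * volume T ^ (1 / (N : ℝ)) * ∫⁻ y in K, f y := by
  obtain ⟨C, hC, h⟩ := exists_lintegral_rieszKernel_le hN
  refine ⟨C, hC, fun T K f hT hTm hf => ?_⟩
  have hk : Measurable fun p : EuclideanSpace ℝ (Fin N) × EuclideanSpace ℝ (Fin N) =>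
      ‖p.1 - p.2‖ₑ ^ (1 - (N : ℝ)) := measurable_rieszKernel.comp (by fun_prop)
  rw [lintegral_lintegral_swap (hk.mul (hf.comp measurable_snd)).aemeasurable,
    ← lintegral_const_mul _ hf]
  refine lintegral_mono fun y => ?_
  have hk' : Measurable fun x => ‖x - y‖ₑ ^ (1 - (N : ℝ)) :=
    measurable_rieszKernel.comp (by fun_prop)
  rw [lintegral_mul_const _ hk']
  gcongr
  simp_rw [enorm_sub_rev _ y]
  exact h y T hT hTm

theorem measure_le_rpow_of_mul_le {N : ℕ} (hN : 2 ≤ N) {lam m b : ℝ≥0∞} (hlam : lam ≠ 0)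
    (hlam' : lam ≠ ⊤) (hm : m ≠ ⊤) (h : lam * m ≤ b * m ^ (1 / (N : ℝ))) :
    m ≤ (b / lam) ^ ((N : ℝ) / (N - 1)) := by
  have hN' : (2 : ℝ) ≤ N := by exact_mod_cast hN
  rcases eq_or_ne m 0 with rfl | hm0
  · exact zero_le
  have h1 : m ^ (((N : ℝ) - 1) / N) ≤ b / lam := by
    rw [ENNReal.le_div_iff_mul_le (Or.inl hlam) (Or.inl hlam')]
    have e : m ^ (((N : ℝ) - 1) / N) = m * m ^ (-(1 / (N : ℝ))) := by
      nth_rewrite 2 [← ENNReal.rpow_one m]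
      rw [← ENNReal.rpow_add _ _ hm0 hm]
      congr 1
      field_simp
      ring
    have e2 : m ^ (1 / (N : ℝ)) * m ^ (-(1 / (N : ℝ))) = 1 := by
      rw [← ENNReal.rpow_add _ _ hm0 hm, add_neg_cancel, ENNReal.rpow_zero]
    calc m ^ (((N : ℝ) - 1) / N) * lam = (lam * m) * m ^ (-(1 / (N : ℝ))) := by rw [e]; ring
      _ ≤ (b * m ^ (1 / (N : ℝ))) * m ^ (-(1 / (N : ℝ))) := by gcongr
      _ = b := by rw [mul_assoc, e2, mul_one]
  calc m = (m ^ (((N : ℝ) - 1) / N)) ^ ((N : ℝ) / (N - 1)) := by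
        rw [← ENNReal.rpow_mul]
        have : ((N : ℝ) - 1) / N * (N / (N - 1)) = 1 := by
          have : (N : ℝ) - 1 ≠ 0 := by linarith
          field_simp
        rw [this, ENNReal.rpow_one]
    _ ≤ _ := ENNReal.rpow_le_rpow h1 (div_nonneg (by linarith) (by linarith))

theorem exists_measure_superlevel_le {N : ℕ} (hN : 2 ≤ N) {Ω : Set (EuclideanSpace ℝ (Fin N))}
    (hΩ : IsOpen Ω) (hcone : ConeProperty Ω) : ∃ C : ℝ≥0∞, C ≠ ⊤ ∧
      ∀ (w : EuclideanSpace ℝ (Fin N) → ℝ) (F : EuclideanSpace ℝ (Fin N) → ℝ≥0∞),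
        HasC1Approx Ω w F → ∀ (lam : ℝ≥0∞) (s : Set (EuclideanSpace ℝ (Fin N))),
          lam ≠ 0 → lam ≠ ⊤ → s ⊆ Ω → (∀ x ∈ s, lam ≤ ‖w x‖ₑ) →
          volume s ≤ (C * (∫⁻ y in Ω, (F y + ‖w y‖ₑ)) / lam) ^ ((N : ℝ) / (N - 1)) := by
  obtain ⟨ρ, κ, hρ, hκ, hκπ, hcone⟩ := hcone
  obtain ⟨C1, hC1, hpt⟩ := exists_enorm_le_lintegral_rieszKernel hN hρ hκ hκπ
  obtain ⟨C2, hC2, hpot⟩ := exists_lintegral_potential_le hN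
  refine ⟨C1 * C2, ENNReal.mul_ne_top hC1 hC2, ?_⟩
  intro w F hw lam s hlam hlam' hsΩ hs
  set b := ∫⁻ y in Ω, (F y + ‖w y‖ₑ) with hb
  have key : ∀ K ⊆ Ω, IsCompact K →
      volume (s ∩ {x | ∃ v, v ≠ 0 ∧ finiteCone x v ρ κ ⊆ K}) ≤
        (C1 * C2 * b / lam) ^ ((N : ℝ) / (N - 1)) := by
    intro K hKΩ hK
    obtain ⟨W, hWc, hWt, hWl⟩ := hw K hKΩ hK
    set f : ℕ → EuclideanSpace ℝ (Fin N) → ℝ≥0∞ := fun j y => ‖fderiv ℝ (W j) y‖ₑ + ‖W j y‖ₑ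
      with hf
    have hWm : ∀ j, Measurable fun y => ‖W j y‖ₑ := fun j => by
      have := (hWc j).continuous
      fun_prop
    have hfm : ∀ j, Measurable (f j) := fun j => by
      have h1 : Continuous (fderiv ℝ (W j)) := (hWc j).continuous_fderiv (by simp)
      exact Measurable.add (by fun_prop) (hWm j)
    have hIm : ∀ j, Measurable fun x => ∫⁻ y in K, ‖x - y‖ₑ ^ (1 - (N : ℝ)) * f j y := fun j => by
      have hk : Measurable fun p : EuclideanSpace ℝ (Fin N) × EuclideanSpace ℝ (Fin N) =>
        ‖p.1 - p.2‖ₑ ^ (1 - (N : ℝ)) := measurable_rieszKernel.comp (by fun_prop)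
      exact Measurable.lintegral_prod_right' (hk.mul ((hfm j).comp measurable_snd))
    set T : Set (EuclideanSpace ℝ (Fin N)) := K ∩ ((⋂ j, {x | ‖W j x‖ₑ ≤ C1 *
      ∫⁻ y in K, ‖x - y‖ₑ ^ (1 - (N : ℝ)) * f j y}) ∩
      {x | lam ≤ Filter.liminf (fun j => ‖W j x‖ₑ) Filter.atTop}) with hT
    have hTm : MeasurableSet T := by
      refine hK.measurableSet.inter (MeasurableSet.inter ?_ ?_)
      · exact MeasurableSet.iInter fun j => measurableSet_le (hWm j) ((hIm j).const_mul _)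
      · exact measurableSet_le measurable_const (Measurable.liminf hWm)
    have hTt : volume T ≠ ⊤ := measure_ne_top_of_subset Set.inter_subset_left hK.measure_ne_top
    have hsT : volume (s ∩ {x | ∃ v, v ≠ 0 ∧ finiteCone x v ρ κ ⊆ K}) ≤ volume T := by
      rw [ae_restrict_iff' hK.measurableSet] at hWt
      refine measure_mono_ae ?_
      filter_upwards [hWt] with x hx
      rintro ⟨hxs, v, hv, hxv⟩
      have hxK : x ∈ K := hxv (Or.inl rfl)
      refine ⟨hxK, Set.mem_iInter.2 fun j => hpt x v K (W j) hv (hWc j) hK.measurableSet hxv, ?_⟩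
      have : Filter.Tendsto (fun j => ‖W j x‖ₑ) Filter.atTop (nhds ‖w x‖ₑ) :=
        (continuous_enorm.tendsto _).comp (hx hxK)
      show lam ≤ _
      rw [this.liminf_eq]
      exact hs x hxs
    refine hsT.trans (measure_le_rpow_of_mul_le hN hlam hlam' hTt ?_)
    calc lam * volume T = ∫⁻ x in T, lam := (setLIntegral_const _ _).symm
      _ ≤ ∫⁻ x in T, Filter.liminf (fun j => ‖W j x‖ₑ) Filter.atTop :=
          setLIntegral_mono' hTm fun x hx => hx.2.2
      _ ≤ Filter.liminf (fun j => ∫⁻ x in T, ‖W j x‖ₑ) Filter.atTop := lintegral_liminf_le hWm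
      _ ≤ Filter.limsup (fun j => ∫⁻ x in T, ‖W j x‖ₑ) Filter.atTop := Filter.liminf_le_limsup
      _ ≤ Filter.limsup (fun j => C1 * (C2 * volume T ^ (1 / (N : ℝ))) * ∫⁻ y in K, f j y)
            Filter.atTop := by
          refine Filter.limsup_le_limsup (Filter.Eventually.of_forall fun j => ?_)
          calc ∫⁻ x in T, ‖W j x‖ₑ
              ≤ ∫⁻ x in T, C1 * ∫⁻ y in K, ‖x - y‖ₑ ^ (1 - (N : ℝ)) * f j y :=
                setLIntegral_mono' hTm fun x hx => Set.mem_iInter.1 hx.2.1 j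
            _ = C1 * ∫⁻ x in T, ∫⁻ y in K, ‖x - y‖ₑ ^ (1 - (N : ℝ)) * f j y :=
                lintegral_const_mul _ (hIm j)
            _ ≤ C1 * (C2 * volume T ^ (1 / (N : ℝ)) * ∫⁻ y in K, f j y) := by
                gcongr
                exact hpot T K (f j) hTt hTm (hfm j)
            _ = _ := by ring
      _ = C1 * (C2 * volume T ^ (1 / (N : ℝ))) *
            Filter.limsup (fun j => ∫⁻ y in K, f j y) Filter.atTop := by
          refine ENNReal.limsup_const_mul_of_ne_top ?_
          exact ENNReal.mul_ne_top hC1 (ENNReal.mul_ne_top hC2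
            (ENNReal.rpow_ne_top_of_nonneg (by positivity) hTt))
      _ ≤ C1 * (C2 * volume T ^ (1 / (N : ℝ))) * b := by
          gcongr
          exact hWl.trans (lintegral_mono_set hKΩ)
      _ = _ := by ring
  obtain ⟨K, hKc, hKm, hKΩ, hKex⟩ : ∃ K : ℕ → Set (EuclideanSpace ℝ (Fin N)),
      (∀ n, IsCompact (K n)) ∧ Monotone K ∧ (∀ n, K n ⊆ Ω) ∧
      ∀ L ⊆ Ω, IsCompact L → ∃ n, L ⊆ K n := exists_compact_exhaustion hΩ
  have hmono : Monotone fun n => s ∩ {x | ∃ v, v ≠ 0 ∧ finiteCone x v ρ κ ⊆ K n} := by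
    intro m n hmn x hx
    obtain ⟨hxs, v, hv, hxv⟩ := hx
    exact ⟨hxs, v, hv, hxv.trans (hKm hmn)⟩
  have hunion : s = ⋃ n, s ∩ {x | ∃ v, v ≠ 0 ∧ finiteCone x v ρ κ ⊆ K n} := by
    refine Set.Subset.antisymm (fun x hx => ?_) (Set.iUnion_subset fun n => Set.inter_subset_left)
    obtain ⟨v, hv, hxv⟩ := hcone x (hsΩ hx)
    obtain ⟨n, hn⟩ := hKex _ hxv (isCompact_finiteCone hv hρ hκ hκπ)
    exact Set.mem_iUnion.2 ⟨n, hx, v, hv, hn⟩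
  rw [hunion, hmono.measure_iUnion]
  exact iSup_le fun n => key (K n) (hKΩ n) (hKc n)

/-- A sequence of bump functions at the origin with radii tending to `0`. -/
noncomputable def bump (N j : ℕ) : ContDiffBump (0 : EuclideanSpace ℝ (Fin N)) where
  rIn := 1 / (j + 1 : ℝ) / 2
  rOut := 1 / (j + 1 : ℝ)
  rIn_pos := by positivity
  rIn_lt_rOut := half_lt_self (by positivity)

theorem bump_rOut (N j : ℕ) : (bump N j).rOut = 1 / (j + 1 : ℝ) := rfl

theorem bump_rOut_le_one (N j : ℕ) : (bump N j).rOut ≤ 1 := by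
  rw [bump_rOut, div_le_one (by positivity)]
  linarith [(Nat.cast_nonneg j : (0 : ℝ) ≤ j)]

theorem tendsto_bump_rOut (N : ℕ) :
    Filter.Tendsto (fun j => (bump N j).rOut) Filter.atTop (nhds 0) :=
  tendsto_one_div_add_atTop_nhds_zero_nat

/-- Mollification of `f` at scale `1 / (j + 1)`. -/
noncomputable def mollify {N : ℕ} (j : ℕ) (f : EuclideanSpace ℝ (Fin N) → ℝ) :
    EuclideanSpace ℝ (Fin N) → ℝ :=
  convolution ((bump N j).normed volume) f (ContinuousLinearMap.lsmul ℝ ℝ) volume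

theorem mollify_apply {N : ℕ} (j : ℕ) (f : EuclideanSpace ℝ (Fin N) → ℝ)
    (y : EuclideanSpace ℝ (Fin N)) :
    mollify j f y = ∫ t, (bump N j).normed volume t * f (y - t) := rfl

theorem contDiff_mollify {N : ℕ} (j : ℕ) {f : EuclideanSpace ℝ (Fin N) → ℝ}
    (hf : LocallyIntegrable f) : ContDiff ℝ 1 (mollify j f) :=
  HasCompactSupport.contDiff_convolution_left (n := 1) _ (bump N j).hasCompactSupport_normed
    (bump N j).contDiff_normed hf

theorem ae_tendsto_mollify {N : ℕ} {f : EuclideanSpace ℝ (Fin N) → ℝ}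
    (hf : LocallyIntegrable f) :
    ∀ᵐ y, Filter.Tendsto (fun j => mollify j f y) Filter.atTop (nhds (f y)) := by
  refine ContDiffBump.ae_convolution_tendsto_right_of_locallyIntegrable (K := 2)
    (tendsto_bump_rOut N) (Filter.Eventually.of_forall fun j => ?_) hf
  show 1 / ((j : ℝ) + 1) ≤ 2 * (1 / (j + 1 : ℝ) / 2)
  linarith

theorem tendsto_mollify {N : ℕ} {f : EuclideanSpace ℝ (Fin N) → ℝ} (hf : Continuous f)
    (y : EuclideanSpace ℝ (Fin N)) :
    Filter.Tendsto (fun j => mollify j f y) Filter.atTop (nhds (f y)) :=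
  ContDiffBump.convolution_tendsto_right_of_continuous (tendsto_bump_rOut N) hf y

theorem integrable_bump_mul {N : ℕ} (j : ℕ) {f : EuclideanSpace ℝ (Fin N) → ℝ}
    (hf : LocallyIntegrable f) (y : EuclideanSpace ℝ (Fin N)) :
    Integrable fun t => (bump N j).normed volume t * f (y - t) :=
  (bump N j).hasCompactSupport_normed.convolutionExists_left (ContinuousLinearMap.lsmul ℝ ℝ)
    (bump N j).continuous_normed hf y

theorem mollify_mono {N : ℕ} (j : ℕ) {f g : EuclideanSpace ℝ (Fin N) → ℝ}
    (hf : LocallyIntegrable f) (hg : LocallyIntegrable g) (hfg : ∀ y, f y ≤ g y)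
    (y : EuclideanSpace ℝ (Fin N)) : mollify j f y ≤ mollify j g y := by
  rw [mollify_apply, mollify_apply]
  refine integral_mono (integrable_bump_mul j hf y) (integrable_bump_mul j hg y) fun t => ?_
  exact mul_le_mul_of_nonneg_left (hfg _) ((bump N j).nonneg_normed t)

theorem mollify_const {N : ℕ} (j : ℕ) (c : ℝ) (y : EuclideanSpace ℝ (Fin N)) :
    mollify j (fun _ => c) y = c := by
  rw [mollify_apply, integral_mul_const, (bump N j).integral_normed, one_mul]

theorem mollify_sub {N : ℕ} (j : ℕ) {f g : EuclideanSpace ℝ (Fin N) → ℝ}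
    (hf : LocallyIntegrable f) (hg : LocallyIntegrable g) (y : EuclideanSpace ℝ (Fin N)) :
    mollify j (fun x => f x - g x) y = mollify j f y - mollify j g y := by
  simp only [mollify_apply, mul_sub]
  exact integral_sub (integrable_bump_mul j hf y) (integrable_bump_mul j hg y)

theorem lipschitzWith_mollify {N : ℕ} (j : ℕ) {f : EuclideanSpace ℝ (Fin N) → ℝ} {L : NNReal}
    (hf : LipschitzWith L f) : LipschitzWith L (mollify j f) := by
  have hfl : LocallyIntegrable f := hf.continuous.locallyIntegrable
  refine LipschitzWith.of_le_add_mul _ fun x y => ?_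
  have h := integral_mono (f := fun t => (bump N j).normed volume t * f (x - t))
    (g := fun t => (bump N j).normed volume t * f (y - t) +
      (bump N j).normed volume t * (L * dist x y)) (integrable_bump_mul j hfl x)
    ((integrable_bump_mul j hfl y).add ((bump N j).integrable_normed.mul_const _)) (by
      intro t
      show _ ≤ _ * _ + _ * _
      rw [← mul_add]
      refine mul_le_mul_of_nonneg_left ?_ ((bump N j).nonneg_normed t)
      have := hf.le_add_mul (x - t) (y - t)
      rwa [dist_sub_right] at this)
  rw [integral_add (integrable_bump_mul j hfl y) ((bump N j).integrable_normed.mul_const _),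
    integral_mul_const, (bump N j).integral_normed, one_mul] at h
  exact h

theorem lintegral_enorm_mollify_le {N : ℕ} (j : ℕ) {f : EuclideanSpace ℝ (Fin N) → ℝ}
    (hf : Integrable f) : ∫⁻ y, ‖mollify j f y‖ₑ ≤ ∫⁻ y, ‖f y‖ₑ := by
  have hη : Measurable fun t => ‖(bump N j).normed volume t‖ₑ := by
    have := (bump N j).continuous_normed (μ := volume)
    fun_prop
  have hqp : Measure.QuasiMeasurePreserving
      (fun p : EuclideanSpace ℝ (Fin N) × EuclideanSpace ℝ (Fin N) => p.1 - p.2)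
      (volume.prod volume) volume := quasiMeasurePreserving_sub _ _
  calc ∫⁻ y, ‖mollify j f y‖ₑ
      ≤ ∫⁻ y, ∫⁻ t, ‖(bump N j).normed volume t‖ₑ * ‖f (y - t)‖ₑ := by
        refine lintegral_mono fun y => ?_
        rw [mollify_apply]
        refine (enorm_integral_le_lintegral_enorm _).trans (le_of_eq ?_)
        simp_rw [enorm_mul]
    _ = ∫⁻ t, ∫⁻ y, ‖(bump N j).normed volume t‖ₑ * ‖f (y - t)‖ₑ := by
        refine lintegral_lintegral_swap ?_
        refine AEMeasurable.mul (hη.comp measurable_snd).aemeasurable ?_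
        exact (hf.aestronglyMeasurable.comp_quasiMeasurePreserving hqp).enorm
    _ = ∫⁻ t, ‖(bump N j).normed volume t‖ₑ * ∫⁻ y, ‖f y‖ₑ := by
        refine lintegral_congr fun t => ?_
        rw [lintegral_const_mul'' _
          (hf.comp_sub_right t).aestronglyMeasurable.enorm,
          lintegral_sub_right_eq_self (fun y => ‖f y‖ₑ) t]
    _ = ∫⁻ y, ‖f y‖ₑ := by
        rw [lintegral_mul_const _ hη]
        have : ∫⁻ t, ‖(bump N j).normed volume t‖ₑ = 1 := by
          have h := ofReal_integral_norm_eq_lintegral_enorm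
            (bump N j).integrable_normed (μ := volume)
          rw [← h]
          simp_rw [Real.norm_eq_abs, abs_of_nonneg ((bump N j).nonneg_normed _)]
          rw [(bump N j).integral_normed, ENNReal.ofReal_one]
        rw [this, one_mul]

theorem tendsto_lintegral_mollify_sub_of_continuous {N : ℕ} {h : EuclideanSpace ℝ (Fin N) → ℝ}
    (hc : Continuous h) (hs : HasCompactSupport h) :
    Filter.Tendsto (fun j => ∫⁻ y, ‖mollify j h y - h y‖ₑ) Filter.atTop (nhds 0) := by
  obtain ⟨M, hM⟩ := hs.exists_bound_of_continuous hc
  obtain ⟨R, hR⟩ := hs.isBounded.subset_closedBall 0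
  have hbound : ∀ j y, ‖mollify j h y - h y‖ ≤
      (Metric.closedBall (0 : EuclideanSpace ℝ (Fin N)) (R + 1)).indicator (fun _ => 2 * M) y := by
    intro j y
    rw [← dist_eq_norm]
    refine ContDiffBump.dist_normed_convolution_le hc.aestronglyMeasurable fun x hx => ?_
    by_cases hy : y ∈ Metric.closedBall (0 : EuclideanSpace ℝ (Fin N)) (R + 1)
    · rw [Set.indicator_of_mem hy, dist_eq_norm]
      linarith [norm_sub_le (h x) (h y), hM x, hM y]
    · rw [Set.indicator_of_notMem hy]
      rw [mem_closedBall_zero_iff, not_le] at hy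
      have hxy : ‖y‖ < ‖x‖ + 1 := by
        have h1 : dist x y < 1 := lt_of_lt_of_le hx (bump_rOut_le_one N j)
        rw [dist_comm, dist_eq_norm] at h1
        linarith [norm_le_norm_sub_add y x]
      have hz : ∀ z : EuclideanSpace ℝ (Fin N), R < ‖z‖ → h z = 0 := by
        intro z hz
        refine image_eq_zero_of_notMem_tsupport fun hz' => ?_
        have := hR hz'
        rw [mem_closedBall_zero_iff] at this
        linarith
      rw [hz x (by linarith), hz y (by linarith), dist_self]
  have hlim := tendsto_lintegral_of_dominated_convergence
    (μ := (volume : Measure (EuclideanSpace ℝ (Fin N))))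
    (F := fun j y => ‖mollify j h y - h y‖ₑ) (f := fun _ => 0)
    (fun y => ENNReal.ofReal
      ((Metric.closedBall (0 : EuclideanSpace ℝ (Fin N)) (R + 1)).indicator (fun _ => 2 * M) y))
    (fun j => by
      have h1 : Continuous (mollify j h) := (contDiff_mollify j hc.locallyIntegrable).continuous
      fun_prop)
    (fun j => Filter.Eventually.of_forall fun y => by
      show ‖mollify j h y - h y‖ₑ ≤ _
      rw [← ofReal_norm]
      exact ENNReal.ofReal_le_ofReal (hbound j y))
    (by
      refine Integrable.lintegral_lt_top ?_ |>.ne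
      rw [integrable_indicator_iff measurableSet_closedBall]
      exact integrableOn_const measure_closedBall_lt_top.ne)
    (Filter.Eventually.of_forall fun y => by
      have h1 : Filter.Tendsto (fun j => mollify j h y - h y) Filter.atTop (nhds (h y - h y)) :=
        (tendsto_mollify hc y).sub_const _
      rw [sub_self] at h1
      have h2 := (continuous_enorm.tendsto _).comp h1
      rwa [enorm_zero] at h2)
  simpa using hlim

theorem tendsto_lintegral_mollify_sub {N : ℕ} {f : EuclideanSpace ℝ (Fin N) → ℝ}
    (hf : Integrable f) :
    Filter.Tendsto (fun j => ∫⁻ y, ‖mollify j f y - f y‖ₑ) Filter.atTop (nhds 0) := by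
  rw [ENNReal.tendsto_nhds_zero]
  intro ε hε
  obtain ⟨δ, hδ, hδε⟩ : ∃ δ : ℝ, 0 < δ ∧ ENNReal.ofReal δ + ENNReal.ofReal δ +
      ENNReal.ofReal δ ≤ ε := by
    rcases eq_or_ne ε ⊤ with rfl | hεt
    · exact ⟨1, one_pos, le_top⟩
    · have h0 : 0 < ε.toReal := ENNReal.toReal_pos hε.ne' hεt
      refine ⟨ε.toReal / 3, by positivity, ?_⟩
      rw [← ENNReal.ofReal_add (by positivity) (by positivity),
        ← ENNReal.ofReal_add (by positivity) (by positivity)]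
      refine ENNReal.ofReal_le_of_le_toReal (by linarith)
  obtain ⟨h, hs, hfh, hc, hi⟩ := hf.exists_hasCompactSupport_integral_sub_le hδ
  have hfh' : ∫⁻ y, ‖f y - h y‖ₑ ≤ ENNReal.ofReal δ := by
    have h1 := ofReal_integral_norm_eq_lintegral_enorm (hf.sub hi)
    simp only [Pi.sub_apply] at h1
    rw [← h1]
    exact ENNReal.ofReal_le_ofReal hfh
  have hev := (ENNReal.tendsto_nhds_zero.1 (tendsto_lintegral_mollify_sub_of_continuous hc hs))
    (ENNReal.ofReal δ) (by simpa using hδ)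
  filter_upwards [hev] with j hj
  have hmc : ∀ {k : EuclideanSpace ℝ (Fin N) → ℝ}, Integrable k → Continuous (mollify j k) :=
    fun hk => (contDiff_mollify j hk.locallyIntegrable).continuous
  have hm1 := hmc (hf.sub hi)
  have hm2 := hmc hi
  calc ∫⁻ y, ‖mollify j f y - f y‖ₑ
      ≤ ∫⁻ y, (‖mollify j (f - h) y‖ₑ + ‖mollify j h y - h y‖ₑ + ‖f y - h y‖ₑ) := by
        refine lintegral_mono fun y => ?_
        have e : mollify j f y - f y =
            mollify j (f - h) y + (mollify j h y - h y) - (f y - h y) := by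
          have := mollify_sub j hf.locallyIntegrable hi.locallyIntegrable y
          have h2 : (f - h) = fun x => f x - h x := rfl
          rw [h2, this]
          ring
        rw [e]
        refine enorm_sub_le.trans ?_
        gcongr
        exact enorm_add_le _ _
    _ = (∫⁻ y, ‖mollify j (f - h) y‖ₑ) + (∫⁻ y, ‖mollify j h y - h y‖ₑ) +
          ∫⁻ y, ‖f y - h y‖ₑ := by
        rw [lintegral_add_left (by fun_prop), lintegral_add_left (by fun_prop)]
    _ ≤ ENNReal.ofReal δ + ENNReal.ofReal δ + ENNReal.ofReal δ := by
        gcongr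
        exact (lintegral_enorm_mollify_le j (hf.sub hi)).trans hfh'
    _ ≤ ε := hδε

theorem enorm_fderiv_mollify_le {N : ℕ} {Ω L : Set (EuclideanSpace ℝ (Fin N))}
    {u : EuclideanSpace ℝ (Fin N) → ℝ}
    {g : EuclideanSpace ℝ (Fin N) → EuclideanSpace ℝ (Fin N)} (hg : IsWeakGradient Ω u g)
    (hL : IsCompact L) (hLΩ : L ⊆ Ω) (j : ℕ) {y : EuclideanSpace ℝ (Fin N)}
    (hy : Metric.closedBall y (bump N j).rOut ⊆ L) :
    ‖fderiv ℝ (mollify j (L.indicator u)) y‖ₑ ≤ ‖mollify j (L.indicator fun x => ‖g x‖) y‖ₑ := by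
  set η := (bump N j).normed volume with hη
  have huL : Integrable (L.indicator u) :=
    (integrable_indicator_iff hL.measurableSet).2 (hg.1.integrableOn_compact_subset hLΩ hL)
  have hgL : Integrable (L.indicator g) :=
    (integrable_indicator_iff hL.measurableSet).2 (hg.2.1.integrableOn_compact_subset hLΩ hL)
  have hηd : ContDiff ℝ ∞ η := (bump N j).contDiff_normed
  have hηs : HasCompactSupport η := (bump N j).hasCompactSupport_normed
  have hηt : tsupport η = Metric.closedBall 0 (bump N j).rOut := (bump N j).tsupport_normed_eq
  have hηz : ∀ t, t ∉ L → η (y - t) = 0 := by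
    intro t ht
    refine image_eq_zero_of_notMem_tsupport fun h => ht (hy ?_)
    rwa [hηt, mem_closedBall_zero_iff, norm_sub_rev, ← mem_closedBall_iff_norm] at h
  have hdz : ∀ t, t ∉ L → fderiv ℝ η (y - t) = 0 := by
    intro t ht
    refine image_eq_zero_of_notMem_tsupport fun h => ht (hy ?_)
    have := tsupport_fderiv_subset ℝ h
    rwa [hηt, mem_closedBall_zero_iff, norm_sub_rev, ← mem_closedBall_iff_norm] at this
  set G : EuclideanSpace ℝ (Fin N) := ∫ t, η (y - t) • L.indicator g t with hG
  have hηc : Continuous fun t => η (y - t) := hηd.continuous.comp (by fun_prop)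
  have hηs' : HasCompactSupport fun t => η (y - t) :=
    hηs.comp_homeomorph (Homeomorph.subLeft y)
  have hGi : Integrable fun t => η (y - t) • L.indicator g t :=
    hgL.locallyIntegrable.integrable_smul_left_of_hasCompactSupport hηc hηs'
  have hpart : ∀ i, fderiv ℝ (mollify j (L.indicator u)) y (EuclideanSpace.single i 1) = G i := by
    intro i
    have h1 := (HasCompactSupport.hasFDerivAt_convolution_left (ContinuousLinearMap.lsmul ℝ ℝ)
      hηs (hηd.of_le (by norm_cast)) huL.locallyIntegrable y).fderiv
    have h2 : fderiv ℝ (mollify j (L.indicator u)) y (EuclideanSpace.single i 1) =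
        ∫ t, fderiv ℝ η (y - t) (EuclideanSpace.single i 1) * L.indicator u t := by
      have hex := (hηs.fderiv (𝕜 := ℝ)).convolutionExists_left
        (ContinuousLinearMap.precompL (EuclideanSpace ℝ (Fin N)) (ContinuousLinearMap.lsmul ℝ ℝ))
        (hηd.continuous_fderiv (by simp)) huL.locallyIntegrable y
      have h1' : fderiv ℝ (mollify j (L.indicator u)) y = _ := h1
      rw [h1', convolution_eq_swap, ContinuousLinearMap.integral_apply hex.integrable_swap]
      rfl
    have hts : tsupport (fun t => η (y - t)) ⊆ Ω := by
      refine (closure_minimal (fun t ht => ?_) hL.isClosed).trans hLΩ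
      by_contra h
      exact ht (hηz t h)
    have h3 := hg.2.2 (fun t => η (y - t)) (by fun_prop) hηs' hts i
    have hder : ∀ t, fderiv ℝ (fun t => η (y - t)) t (EuclideanSpace.single i 1) =
        -fderiv ℝ η (y - t) (EuclideanSpace.single i 1) := by
      intro t
      have hd := ((hηd.differentiable (by simp)) (y - t)).hasFDerivAt.comp t
        ((hasFDerivAt_id t).const_sub y)
      have hd' : fderiv ℝ (fun t => η (y - t)) t = _ := hd.fderiv
      rw [hd']
      simp
    have hz : ∀ {a b : EuclideanSpace ℝ (Fin N) → ℝ}, (∀ t, t ∉ L → a t = 0) →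
        (∀ t ∈ L, b t = a t) → (∀ t, t ∉ L → b t = 0) → ∫ t, b t = ∫ t in Ω, a t := by
      intro a b ha hb hb0
      rw [setIntegral_eq_integral_of_forall_compl_eq_zero fun t ht => ha t fun h => ht (hLΩ h)]
      refine integral_congr_ae (Filter.Eventually.of_forall fun t => ?_)
      by_cases ht : t ∈ L
      · exact hb t ht
      · exact (hb0 t ht).trans (ha t ht).symm
    have h4 : ∫ t, fderiv ℝ η (y - t) (EuclideanSpace.single i 1) * L.indicator u t =
        ∫ t in Ω, u t * fderiv ℝ η (y - t) (EuclideanSpace.single i 1) := by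
      refine hz (fun t ht => ?_) (fun t ht => ?_) (fun t ht => ?_)
      · rw [hdz t ht]; simp
      · rw [Set.indicator_of_mem ht, mul_comm]
      · rw [hdz t ht]; simp
    have h5 : G i = ∫ t in Ω, g t i * η (y - t) := by
      have h6 := (EuclideanSpace.proj (𝕜 := ℝ) i).integral_comp_comm hGi
      have h7 : G i = EuclideanSpace.proj (𝕜 := ℝ) i G := rfl
      rw [h7, hG, ← h6]
      refine hz (fun t ht => ?_) (fun t ht => ?_) (fun t ht => ?_)
      · rw [hηz t ht, mul_zero]
      · rw [Set.indicator_of_mem ht, mul_comm]; simp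
      · rw [hηz t ht]; simp
    simp_rw [hder, mul_neg] at h3
    rw [integral_neg, neg_inj] at h3
    rw [h2, h4, h3, h5]
  have hfd : ∀ e, fderiv ℝ (mollify j (L.indicator u)) y e = inner ℝ G e := by
    have : (fderiv ℝ (mollify j (L.indicator u)) y).toLinearMap = (innerSL ℝ G).toLinearMap := by
      refine (EuclideanSpace.basisFun (Fin N) ℝ).toBasis.ext fun i => ?_
      simp [hpart i, EuclideanSpace.inner_single_right]
    intro e
    exact LinearMap.congr_fun this e
  have hnorm : ‖fderiv ℝ (mollify j (L.indicator u)) y‖ ≤ ‖G‖ := by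
    refine ContinuousLinearMap.opNorm_le_bound _ (norm_nonneg _) fun e => ?_
    rw [hfd]
    exact norm_inner_le_norm _ _
  have hGm : ‖G‖ ≤ mollify j (L.indicator fun x => ‖g x‖) y := by
    refine (norm_integral_le_integral_norm _).trans (le_of_eq ?_)
    have : mollify j (L.indicator fun x => ‖g x‖) y =
        ∫ t, η (y - t) * L.indicator (fun x => ‖g x‖) t := by
      rw [mollify, convolution_eq_swap]; rfl
    rw [this]
    refine integral_congr_ae (Filter.Eventually.of_forall fun t => ?_)
    have h0 : 0 ≤ η (y - t) := (bump N j).nonneg_normed _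
    simp only [norm_smul, Real.norm_eq_abs, abs_of_nonneg h0, norm_indicator_eq_indicator_norm]
  rw [← ofReal_norm, Real.enorm_eq_ofReal ((norm_nonneg G).trans hGm)]
  exact ENNReal.ofReal_le_ofReal (hnorm.trans hGm)

/-- The exponent `p* / N'` where `N' = N / (N - 1)`. -/
noncomputable def expP (n p : ℝ) : ℝ := p * (n - 1) / (n - p)

/-- The exponent `q* / (q N')` where `N' = N / (N - 1)`. -/
noncomputable def expA (n q : ℝ) : ℝ := (n - 1) / (n - q)

/-- A function whose power `N' = N / (N - 1)` is comparable to `𝒢*`. -/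
noncomputable def rootG (n p q a t : ℝ) : ℝ :=
  t ^ expP n p + a ^ expA n q * t ^ (q * expA n q)

/-- The derivative of `rootG` in the last variable. -/
noncomputable def rootGDeriv (n p q a t : ℝ) : ℝ :=
  expP n p * t ^ (expP n p - 1) + a ^ expA n q * (q * expA n q * t ^ (q * expA n q - 1))

/-- A bound for the derivatives of `rootG` in the variables `p, q, a`, up to a constant. -/
noncomputable def rootGParam (n p q a t : ℝ) : ℝ :=
  t ^ (expP n p - 1) * |t * Real.log t| + a ^ (expA n q - 1) * |a * Real.log a| * t ^ (q * expA n q)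
    + a ^ (expA n q - 1) * t ^ (q * expA n q)
    + a ^ expA n q * (t ^ (q * expA n q - 1) * |t * Real.log t|)

theorem one_lt_expP {n p : ℝ} (h1 : 1 < p) (h2 : p < n) : 1 < expP n p := by
  rw [expP, lt_div_iff₀ (by linarith)]; nlinarith

theorem one_lt_expA {n q : ℝ} (h1 : 1 < q) (h2 : q < n) : 1 < expA n q := by
  rw [expA, lt_div_iff₀ (by linarith)]; linarith

theorem one_lt_mul_expA {n q : ℝ} (h1 : 1 < q) (h2 : q < n) : 1 < q * expA n q := by
  have := one_lt_expA h1 h2; nlinarith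

/-- The range of the parameters `(p, q, a, t)`. -/
def paramSet (l h : ℝ) : Set (ℝ × ℝ × ℝ × ℝ) :=
  {x | x.1 ∈ Set.Icc l h ∧ x.2.1 ∈ Set.Icc l h ∧ 0 ≤ x.2.2.1 ∧ 0 ≤ x.2.2.2}

section Continuity

variable {n l h : ℝ}

theorem continuousOn_expP (hh : h < n) :
    ContinuousOn (fun x : ℝ × ℝ × ℝ × ℝ => expP n x.1) (paramSet l h) := by
  refine ContinuousOn.div (by fun_prop) (by fun_prop) fun x hx => ?_
  have := hx.1.2
  linarith

theorem continuousOn_expA (hh : h < n) :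
    ContinuousOn (fun x : ℝ × ℝ × ℝ × ℝ => expA n x.2.1) (paramSet l h) := by
  refine ContinuousOn.div (by fun_prop) (by fun_prop) fun x hx => ?_
  have := hx.2.1.2
  linarith

theorem continuousOn_rootG (hl : 1 < l) (hh : h < n) :
    ContinuousOn (fun x : ℝ × ℝ × ℝ × ℝ => rootG n x.1 x.2.1 x.2.2.1 x.2.2.2) (paramSet l h) := by
  have c1 := continuousOn_expP (l := l) hh
  have c2 := continuousOn_expA (l := l) hh
  have e1 : ∀ x ∈ paramSet l h, 1 < expP n x.1 := fun x hx =>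
    one_lt_expP (hl.trans_le hx.1.1) (hx.1.2.trans_lt hh)
  have e2 : ∀ x ∈ paramSet l h, 1 < expA n x.2.1 := fun x hx =>
    one_lt_expA (hl.trans_le hx.2.1.1) (hx.2.1.2.trans_lt hh)
  have e3 : ∀ x ∈ paramSet l h, 1 < x.2.1 * expA n x.2.1 := fun x hx =>
    one_lt_mul_expA (hl.trans_le hx.2.1.1) (hx.2.1.2.trans_lt hh)
  unfold rootG
  refine (ContinuousOn.rpow (by fun_prop) c1 fun x hx => Or.inr ?_).add
    ((ContinuousOn.rpow (by fun_prop) c2 fun x hx => Or.inr ?_).mul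
      (ContinuousOn.rpow (by fun_prop) (by fun_prop) fun x hx => Or.inr ?_))
  · linarith [e1 x hx]
  · linarith [e2 x hx]
  · linarith [e3 x hx]

theorem continuousOn_rootGDeriv (hl : 1 < l) (hh : h < n) :
    ContinuousOn (fun x : ℝ × ℝ × ℝ × ℝ => rootGDeriv n x.1 x.2.1 x.2.2.1 x.2.2.2)
      (paramSet l h) := by
  have c1 := continuousOn_expP (l := l) hh
  have c2 := continuousOn_expA (l := l) hh
  have e1 : ∀ x ∈ paramSet l h, 1 < expP n x.1 := fun x hx =>
    one_lt_expP (hl.trans_le hx.1.1) (hx.1.2.trans_lt hh)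
  have e2 : ∀ x ∈ paramSet l h, 1 < expA n x.2.1 := fun x hx =>
    one_lt_expA (hl.trans_le hx.2.1.1) (hx.2.1.2.trans_lt hh)
  have e3 : ∀ x ∈ paramSet l h, 1 < x.2.1 * expA n x.2.1 := fun x hx =>
    one_lt_mul_expA (hl.trans_le hx.2.1.1) (hx.2.1.2.trans_lt hh)
  unfold rootGDeriv
  refine (c1.mul (ContinuousOn.rpow (by fun_prop) (by fun_prop) fun x hx => Or.inr ?_)).add
    ((ContinuousOn.rpow (by fun_prop) c2 fun x hx => Or.inr ?_).mul
      (ContinuousOn.mul (by fun_prop)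
        (ContinuousOn.rpow (by fun_prop) (by fun_prop) fun x hx => Or.inr ?_)))
  · linarith [e1 x hx]
  · linarith [e2 x hx]
  · linarith [e3 x hx]

theorem continuousOn_rootGParam (hl : 1 < l) (hh : h < n) :
    ContinuousOn (fun x : ℝ × ℝ × ℝ × ℝ => rootGParam n x.1 x.2.1 x.2.2.1 x.2.2.2)
      (paramSet l h) := by
  have c1 := continuousOn_expP (l := l) hh
  have c2 := continuousOn_expA (l := l) hh
  have e1 : ∀ x ∈ paramSet l h, 1 < expP n x.1 := fun x hx =>
    one_lt_expP (hl.trans_le hx.1.1) (hx.1.2.trans_lt hh)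
  have e2 : ∀ x ∈ paramSet l h, 1 < expA n x.2.1 := fun x hx =>
    one_lt_expA (hl.trans_le hx.2.1.1) (hx.2.1.2.trans_lt hh)
  have e3 : ∀ x ∈ paramSet l h, 1 < x.2.1 * expA n x.2.1 := fun x hx =>
    one_lt_mul_expA (hl.trans_le hx.2.1.1) (hx.2.1.2.trans_lt hh)
  have l1 : ContinuousOn (fun x : ℝ × ℝ × ℝ × ℝ => |x.2.2.2 * Real.log x.2.2.2|)
      (paramSet l h) :=
    (Real.continuous_mul_log.comp
      (by fun_prop : Continuous fun x : ℝ × ℝ × ℝ × ℝ => x.2.2.2)).abs.continuousOn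
  have l2 : ContinuousOn (fun x : ℝ × ℝ × ℝ × ℝ => |x.2.2.1 * Real.log x.2.2.1|)
      (paramSet l h) :=
    (Real.continuous_mul_log.comp
      (by fun_prop : Continuous fun x : ℝ × ℝ × ℝ × ℝ => x.2.2.1)).abs.continuousOn
  have m1 : ContinuousOn (fun x : ℝ × ℝ × ℝ × ℝ => x.2.2.2 ^ (expP n x.1 - 1)) (paramSet l h) :=
    ContinuousOn.rpow (by fun_prop) (by fun_prop) fun x hx => Or.inr (by linarith [e1 x hx])
  have m2 : ContinuousOn (fun x : ℝ × ℝ × ℝ × ℝ => x.2.2.1 ^ (expA n x.2.1 - 1))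
      (paramSet l h) :=
    ContinuousOn.rpow (by fun_prop) (by fun_prop) fun x hx => Or.inr (by linarith [e2 x hx])
  have m3 : ContinuousOn (fun x : ℝ × ℝ × ℝ × ℝ => x.2.2.1 ^ (expA n x.2.1)) (paramSet l h) :=
    ContinuousOn.rpow (by fun_prop) (by fun_prop) fun x hx => Or.inr (by linarith [e2 x hx])
  have m4 : ContinuousOn (fun x : ℝ × ℝ × ℝ × ℝ => x.2.2.2 ^ (x.2.1 * expA n x.2.1))
      (paramSet l h) :=
    ContinuousOn.rpow (by fun_prop) (by fun_prop) fun x hx => Or.inr (by linarith [e3 x hx])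
  have m5 : ContinuousOn (fun x : ℝ × ℝ × ℝ × ℝ => x.2.2.2 ^ (x.2.1 * expA n x.2.1 - 1))
      (paramSet l h) :=
    ContinuousOn.rpow (by fun_prop) (by fun_prop) fun x hx => Or.inr (by linarith [e3 x hx])
  exact (((m1.mul l1).add ((m2.mul l2).mul m4)).add (m2.mul m4)).add (m3.mul (m5.mul l1))

theorem exists_rootG_bound (hl : 1 < l) (hh : h < n) (A M : ℝ) : ∃ C : ℝ,
    ∀ p ∈ Set.Icc l h, ∀ q ∈ Set.Icc l h, ∀ a ∈ Set.Icc 0 A, ∀ t : ℝ, 0 ≤ t →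
      rootG n p q a t ≤ M → rootGDeriv n p q a t ≤ C ∧ rootGParam n p q a t ≤ C := by
  set S : Set (ℝ × ℝ × ℝ × ℝ) := Set.Icc l h ×ˢ Set.Icc l h ×ˢ Set.Icc 0 A ×ˢ
    Set.Icc 0 (max 1 M) with hS
  have hSc : IsCompact S :=
    isCompact_Icc.prod (isCompact_Icc.prod (isCompact_Icc.prod isCompact_Icc))
  have hSp : S ⊆ paramSet l h := fun x hx => ⟨hx.1, hx.2.1, hx.2.2.1.1, hx.2.2.2.1⟩
  obtain ⟨C1, h1⟩ := hSc.exists_bound_of_continuousOn ((continuousOn_rootGDeriv hl hh).mono hSp)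
  obtain ⟨C2, h2⟩ := hSc.exists_bound_of_continuousOn ((continuousOn_rootGParam hl hh).mono hSp)
  refine ⟨max C1 C2, fun p hp q hq a ha t ht hM => ?_⟩
  have htM : t ≤ max 1 M := by
    rcases le_total t 1 with h | h
    · exact h.trans (le_max_left _ _)
    · refine le_trans ?_ (le_max_right _ _)
      refine le_trans ?_ hM
      have e1 := one_lt_expP (hl.trans_le hp.1) (hp.2.trans_lt hh)
      have h3 : t ≤ t ^ expP n p := by
        nth_rewrite 1 [← Real.rpow_one t]
        exact Real.rpow_le_rpow_of_exponent_le h e1.le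
      have h4 : 0 ≤ a ^ expA n q * t ^ (q * expA n q) :=
        mul_nonneg (Real.rpow_nonneg ha.1 _) (Real.rpow_nonneg ht _)
      rw [rootG]; linarith
  have hx : (p, q, a, t) ∈ S := ⟨hp, hq, ha, ht, htM⟩
  exact ⟨(le_abs_self _).trans ((h1 _ hx).trans (le_max_left _ _)),
    (le_abs_self _).trans ((h2 _ hx).trans (le_max_right _ _))⟩

end Continuity

theorem rootGDeriv_nonneg {n p q a t : ℝ} (hp : 1 < p) (hpn : p < n) (hq : 1 < q) (hqn : q < n)
    (ha : 0 ≤ a) (ht : 0 ≤ t) : 0 ≤ rootGDeriv n p q a t := by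
  have h1 := one_lt_expP hp hpn
  have h2 := one_lt_mul_expA hq hqn
  unfold rootGDeriv
  positivity

theorem rootGParam_nonneg {n p q a t : ℝ} (ha : 0 ≤ a) (ht : 0 ≤ t) :
    0 ≤ rootGParam n p q a t := by
  unfold rootGParam
  positivity

theorem hasDerivAt_expP {n p : ℝ} (hp : p < n) :
    HasDerivAt (expP n) ((n - 1) * n / (n - p) ^ 2) p := by
  have h0 : n - p ≠ 0 := by linarith
  have h := ((hasDerivAt_id p).mul_const (n - 1)).div ((hasDerivAt_id p).const_sub n) h0
  refine HasDerivAt.congr_deriv h ?_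
  simp only [id_eq]
  congr 1
  ring

theorem hasDerivAt_expA {n q : ℝ} (hq : q < n) :
    HasDerivAt (expA n) ((n - 1) / (n - q) ^ 2) q := by
  have h0 : n - q ≠ 0 := by linarith
  have h := (hasDerivAt_const q (n - 1)).div ((hasDerivAt_id q).const_sub n) h0
  refine HasDerivAt.congr_deriv h ?_
  simp only [id_eq]
  congr 1
  ring

theorem exists_exp_bound {n l h : ℝ} (hh : h < n) : ∃ D : ℝ, 0 ≤ D ∧
    ∀ p ∈ Set.Icc l h, |(n - 1) * n / (n - p) ^ 2| ≤ D ∧ |(n - 1) / (n - p) ^ 2| ≤ D ∧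
      expA n p ≤ D ∧ expP n p ≤ D := by
  have hc : ∀ p ∈ Set.Icc l h, n - p ≠ 0 := fun p hp => by linarith [hp.2]
  obtain ⟨D1, h1⟩ := isCompact_Icc.exists_bound_of_continuousOn (s := Set.Icc l h)
    (f := fun p => (n - 1) * n / (n - p) ^ 2)
    (ContinuousOn.div (by fun_prop) (by fun_prop) fun p hp => pow_ne_zero 2 (hc p hp))
  obtain ⟨D2, h2⟩ := isCompact_Icc.exists_bound_of_continuousOn (s := Set.Icc l h)
    (f := fun p => (n - 1) / (n - p) ^ 2)
    (ContinuousOn.div (by fun_prop) (by fun_prop) fun p hp => pow_ne_zero 2 (hc p hp))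
  obtain ⟨D3, h3⟩ := isCompact_Icc.exists_bound_of_continuousOn (s := Set.Icc l h)
    (f := expA n) (ContinuousOn.div (by fun_prop) (by fun_prop) hc)
  obtain ⟨D4, h4⟩ := isCompact_Icc.exists_bound_of_continuousOn (s := Set.Icc l h)
    (f := expP n) (ContinuousOn.div (by fun_prop) (by fun_prop) hc)
  refine ⟨|D1| + |D2| + |D3| + |D4|, by positivity, fun p hp => ?_⟩
  have := le_abs_self D1
  have := le_abs_self D2
  have := le_abs_self D3
  have := le_abs_self D4
  have := abs_nonneg D1
  have := abs_nonneg D2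
  have := abs_nonneg D3
  have := abs_nonneg D4
  have k1 := h1 p hp
  have k2 := h2 p hp
  have k3 := (le_abs_self _).trans (h3 p hp)
  have k4 := (le_abs_self _).trans (h4 p hp)
  rw [Real.norm_eq_abs] at k1 k2
  refine ⟨?_, ?_, ?_, ?_⟩ <;> linarith

theorem exists_norm_fderiv_rootG_le {n l h : ℝ} (hl : 1 < l) (hh : h < n) :
    ∃ C : ℝ, 0 ≤ C ∧ ∀ {V : Type} [NormedAddCommGroup V] [NormedSpace ℝ V] (P Q A T : V → ℝ)
      (P' Q' A' T' : V →L[ℝ] ℝ) (y : V) (L : ℝ), HasFDerivAt P P' y → HasFDerivAt Q Q' y →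
      HasFDerivAt A A' y → HasFDerivAt T T' y → P y ∈ Set.Icc l h → Q y ∈ Set.Icc l h →
      0 < A y → 0 < T y → ‖P'‖ ≤ L → ‖Q'‖ ≤ L → ‖A'‖ ≤ L →
      ‖fderiv ℝ (fun z => rootG n (P z) (Q z) (A z) (T z)) y‖ ≤
        rootGDeriv n (P y) (Q y) (A y) (T y) * ‖T'‖ +
          C * L * rootGParam n (P y) (Q y) (A y) (T y) := by
  obtain ⟨D, hD, hDb⟩ := exists_exp_bound (l := l) hh
  refine ⟨D, hD, ?_⟩
  intro V _ _ P Q A T P' Q' A' T' y L hP hQ hA hT hPy hQy hAy hTy hP' hQ' hA'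
  have hL : 0 ≤ L := (norm_nonneg _).trans hP'
  have hβ : ∀ q, q * expA n q = expP n q := fun q => by rw [expA, expP]; ring
  simp only [rootG, rootGDeriv, rootGParam, hβ]
  obtain ⟨α, hα⟩ : ∃ α, α = expP n (P y) := ⟨_, rfl⟩
  obtain ⟨β, hβ'⟩ : ∃ β, β = expP n (Q y) := ⟨_, rfl⟩
  obtain ⟨r, hr⟩ : ∃ r, r = expA n (Q y) := ⟨_, rfl⟩
  have hα1 : 1 < α := hα ▸ one_lt_expP (hl.trans_le hPy.1) (hPy.2.trans_lt hh)
  have hβ1 : 1 < β := hβ' ▸ one_lt_expP (hl.trans_le hQy.1) (hQy.2.trans_lt hh)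
  have hr1 : 1 < r := hr ▸ one_lt_expA (hl.trans_le hQy.1) (hQy.2.trans_lt hh)
  obtain ⟨hP1, -, -, -⟩ := hDb _ hPy
  obtain ⟨hQ1, hQ2, hQ3, -⟩ := hDb _ hQy
  rw [← hr] at hQ3
  have dα := (hasDerivAt_expP (hPy.2.trans_lt hh)).comp_hasFDerivAt y hP
  have dβ := (hasDerivAt_expP (hQy.2.trans_lt hh)).comp_hasFDerivAt y hQ
  have dr := (hasDerivAt_expA (hQy.2.trans_lt hh)).comp_hasFDerivAt y hQ
  have d1 := hT.rpow dα hTy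
  have d2 := hA.rpow dr hAy
  have d3 := hT.rpow dβ hTy
  have d := d1.add (d2.mul d3)
  rw [show (fun z => T z ^ expP n (P z) + A z ^ expA n (Q z) * T z ^ expP n (Q z)) =
    (fun x => T x ^ (expP n ∘ P) x) + (fun x => A x ^ (expA n ∘ Q) x) *
      (fun x => T x ^ (expP n ∘ Q) x) from rfl, d.fderiv]
  simp only [Function.comp_apply, ← hα, ← hβ', ← hr]
  obtain ⟨t, ht⟩ : ∃ t, t = T y := ⟨_, rfl⟩
  obtain ⟨a, ha⟩ : ∃ a, a = A y := ⟨_, rfl⟩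
  rw [← ht] at hTy
  rw [← ha] at hAy
  rw [← ht, ← ha]
  have et : ∀ s : ℝ, t ^ s = t ^ (s - 1) * t := fun s => by
    rw [← Real.rpow_add_one hTy.ne']; ring_nf
  have ea : ∀ s : ℝ, a ^ s = a ^ (s - 1) * a := fun s => by
    rw [← Real.rpow_add_one hAy.ne']; ring_nf
  have bα : ‖((n - 1) * n / (n - P y) ^ 2) • P'‖ ≤ D * L := by
    rw [norm_smul]; exact mul_le_mul hP1 hP' (norm_nonneg _) hD
  have bβ : ‖((n - 1) * n / (n - Q y) ^ 2) • Q'‖ ≤ D * L := by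
    rw [norm_smul]; exact mul_le_mul hQ1 hQ' (norm_nonneg _) hD
  have br : ‖((n - 1) / (n - Q y) ^ 2) • Q'‖ ≤ D * L := by
    rw [norm_smul]; exact mul_le_mul hQ2 hQ' (norm_nonneg _) hD
  have bA : ‖r • A'‖ ≤ D * L := by
    rw [norm_smul, Real.norm_eq_abs, abs_of_pos (by linarith)]
    exact mul_le_mul hQ3 hA' (norm_nonneg _) hD
  generalize ((n - 1) * n / (n - P y) ^ 2) • P' = α' at *
  generalize ((n - 1) * n / (n - Q y) ^ 2) • Q' = β' at *
  generalize ((n - 1) / (n - Q y) ^ 2) • Q' = r' at *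
  have n1 : ‖(α * t ^ (α - 1)) • T' + (t ^ α * Real.log t) • α'‖ ≤
      α * t ^ (α - 1) * ‖T'‖ + t ^ (α - 1) * |t * Real.log t| * (D * L) := by
    refine (norm_add_le _ _).trans ?_
    rw [norm_smul, norm_smul, Real.norm_eq_abs, Real.norm_eq_abs, et α, mul_assoc (t ^ (α - 1)) t,
      abs_mul (t ^ (α - 1)), abs_of_pos (by positivity : 0 < α * t ^ (α - 1)),
      abs_of_pos (by positivity : 0 < t ^ (α - 1))]
    gcongr
  have n3 : ‖(β * t ^ (β - 1)) • T' + (t ^ β * Real.log t) • β'‖ ≤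
      β * t ^ (β - 1) * ‖T'‖ + t ^ (β - 1) * |t * Real.log t| * (D * L) := by
    refine (norm_add_le _ _).trans ?_
    rw [norm_smul, norm_smul, Real.norm_eq_abs, Real.norm_eq_abs, et β, mul_assoc (t ^ (β - 1)) t,
      abs_mul (t ^ (β - 1)), abs_of_pos (by positivity : 0 < β * t ^ (β - 1)),
      abs_of_pos (by positivity : 0 < t ^ (β - 1))]
    gcongr
  have n2 : ‖(r * a ^ (r - 1)) • A' + (a ^ r * Real.log a) • r'‖ ≤
      a ^ (r - 1) * (D * L) + a ^ (r - 1) * |a * Real.log a| * (D * L) := by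
    refine (norm_add_le _ _).trans ?_
    rw [mul_comm r, mul_smul, norm_smul (a ^ (r - 1)), norm_smul _ r', Real.norm_eq_abs, Real.norm_eq_abs, ea r,
      mul_assoc (a ^ (r - 1)) a,
      abs_mul (a ^ (r - 1)), abs_of_pos (by positivity : 0 < a ^ (r - 1))]
    gcongr
  refine (norm_add_le _ _).trans ((add_le_add n1 ((norm_add_le _ _).trans
    (add_le_add (norm_smul_le _ _) (norm_smul_le _ _)))).trans ?_)
  rw [Real.norm_eq_abs, Real.norm_eq_abs, abs_of_pos (by positivity : 0 < a ^ r),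
    abs_of_pos (by positivity : 0 < t ^ β)]
  have n3' := mul_le_mul_of_nonneg_left n3 (by positivity : 0 ≤ a ^ r)
  have n2' := mul_le_mul_of_nonneg_left n2 (by positivity : 0 ≤ t ^ β)
  linarith

/-- A smooth cutoff vanishing on `(-∞, 1]` and equal to `1` on `[2, ∞)`. -/
noncomputable def cutoff (s : ℝ) : ℝ := Real.smoothTransition (s - 1)

theorem contDiff_cutoff {m : ℕ∞} : ContDiff ℝ m cutoff :=
  Real.smoothTransition.contDiff.comp (contDiff_id.sub contDiff_const)

theorem cutoff_nonneg (s : ℝ) : 0 ≤ cutoff s := Real.smoothTransition.nonneg _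

theorem cutoff_le_one (s : ℝ) : cutoff s ≤ 1 := Real.smoothTransition.le_one _

theorem cutoff_of_le {s : ℝ} (hs : s ≤ 1) : cutoff s = 0 :=
  Real.smoothTransition.zero_of_nonpos (by linarith)

theorem cutoff_of_ge {s : ℝ} (hs : 2 ≤ s) : cutoff s = 1 :=
  Real.smoothTransition.one_of_one_le (by linarith)

theorem continuous_deriv_cutoff : Continuous (deriv cutoff) :=
  (contDiff_cutoff (m := 1)).continuous_deriv le_rfl

theorem deriv_cutoff_of_le {s : ℝ} (hs : s ≤ 1) : deriv cutoff s = 0 := by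
  have hmin : IsLocalMin cutoff s := by
    refine Filter.Eventually.of_forall fun x => ?_
    rw [cutoff_of_le hs]; exact cutoff_nonneg x
  exact hmin.deriv_eq_zero

theorem deriv_cutoff_of_ge {s : ℝ} (hs : 2 ≤ s) : deriv cutoff s = 0 := by
  have hmax : IsLocalMax cutoff s := by
    refine Filter.Eventually.of_forall fun x => ?_
    rw [cutoff_of_ge hs]; exact cutoff_le_one x
  exact hmax.deriv_eq_zero

theorem exists_deriv_cutoff_bound : ∃ C : ℝ, 0 < C ∧ ∀ s, |deriv cutoff s| ≤ C := by
  obtain ⟨C, hC⟩ := isCompact_Icc.exists_bound_of_continuousOn (s := Set.Icc (1 : ℝ) 2)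
    continuous_deriv_cutoff.continuousOn
  refine ⟨max C 1, by positivity, fun s => ?_⟩
  by_cases hs : s ∈ Set.Icc (1 : ℝ) 2
  · exact (hC s hs).trans (le_max_left _ _)
  · rw [Set.mem_Icc, not_and_or, not_le, not_le] at hs
    rcases hs with hs | hs
    · rw [deriv_cutoff_of_le hs.le]; simp
    · rw [deriv_cutoff_of_ge hs.le]; simp

theorem mollify_mem_Icc {N : ℕ} (j : ℕ) {f : EuclideanSpace ℝ (Fin N) → ℝ} (hf : Continuous f)
    {b c : ℝ} (hfb : ∀ y, f y ∈ Set.Icc b c) (y : EuclideanSpace ℝ (Fin N)) :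
    mollify j f y ∈ Set.Icc b c := by
  constructor
  · rw [← mollify_const j b y]
    exact mollify_mono j continuous_const.locallyIntegrable hf.locallyIntegrable
      (fun z => (hfb z).1) y
  · rw [← mollify_const j c y]
    exact mollify_mono j hf.locallyIntegrable continuous_const.locallyIntegrable
      (fun z => (hfb z).2) y

theorem hasFDerivAt_sqrt_sq_add {V : Type} [NormedAddCommGroup V] [NormedSpace ℝ V] {f : V → ℝ}
    {f' : V →L[ℝ] ℝ} {y : V} (hf : HasFDerivAt f f' y) {ε : ℝ} (hε : 0 < ε) :
    ∃ g' : V →L[ℝ] ℝ, HasFDerivAt (fun z => √(f z ^ 2 + ε ^ 2)) g' y ∧ ‖g'‖ ≤ ‖f'‖ := by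
  have hpos : 0 < f y ^ 2 + ε ^ 2 := by positivity
  have h := ((hf.pow 2).add_const (ε ^ 2)).sqrt hpos.ne'
  refine ⟨_, h, ?_⟩
  rw [smul_smul, norm_smul]
  refine mul_le_of_le_one_left (norm_nonneg _) ?_
  have hs : 0 < √(f y ^ 2 + ε ^ 2) := Real.sqrt_pos.2 hpos
  have h1 : |f y| ≤ √(f y ^ 2 + ε ^ 2) := Real.abs_le_sqrt (by nlinarith)
  rw [Real.norm_eq_abs]
  have e : 1 / (2 * √(f y ^ 2 + ε ^ 2)) * ((2 : ℕ) • f y ^ (2 - 1)) = f y / √(f y ^ 2 + ε ^ 2) := by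
    simp
    field_simp
  rw [e, abs_div, abs_of_pos hs]
  exact div_le_one_of_le₀ h1 hs.le

/-- The data `(p, q, a)` extended to the whole space: Lipschitz functions with values in compact
intervals. -/
structure GoodData {N : ℕ} (l h A : ℝ) (L : NNReal) (p q a : EuclideanSpace ℝ (Fin N) → ℝ) :
    Prop where
  one_lt : 1 < l
  lt_dim : h < N
  p_lip : LipschitzWith L p
  q_lip : LipschitzWith L q
  a_lip : LipschitzWith L a
  p_mem : ∀ y, p y ∈ Set.Icc l h
  q_mem : ∀ y, q y ∈ Set.Icc l h
  a_mem : ∀ y, a y ∈ Set.Icc 0 A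

theorem GoodData.mem_paramSet {N : ℕ} {l h A : ℝ} {L : NNReal}
    {p q a : EuclideanSpace ℝ (Fin N) → ℝ} (hd : GoodData l h A L p q a)
    (y : EuclideanSpace ℝ (Fin N)) {t : ℝ} (ht : 0 ≤ t) : (p y, q y, a y, t) ∈ paramSet l h :=
  ⟨hd.p_mem y, hd.q_mem y, (hd.a_mem y).1, ht⟩

theorem GoodData.exists_smooth_approx {N : ℕ} {l h A : ℝ} {L : NNReal}
    {p q a : EuclideanSpace ℝ (Fin N) → ℝ} (hd : GoodData l h A L p q a)
    {C : ℝ} (hCb : ∀ {V : Type} [NormedAddCommGroup V] [NormedSpace ℝ V]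
      (P Q A T : V → ℝ)
      (P' Q' A' T' : V →L[ℝ] ℝ) (y : V) (L : ℝ), HasFDerivAt P P' y → HasFDerivAt Q Q' y →
      HasFDerivAt A A' y → HasFDerivAt T T' y → P y ∈ Set.Icc l h → Q y ∈ Set.Icc l h →
      0 < A y → 0 < T y → ‖P'‖ ≤ L → ‖Q'‖ ≤ L → ‖A'‖ ≤ L →
      ‖fderiv ℝ (fun z => rootG N (P z) (Q z) (A z) (T z)) y‖ ≤
        rootGDeriv N (P y) (Q y) (A y) (T y) * ‖T'‖ +
          C * L * rootGParam N (P y) (Q y) (A y) (T y))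
    {lam : ℝ} (hlam : 0 < lam) {f : EuclideanSpace ℝ (Fin N) → ℝ} (hf : LocallyIntegrable f) :
    ∃ X : ℕ → EuclideanSpace ℝ (Fin N) → ℝ × ℝ × ℝ × ℝ,
      (∀ j, Continuous (X j)) ∧ (∀ j y, X j y ∈ paramSet l h ∧ (X j y).2.2.1 ≤ A + 1) ∧
      (∀ᵐ y, Filter.Tendsto (fun j => X j y) Filter.atTop (nhds (p y, q y, a y, |f y|))) ∧
      (∀ j, ContDiff ℝ 1 fun y => lam *
        cutoff (rootG N (X j y).1 (X j y).2.1 (X j y).2.2.1 (X j y).2.2.2 / lam)) ∧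
      ∀ j y, ‖fderiv ℝ (fun y => lam *
        cutoff (rootG N (X j y).1 (X j y).2.1 (X j y).2.2.1 (X j y).2.2.2 / lam)) y‖ ≤
        |deriv cutoff (rootG N (X j y).1 (X j y).2.1 (X j y).2.2.1 (X j y).2.2.2 / lam)| *
        (rootGDeriv N (X j y).1 (X j y).2.1 (X j y).2.2.1 (X j y).2.2.2 *
          ‖fderiv ℝ (mollify j f) y‖ +
        C * L * rootGParam N (X j y).1 (X j y).2.1 (X j y).2.2.1 (X j y).2.2.2) := by
  have hε : ∀ j : ℕ, (0 : ℝ) < 1 / ((j : ℝ) + 1) := fun j => by positivity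
  have hεl : Filter.Tendsto (fun j : ℕ => (1 : ℝ) / ((j : ℝ) + 1)) Filter.atTop (nhds 0) :=
    tendsto_one_div_add_atTop_nhds_zero_nat
  set P : ℕ → EuclideanSpace ℝ (Fin N) → ℝ := fun j => mollify j p with hP
  set Q : ℕ → EuclideanSpace ℝ (Fin N) → ℝ := fun j => mollify j q with hQ
  set A' : ℕ → EuclideanSpace ℝ (Fin N) → ℝ := fun j y => mollify j a y + 1 / ((j : ℝ) + 1) with hA
  set T : ℕ → EuclideanSpace ℝ (Fin N) → ℝ := fun j y =>
    √(mollify j f y ^ 2 + (1 / ((j : ℝ) + 1)) ^ 2) with hT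
  have hPc : ∀ j, ContDiff ℝ 1 (P j) := fun j => contDiff_mollify j hd.p_lip.continuous.locallyIntegrable
  have hQc : ∀ j, ContDiff ℝ 1 (Q j) := fun j => contDiff_mollify j hd.q_lip.continuous.locallyIntegrable
  have hac : ∀ j, ContDiff ℝ 1 (mollify j a) :=
    fun j => contDiff_mollify j hd.a_lip.continuous.locallyIntegrable
  have hAc : ∀ j, ContDiff ℝ 1 (A' j) := fun j => (hac j).add contDiff_const
  have hfc : ∀ j, ContDiff ℝ 1 (mollify j f) := fun j => contDiff_mollify j hf
  have hTc : ∀ j, ContDiff ℝ 1 (T j) := fun j =>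
    (((hfc j).pow 2).add contDiff_const).sqrt fun y => by
      have := hε j
      positivity
  have hPm : ∀ j y, P j y ∈ Set.Icc l h := fun j y => mollify_mem_Icc j hd.p_lip.continuous hd.p_mem y
  have hQm : ∀ j y, Q j y ∈ Set.Icc l h := fun j y => mollify_mem_Icc j hd.q_lip.continuous hd.q_mem y
  have ham : ∀ j y, mollify j a y ∈ Set.Icc 0 A := fun j y =>
    mollify_mem_Icc j hd.a_lip.continuous hd.a_mem y
  have hA0 : ∀ j y, 0 < A' j y := fun j y => add_pos_of_nonneg_of_pos (ham j y).1 (hε j)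
  have hT0 : ∀ j y, 0 < T j y := fun j y => Real.sqrt_pos.2 (by have := hε j; positivity)
  have hRc : ∀ j, ContDiff ℝ 1 fun y => rootG N (P j y) (Q j y) (A' j y) (T j y) := by
    intro j
    have hb : ContDiff ℝ 1 fun y => expA N (Q j y) :=
      contDiff_const.div (contDiff_const.sub (hQc j)) fun y => by
        have := (hQm j y).2
        have := hd.lt_dim
        linarith
    have hα : ContDiff ℝ 1 fun y => expP N (P j y) :=
      ((hPc j).mul contDiff_const).div (contDiff_const.sub (hPc j)) fun y => by
        have := (hPm j y).2
        have := hd.lt_dim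
        linarith
    exact ((hTc j).rpow hα fun y => (hT0 j y).ne').add
      (((hAc j).rpow hb fun y => (hA0 j y).ne').mul
        ((hTc j).rpow ((hQc j).mul hb) fun y => (hT0 j y).ne'))
  have hout : ∀ s, HasDerivAt (fun s => lam * cutoff (s / lam)) (deriv cutoff (s / lam)) s := by
    intro s
    have h1 : HasDerivAt cutoff (deriv cutoff (s / lam)) (s / lam) :=
      ((contDiff_cutoff (m := 1)).differentiable (by simp) _).hasDerivAt
    have h2 := (h1.comp s ((hasDerivAt_id s).div_const lam)).const_mul lam
    refine HasDerivAt.congr_deriv h2 ?_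
    field_simp
  refine ⟨fun j y => (P j y, Q j y, A' j y, T j y), fun j => ?_, fun j y => ?_, ?_, fun j => ?_,
    fun j y => ?_⟩
  · exact (hPc j).continuous.prodMk ((hQc j).continuous.prodMk
      ((hAc j).continuous.prodMk (hTc j).continuous))
  · refine ⟨⟨hPm j y, hQm j y, (hA0 j y).le, (hT0 j y).le⟩, ?_⟩
    have h1 : 1 / ((j : ℝ) + 1) ≤ 1 := bump_rOut_le_one N j
    exact add_le_add (ham j y).2 h1
  · filter_upwards [ae_tendsto_mollify hf] with y hy
    refine (tendsto_mollify hd.p_lip.continuous y).prodMk_nhds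
      ((tendsto_mollify hd.q_lip.continuous y).prodMk_nhds (Filter.Tendsto.prodMk_nhds ?_ ?_))
    · have h1 := (tendsto_mollify hd.a_lip.continuous y).add hεl
      rwa [add_zero] at h1
    · have := ((hy.pow 2).add (hεl.pow 2)).sqrt
      rwa [zero_pow two_ne_zero, add_zero, Real.sqrt_sq_eq_abs] at this
  · exact contDiff_const.mul ((contDiff_cutoff (m := 1)).comp ((hRc j).div_const lam))
  · have hR := ((hRc j).differentiable (by simp) y).hasFDerivAt
    have hcomp := ((hout _).comp_hasFDerivAt y hR).fderiv
    have e : (fun y => lam * cutoff (rootG N (P j y) (Q j y) (A' j y) (T j y) / lam)) =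
      (fun s => lam * cutoff (s / lam)) ∘ fun y => rootG N (P j y) (Q j y) (A' j y) (T j y) := rfl
    show ‖fderiv ℝ (fun y => lam * cutoff (rootG N (P j y) (Q j y) (A' j y) (T j y) / lam)) y‖ ≤ _
    rw [e, hcomp, norm_smul, Real.norm_eq_abs]
    refine mul_le_mul_of_nonneg_left ?_ (abs_nonneg _)
    obtain ⟨T', hT', hTn⟩ := hasFDerivAt_sqrt_sq_add
      ((hfc j).differentiable (by simp) y).hasFDerivAt (hε j)
    refine (hCb (P j) (Q j) (A' j) (T j) _ _ _ T' y L
      ((hPc j).differentiable (by simp) y).hasFDerivAt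
      ((hQc j).differentiable (by simp) y).hasFDerivAt
      (((hac j).differentiable (by simp) y).hasFDerivAt.add_const _)
      hT' (hPm j y) (hQm j y) (hA0 j y) (hT0 j y)
      (norm_fderiv_le_of_lipschitz ℝ (lipschitzWith_mollify j hd.p_lip))
      (norm_fderiv_le_of_lipschitz ℝ (lipschitzWith_mollify j hd.q_lip))
      (norm_fderiv_le_of_lipschitz ℝ (lipschitzWith_mollify j hd.a_lip))).trans ?_
    have hn : (N : ℝ) > h := hd.lt_dim
    have := rootGDeriv_nonneg (hd.one_lt.trans_le (hPm j y).1) ((hPm j y).2.trans_lt hn)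
      (hd.one_lt.trans_le (hQm j y).1) ((hQm j y).2.trans_lt hn) (hA0 j y).le (hT0 j y).le
    gcongr

theorem GoodData.exists_hasC1Approx {N : ℕ} {Ω : Set (EuclideanSpace ℝ (Fin N))}
    (hΩ : IsOpen Ω) {l h A : ℝ} {L : NNReal}
    {p q a : EuclideanSpace ℝ (Fin N) → ℝ} (hd : GoodData l h A L p q a) :
    ∃ C : ℝ, 0 ≤ C ∧ ∀ (u : EuclideanSpace ℝ (Fin N) → ℝ)
      (g : EuclideanSpace ℝ (Fin N) → EuclideanSpace ℝ (Fin N)), IsWeakGradient Ω u g →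
      ∀ lam : ℝ, 0 < lam →
        HasC1Approx Ω (fun x => lam * cutoff (rootG N (p x) (q x) (a x) |u x| / lam))
          (fun x => ENNReal.ofReal (|deriv cutoff (rootG N (p x) (q x) (a x) |u x| / lam)| *
            (rootGDeriv N (p x) (q x) (a x) |u x| * ‖g x‖ +
              C * rootGParam N (p x) (q x) (a x) |u x|))) := by
  obtain ⟨C, hC, hCb⟩ := exists_norm_fderiv_rootG_le hd.one_lt hd.lt_dim
  refine ⟨C * L, by positivity, fun u g hg lam hlam K hKΩ hK => ?_⟩
  obtain ⟨δ, hδ, hδΩ⟩ := hK.exists_cthickening_subset_open hΩ hKΩ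
  set L' := Metric.cthickening δ K with hL'
  have hLc : IsCompact L' := hK.cthickening
  have hKL : K ⊆ L' := Metric.self_subset_cthickening K
  set f := L'.indicator u with hf
  set m := L'.indicator fun x => ‖g x‖ with hm
  have hfi : Integrable f :=
    (integrable_indicator_iff hLc.measurableSet).2 (hg.1.integrableOn_compact_subset hδΩ hLc)
  have hmi : Integrable m := (integrable_indicator_iff hLc.measurableSet).2
      (hg.2.1.integrableOn_compact_subset hδΩ hLc).norm
  have hm0 : ∀ y, 0 ≤ m y := fun y => Set.indicator_nonneg (fun _ _ => norm_nonneg _) y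
  obtain ⟨X, hXc, hXm, hXt, hWc, hWd⟩ :=
    hd.exists_smooth_approx hCb hlam hfi.locallyIntegrable
  set W : ℕ → EuclideanSpace ℝ (Fin N) → ℝ := fun j y => lam *
        cutoff (rootG N (X j y).1 (X j y).2.1 (X j y).2.2.1 (X j y).2.2.2 / lam) with hW
  set R : ℝ × ℝ × ℝ × ℝ → ℝ := fun x => rootG N x.1 x.2.1 x.2.2.1 x.2.2.2 with hR
  set c : ℝ × ℝ × ℝ × ℝ → ℝ := fun x => |deriv cutoff (R x / lam)| *
    rootGDeriv N x.1 x.2.1 x.2.2.1 x.2.2.2 with hc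
  set e : ℝ × ℝ × ℝ × ℝ → ℝ := fun x => |deriv cutoff (R x / lam)| *
    (C * L * rootGParam N x.1 x.2.1 x.2.2.1 x.2.2.2) with he
  set θ : ℝ × ℝ × ℝ × ℝ → ℝ := fun x => lam * cutoff (R x / lam) with hθ
  have hRcont : ContinuousOn R (paramSet l h) := continuousOn_rootG hd.one_lt hd.lt_dim
  have hdc : ContinuousOn (fun x => |deriv cutoff (R x / lam)|) (paramSet l h) :=
    (continuous_deriv_cutoff.comp_continuousOn (hRcont.div_const lam)).abs
  have hccont : ContinuousOn c (paramSet l h) :=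
    hdc.mul (continuousOn_rootGDeriv hd.one_lt hd.lt_dim)
  have hecont : ContinuousOn e (paramSet l h) :=
    hdc.mul (continuousOn_const.mul (continuousOn_rootGParam hd.one_lt hd.lt_dim))
  have hθcont : ContinuousOn θ (paramSet l h) := continuousOn_const.mul
    ((contDiff_cutoff (m := 1)).continuous.comp_continuousOn (hRcont.div_const lam))
  have hc0 : ∀ x ∈ paramSet l h, 0 ≤ c x := fun x hx => mul_nonneg (abs_nonneg _)
    (rootGDeriv_nonneg (hd.one_lt.trans_le hx.1.1) (hx.1.2.trans_lt hd.lt_dim)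
      (hd.one_lt.trans_le hx.2.1.1) (hx.2.1.2.trans_lt hd.lt_dim) hx.2.2.1 hx.2.2.2)
  have he0 : ∀ x ∈ paramSet l h, 0 ≤ e x := fun x hx => mul_nonneg (abs_nonneg _)
    (mul_nonneg (by positivity) (rootGParam_nonneg hx.2.2.1 hx.2.2.2))
  have hθ0 : ∀ x, 0 ≤ θ x := fun x => mul_nonneg hlam.le (cutoff_nonneg _)
  have hθ1 : ∀ x, θ x ≤ lam := fun x => mul_le_of_le_one_right hlam.le (cutoff_le_one _)
  obtain ⟨M, hM0, hcM, heM⟩ : ∃ M : ℝ, 0 ≤ M ∧ (∀ x ∈ paramSet l h, x.2.2.1 ≤ A + 1 → c x ≤ M) ∧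
      ∀ x ∈ paramSet l h, x.2.2.1 ≤ A + 1 → e x ≤ M := by
    obtain ⟨D, hD⟩ := exists_rootG_bound hd.one_lt hd.lt_dim (A + 1) (2 * lam)
    obtain ⟨B, hB, hBb⟩ := exists_deriv_cutoff_bound
    refine ⟨B * (|D| + C * L * |D|), by positivity, fun x hx hxA => ?_, fun x hx hxA => ?_⟩
    · rcases le_total (R x) (2 * lam) with hle | hle
      · obtain ⟨h1, h2⟩ := hD _ hx.1 _ hx.2.1 _ ⟨hx.2.2.1, hxA⟩ _ hx.2.2.2 hle
        refine mul_le_mul (hBb _) ?_ ?_ hB.le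
        · have : 0 ≤ C * L * |D| := by positivity
          linarith [le_abs_self D]
        · exact (rootGDeriv_nonneg (hd.one_lt.trans_le hx.1.1) (hx.1.2.trans_lt hd.lt_dim)
            (hd.one_lt.trans_le hx.2.1.1) (hx.2.1.2.trans_lt hd.lt_dim) hx.2.2.1 hx.2.2.2)
      · rw [hc]
        simp only
        rw [deriv_cutoff_of_ge ((le_div_iff₀ hlam).2 hle), abs_zero, zero_mul]
        positivity
    · rcases le_total (R x) (2 * lam) with hle | hle
      · obtain ⟨h1, h2⟩ := hD _ hx.1 _ hx.2.1 _ ⟨hx.2.2.1, hxA⟩ _ hx.2.2.2 hle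
        refine mul_le_mul (hBb _) ?_ ?_ hB.le
        · have : C * L * rootGParam N x.1 x.2.1 x.2.2.1 x.2.2.2 ≤ C * L * |D| := by
            gcongr
            exact h2.trans (le_abs_self D)
          linarith [abs_nonneg D]
        · exact mul_nonneg (by positivity) (rootGParam_nonneg hx.2.2.1 hx.2.2.2)
      · rw [he]
        simp only
        rw [deriv_cutoff_of_ge ((le_div_iff₀ hlam).2 hle), abs_zero, zero_mul]
        positivity
  have hXp : ∀ j y, X j y ∈ paramSet l h := fun j y => (hXm j y).1
  have hcomp : ∀ {k : ℝ × ℝ × ℝ × ℝ → ℝ}, ContinuousOn k (paramSet l h) →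
      (∀ j, Continuous fun y => k (X j y)) ∧ ∀ᵐ y ∂volume.restrict K, Filter.Tendsto
        (fun j => k (X j y)) Filter.atTop (nhds (k (p y, q y, a y, |u y|))) := by
    intro k hk
    refine ⟨fun j => hk.comp_continuous (hXc j) (hXp j), ?_⟩
    filter_upwards [ae_restrict_of_ae hXt, ae_restrict_mem hK.measurableSet] with y hy hyK
    have hfu : f y = u y := Set.indicator_of_mem (hKL hyK) u
    rw [hfu] at hy
    exact (hk _ (hd.mem_paramSet y (abs_nonneg _))).tendsto.comp
      (tendsto_nhdsWithin_iff.2 ⟨hy, Filter.Eventually.of_forall fun j => hXp j y⟩)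
  obtain ⟨hc1, hc2⟩ := hcomp hccont
  obtain ⟨he1, he2⟩ := hcomp hecont
  obtain ⟨hθ1', hθ2⟩ := hcomp hθcont
  refine ⟨W, hWc, hθ2, ?_⟩
  set F : ℕ → EuclideanSpace ℝ (Fin N) → ℝ≥0∞ := fun j y =>
    ENNReal.ofReal (c (X j y) * m y + e (X j y) + θ (X j y)) with hF
  have hFt : Filter.Tendsto (fun j => ∫⁻ y in K, F j y) Filter.atTop
      (nhds (∫⁻ y in K, ENNReal.ofReal (c (p y, q y, a y, |u y|) * m y +
        e (p y, q y, a y, |u y|) + θ (p y, q y, a y, |u y|)))) := by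
    refine tendsto_lintegral_of_dominated_convergence'
      (fun y => ENNReal.ofReal (M * m y + M + lam)) (fun j => ?_) (fun j => ?_) ?_ ?_
    · refine AEMeasurable.ennreal_ofReal ?_
      have := hmi.aestronglyMeasurable.aemeasurable.restrict (s := K)
      exact ((((hc1 j).measurable.aemeasurable).mul this).add
        (he1 j).measurable.aemeasurable).add (hθ1' j).measurable.aemeasurable
    · refine Filter.Eventually.of_forall fun y => ENNReal.ofReal_le_ofReal ?_
      have h1 := mul_le_mul_of_nonneg_right (hcM _ (hXp j y) (hXm j y).2) (hm0 y)
      linarith [heM _ (hXp j y) (hXm j y).2, hθ1 (X j y)]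
    · have hi : IntegrableOn (fun y => M * m y + M + lam) K :=
        ((hmi.integrableOn.const_mul M).add (integrableOn_const hK.measure_ne_top)).add
          (integrableOn_const hK.measure_ne_top)
      exact hi.lintegral_lt_top.ne
    · filter_upwards [hc2, he2, hθ2] with y h1 h2 h3
      exact (ENNReal.continuous_ofReal.tendsto _).comp (((h1.mul_const (m y)).add h2).add h3)
  have hlim : ∫⁻ y in K, ENNReal.ofReal (c (p y, q y, a y, |u y|) * m y +
        e (p y, q y, a y, |u y|) + θ (p y, q y, a y, |u y|)) =
      ∫⁻ y in K, (ENNReal.ofReal (|deriv cutoff (rootG N (p y) (q y) (a y) |u y| / lam)| *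
            (rootGDeriv N (p y) (q y) (a y) |u y| * ‖g y‖ +
              C * L * rootGParam N (p y) (q y) (a y) |u y|)) +
        ‖lam * cutoff (rootG N (p y) (q y) (a y) |u y| / lam)‖ₑ) := by
    refine setLIntegral_congr_fun hK.measurableSet fun y hy => ?_
    have hx := hd.mem_paramSet y (abs_nonneg (u y))
    rw [ENNReal.ofReal_add (add_nonneg (mul_nonneg (hc0 _ hx) (hm0 y)) (he0 _ hx)) (hθ0 _),
      Real.enorm_eq_ofReal (hθ0 (p y, q y, a y, |u y|))]
    congr 2
    have hmy : m y = ‖g y‖ := Set.indicator_of_mem (hKL hy) _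
    rw [hmy]
    simp only [hc, he, hR]
    ring
  have hbd : ∀ᶠ j in Filter.atTop, ∫⁻ y in K, (‖fderiv ℝ (W j) y‖ₑ + ‖W j y‖ₑ) ≤
      (∫⁻ y in K, F j y) + ENNReal.ofReal M * ∫⁻ y, ‖mollify j m y - m y‖ₑ := by
    have hev : ∀ᶠ j in Filter.atTop, (bump N j).rOut < δ :=
      (tendsto_bump_rOut N).eventually_lt_const hδ
    filter_upwards [hev] with j hj
    have hmc := (contDiff_mollify j hmi.locallyIntegrable).continuous
    have hmeas : AEMeasurable (fun y => ‖mollify j m y - m y‖ₑ) :=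
      (hmc.measurable.aemeasurable.sub hmi.aestronglyMeasurable.aemeasurable).enorm
    have hFm : AEMeasurable (F j) (volume.restrict K) := by
      refine AEMeasurable.ennreal_ofReal ?_
      have := hmi.aestronglyMeasurable.aemeasurable.restrict (s := K)
      exact ((((hc1 j).measurable.aemeasurable).mul this).add
        (he1 j).measurable.aemeasurable).add (hθ1' j).measurable.aemeasurable
    rw [← lintegral_const_mul'' _ hmeas]
    refine le_trans ?_ (add_le_add_right (setLIntegral_le_lintegral K _) _)
    rw [← lintegral_add_left' hFm]
    refine setLIntegral_mono' hK.measurableSet fun y hy => ?_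
    have hyL : Metric.closedBall y (bump N j).rOut ⊆ L' :=
      (Metric.closedBall_subset_closedBall hj.le).trans (Metric.closedBall_subset_cthickening hy δ)
    have hgrad := enorm_fderiv_mollify_le hg hLc hδΩ j hyL
    have hm0' : 0 ≤ mollify j m y := by
      rw [← mollify_const j 0 y]
      exact mollify_mono j continuous_const.locallyIntegrable hmi.locallyIntegrable hm0 y
    rw [← ofReal_norm, Real.enorm_eq_ofReal hm0', ENNReal.ofReal_le_ofReal_iff hm0'] at hgrad
    have h1 := hWd j y
    have h2 : ‖W j y‖ = θ (X j y) := by rw [Real.norm_eq_abs, abs_of_nonneg (hθ0 (X j y))]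
    rw [← ofReal_norm, ← ofReal_norm, ← ofReal_norm, h2, ← ENNReal.ofReal_add (norm_nonneg _) (hθ0 _),
      ← ENNReal.ofReal_mul hM0, ← ENNReal.ofReal_add
      (add_nonneg (add_nonneg (mul_nonneg (hc0 _ (hXp j y)) (hm0 y)) (he0 _ (hXp j y))) (hθ0 _))
      (by positivity)]
    refine ENNReal.ofReal_le_ofReal ?_
    have h3 : ‖fderiv ℝ (W j) y‖ ≤ c (X j y) * ‖fderiv ℝ (mollify j f) y‖ + e (X j y) := by
      refine h1.trans (le_of_eq ?_)
      simp only [hc, he, hR]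
      ring
    have h4 : c (X j y) * ‖fderiv ℝ (mollify j f) y‖ ≤ c (X j y) * m y +
        M * ‖mollify j m y - m y‖ := by
      have h5 : ‖fderiv ℝ (mollify j f) y‖ ≤ m y + ‖mollify j m y - m y‖ := by
        refine hgrad.trans ?_
        linarith [le_abs_self (mollify j m y - m y), Real.norm_eq_abs (mollify j m y - m y)]
      have h6 := mul_le_mul_of_nonneg_left h5 (hc0 _ (hXp j y))
      have h7 := mul_le_mul_of_nonneg_right (hcM _ (hXp j y) (hXm j y).2)
        (norm_nonneg (mollify j m y - m y))
      linarith
    linarith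
  rw [← hlim]
  have hz : Filter.Tendsto (fun j => (∫⁻ y in K, F j y) +
      ENNReal.ofReal M * ∫⁻ y, ‖mollify j m y - m y‖ₑ) Filter.atTop
      (nhds (∫⁻ y in K, ENNReal.ofReal (c (p y, q y, a y, |u y|) * m y +
        e (p y, q y, a y, |u y|) + θ (p y, q y, a y, |u y|)))) := by
    have := hFt.add (ENNReal.Tendsto.const_mul (tendsto_lintegral_mollify_sub hmi)
      (Or.inr (ENNReal.ofReal_ne_top (r := M))))
    simpa using this
  exact (Filter.limsup_le_limsup hbd).trans hz.limsup_eq.le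

theorem tsum_rpow_le_rpow_tsum {s : ℝ} (hs : 1 ≤ s) (b : ℕ → ℝ≥0∞) :
    ∑' j, b j ^ s ≤ (∑' j, b j) ^ s := by
  have e : ∀ x : ℝ≥0∞, x ^ s = x * x ^ (s - 1) := fun x => by
    nth_rewrite 2 [← ENNReal.rpow_one x]
    rw [← ENNReal.rpow_add_of_nonneg _ _ zero_le_one (by linarith), add_sub_cancel]
  calc ∑' j, b j ^ s ≤ ∑' j, b j * (∑' i, b i) ^ (s - 1) := by
        refine ENNReal.tsum_le_tsum fun j => ?_
        rw [e]
        have := ENNReal.rpow_le_rpow (ENNReal.le_tsum (f := b) j) (by linarith : 0 ≤ s - 1)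
        gcongr
    _ = _ := by rw [ENNReal.tsum_mul_right, ← e]

theorem exists_dyadic_near {v M : ℝ} (hv : 0 < v) (hM : 0 < M) :
    ∃ j : ℕ, 2 * (M / 2 ^ (j + 1)) ≤ v ∧ min v M ≤ 4 * (M / 2 ^ (j + 1)) := by
  have hex : ∃ j : ℕ, M / 2 ^ j ≤ v := by
    obtain ⟨j, hj⟩ := pow_unbounded_of_one_lt (M / v) (by norm_num : (1 : ℝ) < 2)
    refine ⟨j, ?_⟩
    rw [div_lt_iff₀ hv] at hj
    rw [div_le_iff₀ (by positivity)]
    linarith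
  classical
  have e : ∀ j : ℕ, 2 * (M / 2 ^ (j + 1)) = M / 2 ^ j := fun j => by
    rw [pow_succ]; field_simp
  refine ⟨Nat.find hex, ?_, ?_⟩
  · rw [e]; exact Nat.find_spec hex
  · have e4 : 4 * (M / 2 ^ (Nat.find hex + 1)) = 2 * (M / 2 ^ Nat.find hex) := by
      rw [← e]; ring
    rw [e4]
    rcases Nat.eq_zero_or_pos (Nat.find hex) with h0 | hpos
    · rw [h0, pow_zero, div_one]
      exact (min_le_right _ _).trans (by linarith)
    · have hmin := Nat.find_min hex (Nat.sub_lt hpos one_pos)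
      have e1 : Nat.find hex - 1 + 1 = Nat.find hex := Nat.succ_pred_eq_of_pos hpos
      rw [not_le, ← e, e1] at hmin
      exact (min_le_left _ _).trans hmin.le

theorem tsum_dyadic_cutoff_le {v M : ℝ} (hv : 0 ≤ v) (hM : 0 < M) :
    ∑' j : ℕ, ENNReal.ofReal (M / 2 ^ (j + 1) * cutoff (v / (M / 2 ^ (j + 1)))) ≤
      2 * ENNReal.ofReal (min v M) := by
  have hl : ∀ j : ℕ, 0 < M / 2 ^ (j + 1) := fun j => by positivity
  have hstep : ∀ j : ℕ, M / 2 ^ (j + 1) * cutoff (v / (M / 2 ^ (j + 1))) ≤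
      2 * (min v (M / 2 ^ (j + 1)) - min v (M / 2 ^ (j + 2))) := by
    intro j
    have e : M / 2 ^ (j + 2) = M / 2 ^ (j + 1) / 2 := by rw [pow_succ _ (j + 1)]; field_simp
    rw [e]
    have h0 := hl j
    generalize M / 2 ^ (j + 1) = s at *
    rcases le_total v s with h | h
    · rw [cutoff_of_le ((div_le_one h0).2 h), mul_zero, min_eq_left h]
      linarith [min_le_left v (s / 2)]
    · rw [min_eq_right h, min_eq_right (by linarith)]
      nlinarith [cutoff_le_one (v / s)]
  have hsum : ∀ n : ℕ, ∑ j ∈ Finset.range n,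
      M / 2 ^ (j + 1) * cutoff (v / (M / 2 ^ (j + 1))) ≤
      2 * (min v (M / 2 ^ 1) - min v (M / 2 ^ (n + 1))) := by
    intro n
    induction n with
    | zero => simp
    | succ n ih =>
      rw [Finset.sum_range_succ]
      linarith [hstep n]
  refine ENNReal.tsum_le_of_sum_range_le fun n => ?_
  rw [← ENNReal.ofReal_sum_of_nonneg fun j _ => mul_nonneg (hl j).le (cutoff_nonneg _),
    ← ENNReal.ofReal_ofNat 2, ← ENNReal.ofReal_mul (by norm_num)]
  refine ENNReal.ofReal_le_ofReal ((hsum n).trans ?_)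
  have h1 : 0 ≤ min v (M / 2 ^ (n + 1)) := le_min hv (by positivity)
  have h2 : min v (M / 2 ^ 1) ≤ min v M := min_le_min_left _ (by linarith)
  linarith

theorem tsum_dyadic_indicator_le {α : Type*} (v : α → ℝ) (G : α → ℝ≥0∞) {M : ℝ} (hM : 0 < M)
    (x : α) : ∑' j : ℕ, {x | M / 2 ^ (j + 1) < v x ∧ v x < 2 * (M / 2 ^ (j + 1))}.indicator G x ≤
      {x | v x < M}.indicator G x := by
  have e : ∀ j : ℕ, 2 * (M / 2 ^ (j + 1)) = M / 2 ^ j := fun j => by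
    rw [pow_succ]; field_simp
  simp_rw [e]
  have hanti : ∀ {i j : ℕ}, i ≤ j → M / 2 ^ j ≤ M / 2 ^ i := fun hij => by
    have : (2 : ℝ) ^ _ ≤ 2 ^ _ := pow_le_pow_right₀ one_le_two hij
    gcongr
  by_cases hx : ∃ j : ℕ, x ∈ {x | M / 2 ^ (j + 1) < v x ∧ v x < M / 2 ^ j}
  · obtain ⟨j, hj⟩ := hx
    rw [tsum_eq_single j]
    · rw [Set.indicator_of_mem hj, Set.indicator_of_mem]
      exact hj.2.trans_le (by simpa using hanti (Nat.zero_le j))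
    · intro i hij
      refine Set.indicator_of_notMem (fun hi => ?_) _
      rcases lt_or_gt_of_ne hij with h | h
      · exact absurd (hi.1.trans hj.2) (not_lt.2 (hanti h))
      · exact absurd (hj.1.trans hi.2) (not_lt.2 (hanti h))
  · push Not at hx
    rw [ENNReal.tsum_eq_zero.2 fun j => Set.indicator_of_notMem (hx j) _]
    exact zero_le

theorem lintegral_min_rpow_le {N : ℕ} (hN : 2 ≤ N) {Ω : Set (EuclideanSpace ℝ (Fin N))}
    (hΩ : MeasurableSet Ω) {C B : ℝ≥0∞} {v : EuclideanSpace ℝ (Fin N) → ℝ}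
    (hv : AEMeasurable v (volume.restrict Ω)) (hv0 : ∀ x, 0 ≤ v x)
    {G : EuclideanSpace ℝ (Fin N) → ℝ≥0∞} (hG : AEMeasurable G (volume.restrict Ω))
    (hweak : ∀ lam : ℝ, 0 < lam → volume ({x | 2 * lam ≤ v x} ∩ Ω) ≤
      (C * (∫⁻ x in Ω, (B * {x | lam < v x ∧ v x < 2 * lam}.indicator G x +
        ENNReal.ofReal (lam * cutoff (v x / lam)))) / ENNReal.ofReal lam) ^ ((N : ℝ) / (N - 1)))
    {M : ℝ} (hM : 0 < M) :
    ∫⁻ x in Ω, ENNReal.ofReal (min (v x) M) ^ ((N : ℝ) / (N - 1)) ≤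
      (4 * (C * (B * (∫⁻ x in Ω, {x | v x < M}.indicator G x) +
        2 * ∫⁻ x in Ω, ENNReal.ofReal (min (v x) M)))) ^ ((N : ℝ) / (N - 1)) := by
  have hN' : (2 : ℝ) ≤ N := by exact_mod_cast hN
  have hs1 : 1 ≤ (N : ℝ) / (N - 1) := by rw [le_div_iff₀ (by linarith)]; linarith
  set s : ℝ := (N : ℝ) / (N - 1) with hs
  have hs0 : 0 ≤ s := by linarith
  have hl : ∀ j : ℕ, 0 < M / 2 ^ (j + 1) := fun j => by positivity
  have hA : ∀ c d : ℝ, NullMeasurableSet {x | c < v x ∧ v x < d} (volume.restrict Ω) := fun c d =>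
    (nullMeasurableSet_lt aemeasurable_const hv).inter (nullMeasurableSet_lt hv aemeasurable_const)
  have hS : ∀ c : ℝ, NullMeasurableSet {x | c ≤ v x} (volume.restrict Ω) := fun c =>
    nullMeasurableSet_le aemeasurable_const hv
  have hcut : ∀ lam : ℝ, AEMeasurable (fun x => ENNReal.ofReal (lam * cutoff (v x / lam)))
      (volume.restrict Ω) := fun lam => by
    have : Measurable cutoff := (contDiff_cutoff (m := 1)).continuous.measurable
    exact ((this.comp_aemeasurable (hv.div_const lam)).const_mul lam).ennreal_ofReal
  set b : ℕ → ℝ≥0∞ := fun j => ∫⁻ x in Ω, (B * {x | M / 2 ^ (j + 1) < v x ∧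
    v x < 2 * (M / 2 ^ (j + 1))}.indicator G x +
        ENNReal.ofReal (M / 2 ^ (j + 1) * cutoff (v x / (M / 2 ^ (j + 1))))) with hb
  have hbsum : ∑' j, b j ≤ B * (∫⁻ x in Ω, {x | v x < M}.indicator G x) +
        2 * ∫⁻ x in Ω, ENNReal.ofReal (min (v x) M) := by
    have hm1 : ∀ j : ℕ, AEMeasurable ({x | M / 2 ^ (j + 1) < v x ∧
        v x < 2 * (M / 2 ^ (j + 1))}.indicator G) (volume.restrict Ω) := fun j =>
      hG.indicator₀ (hA _ _)
    have hm2 : AEMeasurable ({x | v x < M}.indicator G) (volume.restrict Ω) :=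
      hG.indicator₀ (nullMeasurableSet_lt hv aemeasurable_const)
    have hm3 : AEMeasurable (fun x => ENNReal.ofReal (min (v x) M)) (volume.restrict Ω) :=
      (hv.min aemeasurable_const).ennreal_ofReal
    have hm4 : ∀ j : ℕ, AEMeasurable (fun x => B * {x | M / 2 ^ (j + 1) < v x ∧
        v x < 2 * (M / 2 ^ (j + 1))}.indicator G x +
        ENNReal.ofReal (M / 2 ^ (j + 1) * cutoff (v x / (M / 2 ^ (j + 1))))) (volume.restrict Ω) :=
      fun j => ((hm1 j).const_mul B).add (hcut _)
    simp only [hb]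
    rw [← lintegral_tsum hm4,
      ← lintegral_const_mul'' _ hm2, ← lintegral_const_mul'' _ hm3,
      ← lintegral_add_left' (hm2.const_mul B)]
    refine lintegral_mono fun x => ?_
    rw [ENNReal.tsum_add, ENNReal.tsum_mul_left]
    gcongr
    · exact tsum_dyadic_indicator_le v G hM x
    · exact tsum_dyadic_cutoff_le (hv0 x) hM
  calc ∫⁻ x in Ω, ENNReal.ofReal (min (v x) M) ^ s
      ≤ ∫⁻ x in Ω, ∑' j : ℕ, {x | 2 * (M / 2 ^ (j + 1)) ≤ v x}.indicator
          (fun _ => ENNReal.ofReal (4 * (M / 2 ^ (j + 1))) ^ s) x := by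
        refine lintegral_mono fun x => ?_
        rcases (hv0 x).eq_or_lt with h0 | h0
        · rw [← h0, min_eq_left hM.le, ENNReal.ofReal_zero, ENNReal.zero_rpow_of_pos (by linarith)]
          exact zero_le
        · obtain ⟨j, hj1, hj2⟩ := exists_dyadic_near h0 hM
          refine le_trans ?_ (ENNReal.le_tsum j)
          rw [Set.indicator_of_mem (by exact hj1)]
          gcongr
    _ = ∑' j : ℕ, ENNReal.ofReal (4 * (M / 2 ^ (j + 1))) ^ s *
          volume ({x | 2 * (M / 2 ^ (j + 1)) ≤ v x} ∩ Ω) := by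
        rw [lintegral_tsum fun j => aemeasurable_const.indicator₀ (hS _)]
        refine tsum_congr fun j => ?_
        rw [lintegral_indicator_const₀ (hS _), Measure.restrict_apply' hΩ]
    _ ≤ ∑' j : ℕ, (4 * (C * b j)) ^ s := by
        refine ENNReal.tsum_le_tsum fun j => ?_
        refine (mul_le_mul_right (hweak _ (hl j)) _).trans (le_of_eq ?_)
        rw [← ENNReal.mul_rpow_of_nonneg _ _ hs0, ENNReal.ofReal_mul (by norm_num),
          ENNReal.ofReal_ofNat, mul_assoc, ENNReal.mul_div_cancel]
        · simpa using hl j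
        · exact ENNReal.ofReal_ne_top
    _ ≤ (∑' j : ℕ, 4 * (C * b j)) ^ s := tsum_rpow_le_rpow_tsum hs1 _
    _ ≤ _ := by
        rw [ENNReal.tsum_mul_left, ENNReal.tsum_mul_left]
        gcongr

theorem exists_rpow_mul_rpow_le {θ₁ ε : ℝ} (hθ₁ : θ₁ < 1) (hε : 0 < ε) : ∃ C : ℝ, 0 ≤ C ∧
    ∀ θ ∈ Set.Icc 0 θ₁, ∀ x y : ℝ, 0 ≤ x → 0 ≤ y → x ^ θ * y ^ (1 - θ) ≤ ε * x + C * y := by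
  have hm : 0 < min 1 ε := by positivity
  obtain ⟨η, hη⟩ : ∃ η, η = (min 1 ε) ^ (1 / (1 - θ₁)) := ⟨_, rfl⟩
  have h1 : 0 < 1 - θ₁ := by linarith
  have hη0 : 0 < η := by rw [hη]; positivity
  have hη1 : η ≤ 1 := by
    rw [hη]; exact Real.rpow_le_one hm.le (min_le_left _ _) (by positivity)
  have hηε : η ^ (1 - θ₁) ≤ ε := by
    rw [hη, ← Real.rpow_mul hm.le, one_div, inv_mul_cancel₀ h1.ne', Real.rpow_one]
    exact min_le_right _ _
  refine ⟨η⁻¹, by positivity, fun θ hθ x y hx hy => ?_⟩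
  have hθ1 : 0 < 1 - θ := by linarith [hθ.2]
  have split : ∀ z : ℝ, 0 ≤ z → z ^ θ * z ^ (1 - θ) = z := fun z hz => by
    rw [← Real.rpow_add_of_nonneg hz hθ.1 hθ1.le, add_sub_cancel, Real.rpow_one]
  rcases le_total y (η * x) with h | h
  · calc x ^ θ * y ^ (1 - θ) ≤ x ^ θ * (η * x) ^ (1 - θ) := by gcongr
      _ = η ^ (1 - θ) * x := by
        rw [Real.mul_rpow hη0.le hx, mul_left_comm, split x hx]
      _ ≤ ε * x := by
        gcongr
        exact (Real.rpow_le_rpow_of_exponent_ge hη0 hη1 (by linarith [hθ.2])).trans hηε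
      _ ≤ _ := le_add_of_nonneg_right (by positivity)
  · have hx' : x ≤ η⁻¹ * y := by rw [← div_eq_inv_mul, le_div_iff₀ hη0]; linarith
    calc x ^ θ * y ^ (1 - θ) ≤ (η⁻¹ * y) ^ θ * y ^ (1 - θ) := by
          gcongr
          exact hθ.1
      _ = (η⁻¹) ^ θ * y := by rw [Real.mul_rpow (by positivity) hy, mul_assoc, split y hy]
      _ ≤ η⁻¹ * y := by
        gcongr
        nth_rewrite 2 [← Real.rpow_one η⁻¹]
        exact Real.rpow_le_rpow_of_exponent_le ((one_le_inv₀ hη0).2 hη1) (by linarith [hθ.2])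
      _ ≤ _ := le_add_of_nonneg_left (by positivity)

theorem exists_rpow_le_interpolation {ε c D : ℝ} (hε : 0 < ε) (hc : 0 < c) :
    ∃ C : ℝ, 0 ≤ C ∧ ∀ t e₀ s e₁ : ℝ, 0 ≤ t → 0 < e₀ → e₀ ≤ s → s ≤ e₀ + D → s + c ≤ e₁ →
      t ^ s ≤ ε * t ^ e₁ + C * t ^ e₀ := by
  have hm : 0 < min 1 ε := by positivity
  obtain ⟨T, hT⟩ : ∃ T, T = ((min 1 ε) ^ (1 / c))⁻¹ := ⟨_, rfl⟩
  have hT1 : 1 ≤ T := by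
    rw [hT]
    exact (one_le_inv₀ (by positivity)).2 (Real.rpow_le_one hm.le (min_le_left _ _) (by positivity))
  have hTε : T ^ (-c) ≤ ε := by
    rw [hT, Real.inv_rpow (by positivity), ← Real.rpow_mul hm.le, ← Real.rpow_neg hm.le]
    have : -(1 / c * -c) = 1 := by field_simp
    rw [this, Real.rpow_one]
    exact min_le_right _ _
  refine ⟨T ^ D, by positivity, fun t e₀ s e₁ ht he0 hs hsD hse => ?_⟩
  rcases le_total T t with h | h
  · have ht0 : 0 < t := by linarith
    calc t ^ s = t ^ (s - e₁) * t ^ e₁ := by rw [← Real.rpow_add ht0]; ring_nf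
      _ ≤ ε * t ^ e₁ := by
        gcongr
        calc t ^ (s - e₁) ≤ t ^ (-c) :=
              Real.rpow_le_rpow_of_exponent_le (hT1.trans h) (by linarith)
          _ ≤ T ^ (-c) := Real.rpow_le_rpow_of_nonpos (by linarith) h (by linarith)
          _ ≤ ε := hTε
      _ ≤ _ := le_add_of_nonneg_right (by positivity)
  · rcases ht.eq_or_lt with rfl | ht0
    · rw [Real.zero_rpow (by linarith)]; positivity
    calc t ^ s = t ^ (s - e₀) * t ^ e₀ := by rw [← Real.rpow_add ht0]; ring_nf
      _ ≤ T ^ D * t ^ e₀ := by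
        gcongr
        calc t ^ (s - e₀) ≤ T ^ (s - e₀) := by
              gcongr
          _ ≤ T ^ D := Real.rpow_le_rpow_of_exponent_le hT1 (by linarith)
      _ ≤ _ := le_add_of_nonneg_left (by positivity)

theorem abs_log_le {t η : ℝ} (ht : 0 < t) (hη : 0 < η) :
    |Real.log t| ≤ (t ^ η + t ^ (-η)) / η := by
  have h1 := Real.log_le_rpow_div ht.le hη
  have h2 := Real.log_le_rpow_div (inv_nonneg.2 ht.le) hη
  rw [Real.log_inv, Real.inv_rpow ht.le, ← Real.rpow_neg ht.le] at h2
  have p1 : 0 ≤ t ^ η / η := by positivity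
  have p2 : 0 ≤ t ^ (-η) / η := by positivity
  rw [add_div, abs_le]
  constructor <;> linarith

section Estimates

variable {n l h : ℝ}

theorem expP_sub_ge {p : ℝ} (hl : 1 < l) (hh : h < n) (hp : p ∈ Set.Icc l h) :
    (l - 1) / n ≤ expP n p - p := by
  have h1 : 0 < n - p := by linarith [hp.2]
  have h2 : 0 < n := by linarith [hp.1]
  have e : expP n p - p = p * (p - 1) / (n - p) := by rw [expP]; field_simp; ring
  rw [e, div_le_div_iff₀ h2 h1]
  nlinarith [hp.1, mul_pos (by linarith : 0 < l - 1) h2, mul_nonneg (by linarith [hp.1] : 0 ≤ p - l) h2.le,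
    mul_pos (by linarith : 0 < l - 1) (by linarith [hp.1] : 0 < p),
    mul_nonneg (mul_nonneg (by linarith [hp.1] : 0 ≤ p - 1) (by linarith [hp.1] : 0 ≤ p - 1)) h2.le]

theorem crit_sub_expP_ge {p : ℝ} (hl : 1 < l) (hh : h < n) (hp : p ∈ Set.Icc l h) :
    1 / n ≤ n * p / (n - p) - expP n p := by
  have h1 : 0 < n - p := by linarith [hp.2]
  have h2 : 0 < n := by linarith [hp.1]
  have e : n * p / (n - p) - expP n p = p / (n - p) := by rw [expP]; field_simp; ring
  rw [e, div_le_div_iff₀ h2 h1]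
  nlinarith [hp.1]

theorem exists_rpow_log_le (hl : 1 < l) (hh : h < n) {ε : ℝ} (hε : 0 < ε) :
    ∃ C : ℝ, 0 ≤ C ∧ ∀ p ∈ Set.Icc l h, ∀ t : ℝ, 0 ≤ t →
      t ^ (expP n p - 1) * |t * Real.log t| ≤ ε * t ^ (n * p / (n - p)) + C * t ^ p := by
  obtain ⟨D, hD, hDb⟩ := exists_exp_bound (l := l) hh
  rcases lt_or_ge h l with hlh | hlh
  · exact ⟨0, le_rfl, fun p hp => absurd (hp.1.trans hp.2) (not_le.2 hlh)⟩
  have hn : 0 < n := by linarith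
  obtain ⟨η, hη0, hη1, hη2⟩ : ∃ η : ℝ, 0 < η ∧ η ≤ (l - 1) / n ∧ η ≤ 1 / n / 2 :=
    ⟨min ((l - 1) / n) (1 / n / 2), lt_min (div_pos (by linarith) hn) (by positivity),
      min_le_left _ _, min_le_right _ _⟩
  obtain ⟨C, hC, hCb⟩ := exists_rpow_le_interpolation (ε := ε * η / 2) (c := 1 / n / 2)
    (D := D + 1 / n) (by positivity) (by positivity)
  refine ⟨2 * C / η, by positivity, fun p hp t ht => ?_⟩
  rcases ht.eq_or_lt with rfl | ht0
  · simp only [zero_mul, abs_zero, mul_zero]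
    positivity
  have hp0 : 0 < p := by linarith [hp.1]
  have g1 := expP_sub_ge hl hh hp
  have g2 := crit_sub_expP_ge hl hh hp
  have g3 := (hDb p hp).2.2.2
  have b1 := hCb t p (expP n p + η) (n * p / (n - p)) ht hp0 (by linarith) (by linarith)
    (by linarith)
  have b2 := hCb t p (expP n p - η) (n * p / (n - p)) ht hp0 (by linarith)
    (by have : 0 < 1 / n := by positivity
        linarith) (by linarith)
  have e : t ^ (expP n p - 1) * |t * Real.log t| = t ^ expP n p * |Real.log t| := by
    rw [abs_mul, abs_of_pos ht0, ← mul_assoc, ← Real.rpow_add_one ht0.ne', sub_add_cancel]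
  have hlog := mul_le_mul_of_nonneg_left (abs_log_le ht0 hη0) (Real.rpow_nonneg ht (expP n p))
  rw [e]
  refine hlog.trans ?_
  have e2 : t ^ expP n p * ((t ^ η + t ^ (-η)) / η) =
      (t ^ (expP n p + η) + t ^ (expP n p - η)) / η := by
    rw [sub_eq_add_neg, Real.rpow_add ht0, Real.rpow_add ht0]; ring
  rw [e2, div_le_iff₀ hη0]
  have e3 : (ε * t ^ (n * p / (n - p)) + 2 * C / η * t ^ p) * η =
    ε * η * t ^ (n * p / (n - p)) + 2 * C * t ^ p := by field_simp
  rw [e3]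
  linarith

theorem exists_rpow_mul_le (hl : 1 < l) (hh : h < n) {ε : ℝ} (hε : 0 < ε) :
    ∃ C : ℝ, 0 ≤ C ∧ ∀ p ∈ Set.Icc l h, ∀ t s : ℝ, 0 ≤ t → 0 ≤ s →
      expP n p * t ^ (expP n p - 1) * s ≤ ε * t ^ (n * p / (n - p)) + C * s ^ p := by
  obtain ⟨D, hD, hDb⟩ := exists_exp_bound (l := l) hh
  rcases lt_or_ge h l with hlh | hlh
  · exact ⟨0, le_rfl, fun p hp => absurd (hp.1.trans hp.2) (not_le.2 hlh)⟩
  have hh0 : 0 < h := by linarith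
  obtain ⟨C, hC, hCb⟩ := exists_rpow_mul_rpow_le (θ₁ := 1 - 1 / h) (ε := ε / (D + 1))
    (by have : 0 < 1 / h := by positivity
        linarith) (by positivity)
  refine ⟨(D + 1) * C, by positivity, fun p hp t s ht hs => ?_⟩
  have hp0 : 0 < p := by linarith [hp.1]
  have hnp : 0 < n - p := by linarith [hp.2]
  have hθ : 1 - 1 / p ∈ Set.Icc 0 (1 - 1 / h) := by
    constructor
    · rw [sub_nonneg, div_le_one hp0]; linarith [hp.1]
    · have := one_div_le_one_div_of_le hp0 hp.2
      linarith
  have hY := hCb _ hθ (t ^ (n * p / (n - p))) (s ^ p) (by positivity) (by positivity)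
  rw [← Real.rpow_mul ht, ← Real.rpow_mul hs, sub_sub_cancel, mul_one_div_cancel hp0.ne',
    Real.rpow_one] at hY
  have e : n * p / (n - p) * (1 - 1 / p) = expP n p - 1 := by
    rw [expP]; field_simp; ring
  rw [e] at hY
  have hα : expP n p ≤ D + 1 := by linarith [(hDb p hp).2.2.2]
  calc expP n p * t ^ (expP n p - 1) * s = expP n p * (t ^ (expP n p - 1) * s) := by ring
    _ ≤ (D + 1) * (ε / (D + 1) * t ^ (n * p / (n - p)) + C * s ^ p) := by
      gcongr
    _ = _ := by field_simp

theorem mul_expA (n q : ℝ) : q * expA n q = expP n q := by rw [expA, expP]; ring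

theorem rpow_expA_mul {a t q : ℝ} (hq : 0 < q) (ha : 0 ≤ a) (ht : 0 ≤ t) :
    a ^ expA n q * t ^ expP n q = (a ^ (1 / q) * t) ^ expP n q := by
  rw [Real.mul_rpow (by positivity) ht, ← Real.rpow_mul ha, ← mul_expA, ← mul_assoc,
    one_div_mul_cancel hq.ne', one_mul]

theorem rpow_mul_rpow_eq {a t q : ℝ} (ha : 0 ≤ a) (ht : 0 ≤ t) (c : ℝ) :
    a ^ (c / q) * t ^ c = (a ^ (1 / q) * t) ^ c := by
  rw [Real.mul_rpow (by positivity) ht, ← Real.rpow_mul ha, one_div_mul_eq_div]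

theorem mul_rpow_eq {a t q : ℝ} (hq : 0 < q) (ha : 0 ≤ a) (ht : 0 ≤ t) :
    a * t ^ q = (a ^ (1 / q) * t) ^ q := by
  rw [← rpow_mul_rpow_eq ha ht, div_self hq.ne', Real.rpow_one]

theorem exists_rootGDeriv_mul_le (hl : 1 < l) (hh : h < n) {ε : ℝ} (hε : 0 < ε) :
    ∃ C : ℝ, 0 ≤ C ∧ ∀ p ∈ Set.Icc l h, ∀ q ∈ Set.Icc l h, ∀ a t s : ℝ, 0 ≤ a → 0 ≤ t → 0 ≤ s →
      rootGDeriv n p q a t * s ≤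
        ε * (t ^ (n * p / (n - p)) + a ^ (n * q / (n - q) / q) * t ^ (n * q / (n - q))) +
        C * (s ^ p + a * s ^ q) := by
  obtain ⟨C, hC, hCb⟩ := exists_rpow_mul_le hl hh hε
  refine ⟨C, hC, fun p hp q hq a t s ha ht hs => ?_⟩
  have hq0 : 0 < q := by linarith [hq.1]
  have h1 := hCb p hp t s ht hs
  have h2 := hCb q hq (a ^ (1 / q) * t) (a ^ (1 / q) * s) (by positivity) (by positivity)
  rw [← rpow_mul_rpow_eq ha ht (n * q / (n - q)), ← mul_rpow_eq hq0 ha hs] at h2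
  have hβ := one_lt_expP (hl.trans_le hq.1) (hq.2.trans_lt hh)
  have e : expP n q * (a ^ (1 / q) * t) ^ (expP n q - 1) * (a ^ (1 / q) * s) =
      a ^ expA n q * (expP n q * t ^ (expP n q - 1)) * s := by
    have e1 : (a ^ (1 / q)) ^ (expP n q - 1) * a ^ (1 / q) = a ^ expA n q := by
      rw [← Real.rpow_mul ha, ← Real.rpow_add_of_nonneg ha (mul_nonneg (by positivity) (by linarith))
        (by positivity), ← mul_expA]
      congr 1
      field_simp
      ring
    rw [Real.mul_rpow (by positivity) ht, ← e1]
    ring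
  rw [e] at h2
  rw [rootGDeriv, mul_expA]
  linarith

theorem exists_mixed_le (hl : 1 < l) (hh : h < n) {δ ε : ℝ} (hδ : 0 < δ) (hε : 0 < ε) :
    ∃ C : ℝ, 0 ≤ C ∧ ∀ p ∈ Set.Icc l h, ∀ q ∈ Set.Icc l h, p ≤ q → δ ≤ p * ((n + 1) / n) - q →
      ∀ a t : ℝ, 0 ≤ a → 0 ≤ t →
      a ^ (expA n q - 1) * t ^ expP n q ≤
        ε * (t ^ (n * p / (n - p)) + a ^ (n * q / (n - q) / q) * t ^ (n * q / (n - q))) +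
        C * t ^ p := by
  rcases lt_or_ge h l with hlh | hlh
  · exact ⟨0, le_rfl, fun p hp => absurd (hp.1.trans hp.2) (not_le.2 hlh)⟩
  have hn : 0 < n := by linarith
  obtain ⟨C₁, hC₁, h1⟩ := exists_rpow_mul_rpow_le (θ₁ := (h - 1) / n) (ε := ε)
    (by rw [div_lt_one hn]; linarith) hε
  obtain ⟨C₂, hC₂, h2⟩ := exists_rpow_le_interpolation (ε := ε / (C₁ + 1)) (c := δ) (D := n * n)
    (by positivity) hδ
  refine ⟨C₁ * C₂, by positivity, fun p hp q hq hpq hpqδ a t ha ht => ?_⟩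
  have hp0 : 0 < p := by linarith [hp.1]
  have hq0 : 0 < q := by linarith [hq.1]
  have hnp : 0 < n - p := by linarith [hp.2]
  have hnq : 0 < n - q := by linarith [hq.2]
  have hnq' : 0 < n + 1 - q := by linarith [hq.2]
  obtain ⟨s, hs⟩ : ∃ s, s = q * n / (n + 1 - q) := ⟨_, rfl⟩
  have hθ : (q - 1) / n ∈ Set.Icc 0 ((h - 1) / n) := by
    refine ⟨div_nonneg (by linarith [hq.1]) hn.le, ?_⟩
    have := hq.2
    gcongr
  have hA : 0 ≤ n * q / (n - q) / q := by positivity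
  have hY := h1 _ hθ (a ^ (n * q / (n - q) / q) * t ^ (n * q / (n - q))) (t ^ s) (by positivity)
    (by positivity)
  have hI := h2 t p s (n * p / (n - p)) ht hp0 (by
      rw [hs]
      refine hpq.trans ?_
      rw [le_div_iff₀ hnq']
      nlinarith [hq.1])
    (by
      have : s ≤ n * n := by
        rw [hs, div_le_iff₀ hnq']
        have : q * n ≤ n * n := by nlinarith
        nlinarith [mul_nonneg (mul_self_nonneg n) hnq.le]
      linarith)
    (by
      have e : n * p / (n - p) - s = n * (p * (n + 1) - q * n) / ((n - p) * (n + 1 - q)) := by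
        rw [hs]; field_simp; ring
      have hδ' : n * δ ≤ p * (n + 1) - q * n := by
        have : n * (p * ((n + 1) / n) - q) = p * (n + 1) - q * n := by field_simp
        nlinarith
      have hden : (n - p) * (n + 1 - q) ≤ n * n :=
        mul_le_mul (by linarith) (by linarith [hq.1]) hnq'.le hn.le
      have : δ ≤ n * (p * (n + 1) - q * n) / ((n - p) * (n + 1 - q)) := by
        rw [le_div_iff₀ (by positivity)]
        nlinarith [mul_le_mul_of_nonneg_left hden hδ.le, mul_le_mul_of_nonneg_left hδ' hn.le]
      linarith)
  have e : (a ^ (n * q / (n - q) / q) * t ^ (n * q / (n - q))) ^ ((q - 1) / n) *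
      (t ^ s) ^ (1 - (q - 1) / n) = a ^ (expA n q - 1) * t ^ expP n q := by
    have hθ1 : 0 ≤ 1 - (q - 1) / n := by
      rw [sub_nonneg, div_le_one hn]; linarith
    have hs0 : 0 ≤ s := by rw [hs]; positivity
    rw [Real.mul_rpow (by positivity) (by positivity), ← Real.rpow_mul ha, ← Real.rpow_mul ht,
      ← Real.rpow_mul ht, mul_assoc, ← Real.rpow_add_of_nonneg ht (mul_nonneg (by positivity) hθ.1)
        (mul_nonneg hs0 hθ1)]
    congr 2
    · rw [expA]; field_simp; ring
    · rw [hs, expP]; field_simp; ring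
  rw [e] at hY
  refine hY.trans ?_
  have hfin := mul_le_mul_of_nonneg_left hI hC₁
  have hlast : C₁ * (ε / (C₁ + 1) * t ^ (n * p / (n - p))) ≤ ε * t ^ (n * p / (n - p)) := by
    rw [← mul_assoc]
    gcongr
    rw [mul_div_assoc', div_le_iff₀ (by positivity)]
    nlinarith
  linarith

theorem exists_rootGParam_le (hl : 1 < l) (hh : h < n) (A : ℝ) {δ ε : ℝ} (hδ : 0 < δ)
    (hε : 0 < ε) :
    ∃ C : ℝ, 0 ≤ C ∧ ∀ p ∈ Set.Icc l h, ∀ q ∈ Set.Icc l h, p ≤ q → δ ≤ p * ((n + 1) / n) - q →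
      ∀ a ∈ Set.Icc 0 A, ∀ t : ℝ, 0 ≤ t →
      rootGParam n p q a t ≤
        ε * (t ^ (n * p / (n - p)) + a ^ (n * q / (n - q) / q) * t ^ (n * q / (n - q))) +
        C * (t ^ p + a * t ^ q) := by
  obtain ⟨B, hB⟩ := isCompact_Icc.exists_bound_of_continuousOn (s := Set.Icc 0 A)
    Real.continuous_mul_log.continuousOn
  have hB0 : 0 ≤ |B| := abs_nonneg B
  obtain ⟨C₁, hC₁, h1⟩ := exists_rpow_log_le hl hh (ε := ε / 2) (by positivity)
  obtain ⟨C₂, hC₂, h2⟩ := exists_mixed_le hl hh hδ (ε := ε / 2 / (2 * |B| + 1)) (by positivity)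
  refine ⟨C₁ + (2 * |B| + 1) * C₂, by positivity, fun p hp q hq hpq hpqδ a ha t ht => ?_⟩
  have hq1 : 1 < q := hl.trans_le hq.1
  have hq0 : 0 < q := by linarith
  have hβ := one_lt_expP hq1 (hq.2.trans_lt hh)
  have hr := one_lt_expA hq1 (hq.2.trans_lt hh)
  have ha0 := ha.1
  obtain ⟨m, hm⟩ : ∃ m, m = a ^ (expA n q - 1) * t ^ expP n q := ⟨_, rfl⟩
  have hm0 : 0 ≤ m := by rw [hm]; positivity
  have hBa : |a * Real.log a| ≤ |B| := (hB a ha).trans (le_abs_self B)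
  have k1 := h1 p hp t ht
  have k2 := h2 p hp q hq hpq hpqδ a t ha.1 ht
  have k3 := h1 q hq (a ^ (1 / q) * t) (by positivity)
  rw [← rpow_mul_rpow_eq ha.1 ht (n * q / (n - q)), ← mul_rpow_eq hq0 ha.1 ht] at k3
  have k4 : a ^ (expA n q - 1) * |a * Real.log a| * t ^ expP n q ≤ |B| * m := by
    rw [hm]
    calc _ = |a * Real.log a| * (a ^ (expA n q - 1) * t ^ expP n q) := by ring
      _ ≤ _ := by gcongr
  have k5 : a ^ expA n q * (t ^ (expP n q - 1) * |t * Real.log t|) ≤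
      (a ^ (1 / q) * t) ^ (expP n q - 1) * |a ^ (1 / q) * t * Real.log (a ^ (1 / q) * t)| +
        |B| * m := by
    have hpos : 0 ≤ (a ^ (1 / q) * t) ^ (expP n q - 1) *
        |a ^ (1 / q) * t * Real.log (a ^ (1 / q) * t)| + |B| * m := by positivity
    rcases ha.1.eq_or_lt with h0 | ha1
    · have h00 : a ^ expA n q = 0 := by rw [← h0, Real.zero_rpow (by linarith)]
      rw [h00, zero_mul]
      exact hpos
    rcases ht.eq_or_lt with h0 | ht1
    · have h00 : |t * Real.log t| = 0 := by rw [← h0, zero_mul, abs_zero]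
      rw [h00, mul_zero, mul_zero]
      exact hpos
    obtain ⟨z, hz⟩ : ∃ z, z = a ^ (1 / q) * t := ⟨_, rfl⟩
    have hz0 : 0 < z := by rw [hz]; positivity
    have e1 : z ^ (expP n q - 1) * |z * Real.log z| = z ^ expP n q * |Real.log z| := by
      rw [abs_mul, abs_of_pos hz0, ← mul_assoc, ← Real.rpow_add_one hz0.ne', sub_add_cancel]
    have e2 : t ^ (expP n q - 1) * |t * Real.log t| = t ^ expP n q * |Real.log t| := by
      rw [abs_mul, abs_of_pos ht1, ← mul_assoc, ← Real.rpow_add_one ht1.ne', sub_add_cancel]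
    have e3 : a ^ expA n q * t ^ expP n q = z ^ expP n q := by rw [rpow_expA_mul hq0 ha.1 ht, hz]
    have e4 : Real.log t = Real.log z - 1 / q * Real.log a := by
      rw [hz, Real.log_mul (by positivity) (by positivity), Real.log_rpow ha1]; ring
    have e5 : z ^ expP n q * |Real.log a| = |a * Real.log a| * m := by
      have : a ^ expA n q = a ^ (expA n q - 1) * a := by
        rw [← Real.rpow_add_one ha1.ne', sub_add_cancel]
      rw [← e3, hm, this, abs_mul, abs_of_pos ha1]; ring
    have e6 : |Real.log t| ≤ |Real.log z| + |Real.log a| := by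
      rw [e4]
      refine (abs_sub _ _).trans (add_le_add le_rfl ?_)
      rw [abs_mul]
      refine mul_le_of_le_one_left (abs_nonneg _) ?_
      rw [abs_of_pos (by positivity), div_le_one hq0]
      linarith
    rw [← hz, e1, e2, ← mul_assoc, e3]
    have h7 := mul_le_mul_of_nonneg_left e6 (by positivity : 0 ≤ z ^ expP n q)
    rw [mul_add, e5] at h7
    have h8 := mul_le_mul_of_nonneg_right hBa hm0
    linarith
  rw [rootGParam, mul_expA, ← hm]
  rw [← hm] at k2
  have k6 := mul_le_mul_of_nonneg_left k2 (by positivity : 0 ≤ 2 * |B| + 1)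
  have e7 : ∀ G Q : ℝ, (2 * |B| + 1) * (ε / 2 / (2 * |B| + 1) * G + C₂ * Q) =
      ε / 2 * G + (2 * |B| + 1) * C₂ * Q := fun G Q => by field_simp
  rw [e7] at k6
  have e8 : 0 ≤ (2 * |B| + 1) * C₂ * (a * t ^ q) := by positivity
  linarith

theorem min_rootG_le (hl : 1 < l) (hh : h < n) {p q a t M : ℝ} (hp : p ∈ Set.Icc l h)
    (hq : q ∈ Set.Icc l h) (ha : 0 ≤ a) (ht : 0 ≤ t) (hM : 1 ≤ M) :
    min (rootG n p q a t) M ≤ M * (t ^ p + a * t ^ q) := by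
  have hq0 : 0 < q := by linarith [hq.1]
  have key : ∀ {p t : ℝ}, p ∈ Set.Icc l h → 0 ≤ t → min (t ^ expP n p) M ≤ M * t ^ p := by
    intro p t hp ht
    have h0 : 0 < p := by linarith [hp.1]
    rcases le_total t 1 with h1 | h1
    · refine (min_le_left _ _).trans ?_
      have hpe : p ≤ expP n p := by
        have := expP_sub_ge hl hh hp
        have h2 : 0 ≤ (l - 1) / n := div_nonneg (by linarith) (by linarith [hp.1, hp.2])
        linarith
      have := Real.rpow_le_rpow_of_exponent_ge' ht h1 h0.le hpe
      nlinarith [Real.rpow_nonneg ht p]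
    · refine (min_le_right _ _).trans ?_
      have := Real.one_le_rpow h1 h0.le
      nlinarith
  have h1 := key hp ht
  have h2 := key hq (by positivity : 0 ≤ a ^ (1 / q) * t)
  rw [← mul_rpow_eq hq0 ha ht] at h2
  rw [rootG, mul_expA, rpow_expA_mul hq0 ha ht]
  have x0 : 0 ≤ t ^ expP n p := by positivity
  have y0 : 0 ≤ (a ^ (1 / q) * t) ^ expP n q := by positivity
  generalize t ^ expP n p = x at *
  generalize (a ^ (1 / q) * t) ^ expP n q = y at *
  have : min (x + y) M ≤ min x M + min y M := by
    rcases le_total x M with h | h <;> rcases le_total y M with h' | h' <;>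
      simp only [min_eq_left h, min_eq_right h, min_eq_left h', min_eq_right h'] <;>
      first
        | exact min_le_left _ _
        | exact (min_le_right _ _).trans (by linarith)
  linarith

theorem rpow_add_le_rootG_rpow (hl : 1 < l) (hh : h < n) {p q a t : ℝ} (hp : p ∈ Set.Icc l h)
    (hq : q ∈ Set.Icc l h) (ha : 0 ≤ a) (ht : 0 ≤ t) :
    t ^ (n * p / (n - p)) + a ^ (n * q / (n - q) / q) * t ^ (n * q / (n - q)) ≤
      rootG n p q a t ^ (n / (n - 1)) := by
  have hq0 : 0 < q := by linarith [hq.1]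
  have hn1 : 0 < n - 1 := by linarith [hp.1, hp.2]
  have hnp : 0 < n - p := by linarith [hp.2]
  have hnq : 0 < n - q := by linarith [hq.2]
  rw [rootG, mul_expA, rpow_expA_mul hq0 ha ht, rpow_mul_rpow_eq ha ht]
  have e : ∀ {p : ℝ}, 0 < n - p → n * p / (n - p) = expP n p * (n / (n - 1)) := fun h => by
    rw [expP]; field_simp
  rw [e hnp, e hnq, Real.rpow_mul ht, Real.rpow_mul (by positivity)]
  exact Real.add_rpow_le_rpow_add (by positivity) (by positivity)
    (by rw [le_div_iff₀ hn1]; linarith)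

end Estimates

theorem exists_min_le {s : ℝ} (hs : 1 < s) {ε : ℝ} (hε : 0 < ε) :
    ∃ R : ℝ, 1 ≤ R ∧ ∀ v M : ℝ, 0 ≤ v → 0 ≤ M → min v M ≤ ε * min v M ^ s + min v R := by
  have hm : 0 < min 1 ε := by positivity
  have h1 : 0 < s - 1 := by linarith
  refine ⟨((min 1 ε) ^ (1 / (s - 1)))⁻¹, ?_, fun v M hv hM => ?_⟩
  · exact (one_le_inv₀ (by positivity)).2
      (Real.rpow_le_one hm.le (min_le_left _ _) (by positivity))
  obtain ⟨R, hR⟩ : ∃ R, R = ((min 1 ε) ^ (1 / (s - 1)))⁻¹ := ⟨_, rfl⟩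
  have hR0 : 0 < R := by rw [hR]; positivity
  rw [← hR]
  have hw : 0 ≤ min v M := le_min hv hM
  rcases le_total (min v M) R with h | h
  · have : min v M ≤ min v R := le_min (min_le_left _ _) h
    have : 0 ≤ ε * min v M ^ s := by positivity
    linarith
  · have hw0 : 0 < min v M := hR0.trans_le h
    have h2 : 1 ≤ ε * min v M ^ (s - 1) := by
      have h3 : R ^ (s - 1) ≤ min v M ^ (s - 1) := by gcongr
      have h4 : R ^ (s - 1) = (min 1 ε)⁻¹ := by
        rw [hR, Real.inv_rpow (by positivity), ← Real.rpow_mul hm.le, one_div,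
          inv_mul_cancel₀ h1.ne', Real.rpow_one]
      rw [h4] at h3
      have h5 : ε⁻¹ ≤ (min 1 ε)⁻¹ := inv_anti₀ hm (min_le_right _ _)
      have := mul_le_mul_of_nonneg_left (h5.trans h3) hε.le
      rwa [mul_inv_cancel₀ hε.ne'] at this
    have e : min v M ^ s = min v M ^ (s - 1) * min v M := by
      rw [← Real.rpow_add_one hw0.ne', sub_add_cancel]
    have : 0 ≤ min v R := le_min hv hR0.le
    rw [e]
    nlinarith

theorem exists_pointwise_absorption {n l h : ℝ} (hl : 1 < l) (hh : h < n) (A C₀ : ℝ)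
    (hC₀ : 0 ≤ C₀) {δ ε : ℝ} (hδ : 0 < δ) (hε : 0 < ε) :
    ∃ C : ℝ, 0 ≤ C ∧ ∀ p ∈ Set.Icc l h, ∀ q ∈ Set.Icc l h, p ≤ q → δ ≤ p * ((n + 1) / n) - q →
      ∀ a ∈ Set.Icc 0 A, ∀ t s M : ℝ, 0 ≤ t → 0 ≤ s → 0 ≤ M →
      (if rootG n p q a t < M then rootGDeriv n p q a t * s + C₀ * rootGParam n p q a t else 0) +
        min (rootG n p q a t) M ≤
        ε * min (rootG n p q a t) M ^ (n / (n - 1)) +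
          C * ((s ^ p + a * s ^ q) + (t ^ p + a * t ^ q)) := by
  rcases lt_or_ge h l with hlh | hlh
  · exact ⟨0, le_rfl, fun p hp => absurd (hp.1.trans hp.2) (not_le.2 hlh)⟩
  obtain ⟨C₁, hC₁, h1⟩ := exists_rootGDeriv_mul_le hl hh (ε := ε / 3) (by positivity)
  obtain ⟨C₂, hC₂, h2⟩ := exists_rootGParam_le hl hh A hδ (ε := ε / 3 / (C₀ + 1)) (by positivity)
  obtain ⟨R, hR, h3⟩ := exists_min_le (s := n / (n - 1))
    (by rw [lt_div_iff₀ (by linarith)]; linarith) (ε := ε / 3) (by positivity)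
  refine ⟨C₁ + C₀ * C₂ + R, by positivity, fun p hp q hq hpq hpqδ a ha t s M ht hs hM => ?_⟩
  have hv0 : 0 ≤ rootG n p q a t := add_nonneg (Real.rpow_nonneg ht _)
    (mul_nonneg (Real.rpow_nonneg ha.1 _) (Real.rpow_nonneg ht _))
  have ha0 := ha.1
  have b1 := h1 p hp q hq a t s ha.1 ht hs
  have b2 := mul_le_mul_of_nonneg_left (h2 p hp q hq hpq hpqδ a ha t ht) hC₀
  have b3 := h3 _ M hv0 hM
  have b4 := min_rootG_le hl hh hp hq ha.1 ht hR
  have b5 := rpow_add_le_rootG_rpow hl hh hp hq ha.1 ht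
  have hHs : 0 ≤ s ^ p + a * s ^ q := by positivity
  have hHt : 0 ≤ t ^ p + a * t ^ q := by positivity
  have hG0 : 0 ≤ t ^ (n * p / (n - p)) + a ^ (n * q / (n - q) / q) * t ^ (n * q / (n - q)) := by
    positivity
  generalize t ^ (n * p / (n - p)) + a ^ (n * q / (n - q) / q) * t ^ (n * q / (n - q)) = Gs at *
  generalize s ^ p + a * s ^ q = Hs at *
  generalize t ^ p + a * t ^ q = Ht at *
  have b6 : C₀ * (ε / 3 / (C₀ + 1) * Gs + C₂ * Ht) ≤ ε / 3 * Gs + C₀ * C₂ * Ht := by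
    have e : C₀ * (ε / 3 / (C₀ + 1)) ≤ ε / 3 := by
      rw [mul_div_assoc', div_le_iff₀ (by positivity)]
      nlinarith
    have := mul_le_mul_of_nonneg_right e hG0
    nlinarith
  have c1 : 0 ≤ C₁ * Ht := by positivity
  have c2 : 0 ≤ C₀ * C₂ * Hs := by positivity
  have c3 : 0 ≤ R * Hs := by positivity
  have c4 : 0 ≤ C₁ * Hs := by positivity
  have c5 : 0 ≤ C₀ * C₂ * Ht := by positivity
  split_ifs with hlt
  · rw [min_eq_left hlt.le] at b3 ⊢
    have := mul_le_mul_of_nonneg_left b5 (by positivity : 0 ≤ ε / 3)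
    nlinarith
  · have : 0 ≤ min (rootG n p q a t) M ^ (n / (n - 1)) := Real.rpow_nonneg (le_min hv0 hM) _
    nlinarith

/-- The truncated critical modular `∫ min(v, M) ^ (N / (N - 1))`. -/
noncomputable def truncModular {N : ℕ} (Ω : Set (EuclideanSpace ℝ (Fin N)))
    (p q a : EuclideanSpace ℝ (Fin N) → ℝ) (M : ℝ) (u : EuclideanSpace ℝ (Fin N) → ℝ) : ℝ≥0∞ :=
  ∫⁻ x in Ω, ENNReal.ofReal (min (rootG N (p x) (q x) (a x) |u x|) M) ^ ((N : ℝ) / (N - 1))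

theorem rootG_nonneg {n p q a t : ℝ} (ha : 0 ≤ a) (ht : 0 ≤ t) : 0 ≤ rootG n p q a t :=
  add_nonneg (Real.rpow_nonneg ht _) (mul_nonneg (Real.rpow_nonneg ha _) (Real.rpow_nonneg ht _))

section Core

variable {N : ℕ} {Ω : Set (EuclideanSpace ℝ (Fin N))} {l h A δ : ℝ} {L : NNReal}
  {p q a : EuclideanSpace ℝ (Fin N) → ℝ}

theorem GoodData.aemeasurable_comp (hd : GoodData l h A L p q a)
    {u : EuclideanSpace ℝ (Fin N) → ℝ} (hu : AEMeasurable u (volume.restrict Ω))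
    {k : ℝ × ℝ × ℝ × ℝ → ℝ} (hk : ContinuousOn k (paramSet l h)) :
    AEMeasurable (fun x => k (p x, q x, a x, |u x|)) (volume.restrict Ω) := by
  have hS : MeasurableSet (paramSet l h) :=
    measurableSet_Icc.prod (measurableSet_Icc.prod (measurableSet_Ici.prod measurableSet_Ici))
  have hX : AEMeasurable (fun x => (p x, q x, a x, |u x|)) (volume.restrict Ω) := by
    have h1 := hd.p_lip.continuous.measurable
    have h2 := hd.q_lip.continuous.measurable
    have h3 := hd.a_lip.continuous.measurable
    fun_prop
  have hk' : Measurable ((paramSet l h).indicator k) := by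
    classical
    rw [← Set.piecewise_eq_indicator]
    exact hk.measurable_piecewise continuousOn_const hS
  refine (hk'.comp_aemeasurable hX).congr (Filter.Eventually.of_forall fun x => ?_)
  exact Set.indicator_of_mem (hd.mem_paramSet x (abs_nonneg _)) k

theorem GoodData.truncModular_absorption (hd : GoodData l h A L p q a) (hN : 2 ≤ N)
    (hΩ : IsOpen Ω) (hcone : ConeProperty Ω) (hδ : 0 < δ)
    (hpq : ∀ x ∈ Ω, p x ≤ q x) (hpqδ : ∀ x ∈ Ω, δ ≤ p x * ((N + 1 : ℝ) / N) - q x)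
    {ε : ℝ} (hε : 0 < ε) : ∃ C : ℝ, 0 ≤ C ∧ ∀ (u : EuclideanSpace ℝ (Fin N) → ℝ)
      (g : EuclideanSpace ℝ (Fin N) → EuclideanSpace ℝ (Fin N)), IsWeakGradient Ω u g →
      ∀ M : ℝ, 0 < M → truncModular Ω p q a M u ≤
        (ENNReal.ofReal ε * truncModular Ω p q a M u + ENNReal.ofReal C *
          (modular Ω (fnH p q a) (fun x => ‖g x‖) + modular Ω (fnH p q a) u)) ^
            ((N : ℝ) / (N - 1)) := by
  obtain ⟨C₀, hC₀, happ⟩ := hd.exists_hasC1Approx hΩ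
  obtain ⟨B, hB, hBb⟩ := exists_deriv_cutoff_bound
  obtain ⟨C₁, hC₁, hweak⟩ := exists_measure_superlevel_le hN hΩ hcone
  obtain ⟨d, hd0, hdD⟩ : ∃ d : ℝ, 0 ≤ d ∧ 4 * (C₁ * (ENNReal.ofReal B + 2)) = ENNReal.ofReal d :=
    ⟨_, ENNReal.toReal_nonneg, (ENNReal.ofReal_toReal (ENNReal.mul_ne_top (by simp)
      (ENNReal.mul_ne_top hC₁ (by simp)))).symm⟩
  obtain ⟨C, hC, hpt⟩ := exists_pointwise_absorption hd.one_lt hd.lt_dim A C₀ hC₀ hδ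
    (ε := ε / (d + 1)) (by positivity)
  refine ⟨d * C, by positivity, fun u g hg M hM => ?_⟩
  have hΩm := hΩ.measurableSet
  have hu : AEMeasurable u (volume.restrict Ω) := hg.1.aestronglyMeasurable.aemeasurable
  have hgm : AEMeasurable g (volume.restrict Ω) := hg.2.1.aestronglyMeasurable.aemeasurable
  set v : EuclideanSpace ℝ (Fin N) → ℝ := fun x => rootG N (p x) (q x) (a x) |u x| with hv
  set G₀ : EuclideanSpace ℝ (Fin N) → ℝ := fun x => rootGDeriv N (p x) (q x) (a x) |u x| * ‖g x‖ +
    C₀ * rootGParam N (p x) (q x) (a x) |u x| with hG₀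
  set G : EuclideanSpace ℝ (Fin N) → ℝ≥0∞ := fun x => ENNReal.ofReal (G₀ x) with hG
  have hv0 : ∀ x, 0 ≤ v x := fun x => rootG_nonneg (hd.a_mem x).1 (abs_nonneg _)
  have hvm : AEMeasurable v (volume.restrict Ω) :=
    hd.aemeasurable_comp hu (continuousOn_rootG hd.one_lt hd.lt_dim)
  have hGm : AEMeasurable G (volume.restrict Ω) :=
    (((hd.aemeasurable_comp hu (continuousOn_rootGDeriv hd.one_lt hd.lt_dim)).mul hgm.norm).add
      ((hd.aemeasurable_comp hu (continuousOn_rootGParam hd.one_lt hd.lt_dim)).const_mul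
        C₀)).ennreal_ofReal
  have hG₀0 : ∀ x, 0 ≤ G₀ x := fun x => by
    have h1 := rootGDeriv_nonneg (hd.one_lt.trans_le (hd.p_mem x).1)
      ((hd.p_mem x).2.trans_lt hd.lt_dim) (hd.one_lt.trans_le (hd.q_mem x).1)
      ((hd.q_mem x).2.trans_lt hd.lt_dim) (hd.a_mem x).1 (abs_nonneg (u x))
    have h2 := rootGParam_nonneg (n := N) (p := p x) (q := q x) (hd.a_mem x).1 (abs_nonneg (u x))
    positivity
  have hmain := lintegral_min_rpow_le hN hΩm (C := C₁) (B := ENNReal.ofReal B) hvm hv0 hGm (by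
    intro lam hlam
    have h1 := hweak _ _ (happ u g hg lam hlam) (ENNReal.ofReal lam) ({x | 2 * lam ≤ v x} ∩ Ω)
      (by simpa using hlam) ENNReal.ofReal_ne_top Set.inter_subset_right (by
        rintro x ⟨hx, -⟩
        have : cutoff (v x / lam) = 1 := cutoff_of_ge ((le_div_iff₀ hlam).2 hx)
        show _ ≤ ‖lam * cutoff (v x / lam)‖ₑ
        rw [this, mul_one, Real.enorm_eq_ofReal hlam.le])
    refine h1.trans ?_
    have hs0 : 0 ≤ (N : ℝ) / (N - 1) := by
      have : (2 : ℝ) ≤ N := by exact_mod_cast hN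
      exact div_nonneg (by linarith) (by linarith)
    gcongr with x
    · by_cases hx : lam < v x ∧ v x < 2 * lam
      · rw [Set.indicator_of_mem (by exact hx), hG, ← ENNReal.ofReal_mul hB.le]
        refine ENNReal.ofReal_le_ofReal ?_
        exact mul_le_mul_of_nonneg_right (hBb _) (hG₀0 x)
      · have hz : deriv cutoff (v x / lam) = 0 := by
          rw [not_and_or, not_lt, not_lt] at hx
          rcases hx with hx | hx
          · exact deriv_cutoff_of_le ((div_le_one hlam).2 hx)
          · exact deriv_cutoff_of_ge ((le_div_iff₀ hlam).2 hx)
        show ENNReal.ofReal (|deriv cutoff (v x / lam)| * _) ≤ _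
        rw [hz, abs_zero, zero_mul, ENNReal.ofReal_zero]
        exact zero_le
    · rw [Real.enorm_eq_ofReal (mul_nonneg hlam.le (cutoff_nonneg _))]) hM
  refine hmain.trans (ENNReal.rpow_le_rpow ?_ ?_)
  swap
  · have : (2 : ℝ) ≤ N := by exact_mod_cast hN
    exact div_nonneg (by linarith) (by linarith)
  set I := ∫⁻ x in Ω, {x | v x < M}.indicator G x with hI
  set J := ∫⁻ x in Ω, ENNReal.ofReal (min (v x) M) with hJ
  have hminm : AEMeasurable (fun x => ENNReal.ofReal (min (v x) M)) (volume.restrict Ω) :=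
    (hvm.min aemeasurable_const).ennreal_ofReal
  have hHm : ∀ {w : EuclideanSpace ℝ (Fin N) → ℝ}, AEMeasurable w (volume.restrict Ω) →
      AEMeasurable (fun x => ENNReal.ofReal (fnH p q a x |w x|)) (volume.restrict Ω) := by
    intro w hw
    have h1 := hd.p_lip.continuous.measurable
    have h2 := hd.q_lip.continuous.measurable
    have h3 := hd.a_lip.continuous.measurable
    unfold fnH
    fun_prop
  have hIJ : I + J ≤ ENNReal.ofReal (ε / (d + 1)) * truncModular Ω p q a M u + ENNReal.ofReal C *
      (modular Ω (fnH p q a) (fun x => ‖g x‖) + modular Ω (fnH p q a) u) := by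
    have hHH : AEMeasurable (fun x => ENNReal.ofReal (fnH p q a x |‖g x‖|) +
        ENNReal.ofReal (fnH p q a x |u x|)) (volume.restrict Ω) := (hHm hgm.norm).add (hHm hu)
    rw [hI, hJ, ← lintegral_add_right' _ hminm, modular, modular, truncModular,
      ← lintegral_add_right' _ (hHm hu), ← lintegral_const_mul'' _ hHH,
      ← lintegral_const_mul'' _ (hminm.pow_const _), ← lintegral_add_left'
        ((hminm.pow_const _).const_mul _)]
    refine setLIntegral_mono' hΩm fun x hx => ?_
    have hpx := hpt (p x) (hd.p_mem x) (q x) (hd.q_mem x) (hpq x hx) (hpqδ x hx) (a x) (hd.a_mem x)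
      |u x| ‖g x‖ M (abs_nonneg _) (norm_nonneg _) hM.le
    have hm0 : 0 ≤ min (v x) M := le_min (hv0 x) hM.le
    have hH0 : ∀ t : ℝ, 0 ≤ t → 0 ≤ fnH p q a x t := fun t ht =>
      add_nonneg (Real.rpow_nonneg ht _) (mul_nonneg (hd.a_mem x).1 (Real.rpow_nonneg ht _))
    have hN1 : 0 ≤ (N : ℝ) / (N - 1) := by
      have : (2 : ℝ) ≤ N := by exact_mod_cast hN
      exact div_nonneg (by linarith) (by linarith)
    have e1 : {x | v x < M}.indicator G x = ENNReal.ofReal (if v x < M then G₀ x else 0) := by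
      by_cases hx : v x < M
      · rw [Set.indicator_of_mem (by exact hx), if_pos hx]
      · rw [Set.indicator_of_notMem (by exact hx), if_neg hx, ENNReal.ofReal_zero]
    have hi0 : 0 ≤ if v x < M then G₀ x else 0 := by
      split_ifs
      · exact hG₀0 x
      · exact le_rfl
    rw [e1, ← ENNReal.ofReal_add hi0 hm0, abs_norm,
      ENNReal.ofReal_rpow_of_nonneg hm0 hN1,
      ← ENNReal.ofReal_add (hH0 _ (norm_nonneg _)) (hH0 _ (abs_nonneg _)),
      ← ENNReal.ofReal_mul (by positivity), ← ENNReal.ofReal_mul hC, ← ENNReal.ofReal_add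
        (mul_nonneg (by positivity) (Real.rpow_nonneg hm0 _))
        (mul_nonneg hC (add_nonneg (hH0 _ (norm_nonneg _)) (hH0 _ (abs_nonneg _))))]
    exact ENNReal.ofReal_le_ofReal hpx
  calc 4 * (C₁ * (ENNReal.ofReal B * I + 2 * J))
      ≤ 4 * (C₁ * ((ENNReal.ofReal B + 2) * (I + J))) := by
        gcongr
        rw [add_mul]
        gcongr
        · exact le_self_add
        · exact le_add_self
    _ = ENNReal.ofReal d * (I + J) := by rw [← hdD]; ring
    _ ≤ ENNReal.ofReal d * (ENNReal.ofReal (ε / (d + 1)) * truncModular Ω p q a M u +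
          ENNReal.ofReal C *
          (modular Ω (fnH p q a) (fun x => ‖g x‖) + modular Ω (fnH p q a) u)) := by gcongr
    _ ≤ _ := by
        rw [mul_add, ← mul_assoc, ← mul_assoc, ← ENNReal.ofReal_mul hd0, ← ENNReal.ofReal_mul hd0]
        gcongr
        rw [mul_div_assoc', div_le_iff₀ (by positivity)]
        nlinarith

end Core

theorem IsWeakGradient.const_mul {N : ℕ} {Ω : Set (EuclideanSpace ℝ (Fin N))}
    {u : EuclideanSpace ℝ (Fin N) → ℝ}
    {g : EuclideanSpace ℝ (Fin N) → EuclideanSpace ℝ (Fin N)} (hg : IsWeakGradient Ω u g)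
    (c : ℝ) : IsWeakGradient Ω (fun x => c * u x) (fun x => c • g x) := by
  refine ⟨fun x hx => ?_, fun x hx => ?_, fun φ hφ hφc hφs i => ?_⟩
  · obtain ⟨s, hs, h⟩ := hg.1 x hx
    exact ⟨s, hs, Integrable.const_mul h c⟩
  · obtain ⟨s, hs, h⟩ := hg.2.1 x hx
    exact ⟨s, hs, Integrable.smul c h⟩
  have h := hg.2.2 φ hφ hφc hφs i
  simp only [PiLp.smul_apply, smul_eq_mul, mul_assoc]
  rw [integral_const_mul, integral_const_mul, h, mul_neg]

theorem fnH_mul_le {N : ℕ} {p q a : EuclideanSpace ℝ (Fin N) → ℝ} {x : EuclideanSpace ℝ (Fin N)}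
    (hp : 1 ≤ p x) (hq : 1 ≤ q x) (ha : 0 ≤ a x) {c t : ℝ} (hc : 0 ≤ c) (hc1 : c ≤ 1)
    (ht : 0 ≤ t) : fnH p q a x (c * t) ≤ c * fnH p q a x t := by
  have key : ∀ s : ℝ, 1 ≤ s → (c * t) ^ s ≤ c * t ^ s := fun s hs => by
    rw [Real.mul_rpow hc ht]
    gcongr
    nth_rewrite 2 [← Real.rpow_one c]
    exact Real.rpow_le_rpow_of_exponent_ge' hc hc1 zero_le_one hs
  have h1 := key _ hp
  have h2 := mul_le_mul_of_nonneg_left (key _ hq) ha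
  unfold fnH
  linarith

theorem modular_fnH_mul_le {N : ℕ} {Ω : Set (EuclideanSpace ℝ (Fin N))} (hΩ : MeasurableSet Ω)
    {p q a : EuclideanSpace ℝ (Fin N) → ℝ} (hp : ∀ x ∈ Ω, 1 ≤ p x) (hq : ∀ x ∈ Ω, 1 ≤ q x)
    (ha : ∀ x ∈ Ω, 0 ≤ a x) {c : ℝ} (hc : 0 ≤ c) (hc1 : c ≤ 1)
    (u : EuclideanSpace ℝ (Fin N) → ℝ) :
    modular Ω (fnH p q a) (fun x => c * u x) ≤ ENNReal.ofReal c * modular Ω (fnH p q a) u := by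
  rw [modular, modular, ← lintegral_const_mul' _ _ ENNReal.ofReal_ne_top]
  refine setLIntegral_mono' hΩ fun x hx => ?_
  rw [← ENNReal.ofReal_mul hc]
  refine ENNReal.ofReal_le_ofReal ?_
  rw [abs_mul, abs_of_nonneg hc]
  exact fnH_mul_le (hp x hx) (hq x hx) (ha x hx) hc hc1 (abs_nonneg _)

/-- The modular of the Sobolev space scales at least linearly under contractions. -/
theorem modular_add_modular_mul_le {N : ℕ} {Ω : Set (EuclideanSpace ℝ (Fin N))}
    (hΩ : MeasurableSet Ω) {p q a : EuclideanSpace ℝ (Fin N) → ℝ} (hp : ∀ x ∈ Ω, 1 ≤ p x)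
    (hq : ∀ x ∈ Ω, 1 ≤ q x) (ha : ∀ x ∈ Ω, 0 ≤ a x) {c : ℝ} (hc : 0 ≤ c) (hc1 : c ≤ 1)
    (u : EuclideanSpace ℝ (Fin N) → ℝ)
    (g : EuclideanSpace ℝ (Fin N) → EuclideanSpace ℝ (Fin N)) :
    modular Ω (fnH p q a) (fun x => ‖c • g x‖) + modular Ω (fnH p q a) (fun x => c * u x) ≤
      ENNReal.ofReal c *
        (modular Ω (fnH p q a) (fun x => ‖g x‖) + modular Ω (fnH p q a) u) := by
  rw [mul_add]
  simp only [norm_smul, Real.norm_eq_abs, abs_of_nonneg hc]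
  gcongr
  · exact modular_fnH_mul_le hΩ hp hq ha hc hc1 _
  · exact modular_fnH_mul_le hΩ hp hq ha hc hc1 _

section Core

variable {N : ℕ} {Ω : Set (EuclideanSpace ℝ (Fin N))} {l h A δ : ℝ} {L : NNReal}
  {p q a : EuclideanSpace ℝ (Fin N) → ℝ}

theorem GoodData.truncModular_le (hd : GoodData l h A L p q a) (hN : 2 ≤ N)
    (hΩ : MeasurableSet Ω) {M : ℝ} (hM : 1 ≤ M) (u : EuclideanSpace ℝ (Fin N) → ℝ) :
    truncModular Ω p q a M u ≤
      ENNReal.ofReal (M ^ ((N : ℝ) / (N - 1))) * modular Ω (fnH p q a) u := by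
  have hN' : (2 : ℝ) ≤ N := by exact_mod_cast hN
  have hs1 : 1 ≤ (N : ℝ) / (N - 1) := by rw [le_div_iff₀ (by linarith)]; linarith
  rw [modular, truncModular, ← lintegral_const_mul' _ _ ENNReal.ofReal_ne_top]
  refine setLIntegral_mono' hΩ fun x _ => ?_
  have hw0 : 0 ≤ min (rootG N (p x) (q x) (a x) |u x|) M :=
    le_min (rootG_nonneg (hd.a_mem x).1 (abs_nonneg _)) (by linarith)
  rw [ENNReal.ofReal_rpow_of_nonneg hw0 (by linarith), ← ENNReal.ofReal_mul (by positivity)]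
  refine ENNReal.ofReal_le_ofReal ?_
  have h1 := min_rootG_le hd.one_lt hd.lt_dim (hd.p_mem x) (hd.q_mem x) (hd.a_mem x).1
    (abs_nonneg (u x)) hM
  have hwM : min (rootG N (p x) (q x) (a x) |u x|) M ≤ M := min_le_right _ _
  generalize min (rootG N (p x) (q x) (a x) |u x|) M = w at *
  have e : ∀ z : ℝ, 0 ≤ z → z ^ ((N : ℝ) / (N - 1)) = z ^ ((N : ℝ) / (N - 1) - 1) * z := by
    intro z hz
    nth_rewrite 3 [← Real.rpow_one z]
    rw [← Real.rpow_add_of_nonneg hz (by linarith) zero_le_one, sub_add_cancel]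
  rw [e w hw0, e M (by linarith), mul_assoc]
  have h2 : w ^ ((N : ℝ) / (N - 1) - 1) ≤ M ^ ((N : ℝ) / (N - 1) - 1) :=
    Real.rpow_le_rpow hw0 hwM (by linarith)
  exact mul_le_mul h2 h1 hw0 (by positivity)

theorem GoodData.exists_truncModular_half_ge (hd : GoodData l h A L p q a) (hN : 2 ≤ N) :
    ∃ θ : ℝ, 0 < θ ∧ ∀ (M : ℝ), 0 ≤ M → ∀ u : EuclideanSpace ℝ (Fin N) → ℝ,
      ENNReal.ofReal θ * truncModular Ω p q a M u ≤
        truncModular Ω p q a M (fun x => 1 / 2 * u x) := by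
  have hN' : (2 : ℝ) ≤ N := by exact_mod_cast hN
  have hs0 : 0 ≤ (N : ℝ) / (N - 1) := div_nonneg (by linarith) (by linarith)
  obtain ⟨D, hD, hDb⟩ := exists_exp_bound (l := l) hd.lt_dim
  obtain ⟨c, hc⟩ : ∃ c : ℝ, c = (1 / 2) ^ D := ⟨_, rfl⟩
  have hc0 : 0 < c := by rw [hc]; positivity
  have hc1 : c ≤ 1 := by rw [hc]; exact Real.rpow_le_one (by norm_num) (by norm_num) hD
  refine ⟨c ^ ((N : ℝ) / (N - 1)), by positivity, fun M hM u => ?_⟩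
  rw [truncModular, truncModular, ← lintegral_const_mul' _ _ ENNReal.ofReal_ne_top]
  refine lintegral_mono fun x => ?_
  have hv0 := rootG_nonneg (n := N) (p := p x) (q := q x) (hd.a_mem x).1 (abs_nonneg (u x))
  rw [← ENNReal.ofReal_rpow_of_pos hc0, ← ENNReal.mul_rpow_of_nonneg _ _ hs0,
    ← ENNReal.ofReal_mul hc0.le]
  refine ENNReal.rpow_le_rpow (ENNReal.ofReal_le_ofReal ?_) hs0
  have key : ∀ s ≤ D, ∀ t : ℝ, 0 ≤ t → c * t ^ s ≤ (1 / 2 * t) ^ s := fun s hs t ht => by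
    rw [Real.mul_rpow (by norm_num) ht, hc]
    gcongr ?_ * _
    exact Real.rpow_le_rpow_of_exponent_ge (by norm_num) (by norm_num) hs
  have hle : c * rootG N (p x) (q x) (a x) |u x| ≤ rootG N (p x) (q x) (a x) |1 / 2 * u x| := by
    rw [abs_mul, abs_of_pos (by norm_num : (0 : ℝ) < 1 / 2)]
    have h1 := key _ (hDb _ (hd.p_mem x)).2.2.2 |u x| (abs_nonneg _)
    have h2 := mul_le_mul_of_nonneg_left (key _ (hDb _ (hd.q_mem x)).2.2.2 |u x| (abs_nonneg _))
      (Real.rpow_nonneg (hd.a_mem x).1 (expA N (q x)))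
    rw [rootG, rootG, mul_expA]
    linarith
  refine le_min ((mul_le_mul_of_nonneg_left (min_le_left _ _) hc0.le).trans hle) ?_
  calc c * min (rootG N (p x) (q x) (a x) |u x|) M ≤ c * M := by
        gcongr
        exact min_le_right _ _
    _ ≤ M := mul_le_of_le_one_left hM hc1

theorem GoodData.exists_truncModular_le_one (hd : GoodData l h A L p q a) (hN : 2 ≤ N)
    (hΩ : IsOpen Ω) (hcone : ConeProperty Ω) (hδ : 0 < δ)
    (hpq : ∀ x ∈ Ω, p x ≤ q x) (hpqδ : ∀ x ∈ Ω, δ ≤ p x * ((N + 1 : ℝ) / N) - q x) :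
    ∃ c : ℝ, 0 < c ∧ c ≤ 1 ∧ ∀ (u : EuclideanSpace ℝ (Fin N) → ℝ)
      (g : EuclideanSpace ℝ (Fin N) → EuclideanSpace ℝ (Fin N)), IsWeakGradient Ω u g →
      modular Ω (fnH p q a) (fun x => ‖g x‖) + modular Ω (fnH p q a) u ≤ ENNReal.ofReal c →
      ∀ M : ℝ, 1 ≤ M → truncModular Ω p q a M u ≤ 1 := by
  have hN' : (2 : ℝ) ≤ N := by exact_mod_cast hN
  have hs0 : 0 < (N : ℝ) / (N - 1) := div_pos (by linarith) (by linarith)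
  obtain ⟨θ, hθ, hhalf⟩ := hd.exists_truncModular_half_ge (Ω := Ω) hN
  obtain ⟨ε, hε, hεθ⟩ : ∃ ε : ℝ, 0 < ε ∧ (ε + ε) ^ ((N : ℝ) / (N - 1)) < θ := by
    refine ⟨θ ^ (((N : ℝ) / (N - 1))⁻¹) / 4, by positivity, ?_⟩
    have e : θ = (θ ^ (((N : ℝ) / (N - 1))⁻¹)) ^ ((N : ℝ) / (N - 1)) := by
      rw [← Real.rpow_mul hθ.le, inv_mul_cancel₀ hs0.ne', Real.rpow_one]
    have hpos : 0 < θ ^ (((N : ℝ) / (N - 1))⁻¹) := by positivity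
    conv_rhs => rw [e]
    refine Real.rpow_lt_rpow (by positivity) ?_ hs0
    linarith
  obtain ⟨C, hC, habs⟩ := hd.truncModular_absorption hN hΩ hcone hδ hpq hpqδ hε
  refine ⟨min 1 (ε / (C + 1)), by positivity, min_le_left _ _, fun u g hg hX M hM => ?_⟩
  set X := modular Ω (fnH p q a) (fun x => ‖g x‖) + modular Ω (fnH p q a) u with hXdef
  have hp1 : ∀ x ∈ Ω, 1 ≤ p x := fun x _ => (hd.one_lt.trans_le (hd.p_mem x).1).le
  have hq1 : ∀ x ∈ Ω, 1 ≤ q x := fun x _ => (hd.one_lt.trans_le (hd.q_mem x).1).le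
  have ha0 : ∀ x ∈ Ω, 0 ≤ a x := fun x _ => (hd.a_mem x).1
  set w : ℕ → EuclideanSpace ℝ (Fin N) → ℝ := fun n x => (1 / 2) ^ n * u x with hw
  have hwg : ∀ n, IsWeakGradient Ω (w n) (fun x => ((1 / 2 : ℝ) ^ n) • g x) := fun n =>
    hg.const_mul _
  have hXt : X ≠ ⊤ := (hX.trans_lt ENNReal.ofReal_lt_top).ne
  have hXn : ∀ n, modular Ω (fnH p q a) (fun x => ‖((1 / 2 : ℝ) ^ n) • g x‖) +
      modular Ω (fnH p q a) (w n) ≤ ENNReal.ofReal ((1 / 2) ^ n) * X := fun n =>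
    modular_add_modular_mul_le hΩ.measurableSet hp1 hq1 ha0 (by positivity)
      (pow_le_one₀ (by norm_num) (by norm_num)) u g
  have hgap : ∀ n, truncModular Ω p q a M (w n) ≤ 1 →
      truncModular Ω p q a M (w n) < ENNReal.ofReal θ := by
    intro n hn
    refine lt_of_le_of_lt ((habs _ _ (hwg n) M (by linarith)).trans
      (ENNReal.rpow_le_rpow (?_ : _ ≤ ENNReal.ofReal (ε + ε)) hs0.le)) ?_
    · rw [ENNReal.ofReal_add hε.le hε.le]
      gcongr
      · exact mul_le_of_le_one_right zero_le hn
      · calc ENNReal.ofReal C * _ ≤ ENNReal.ofReal C * ENNReal.ofReal (min 1 (ε / (C + 1))) := by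
              gcongr
              refine (hXn n).trans (le_trans ?_ hX)
              refine mul_le_of_le_one_left zero_le ?_
              rw [ENNReal.ofReal_le_one]
              exact pow_le_one₀ (by norm_num) (by norm_num)
          _ ≤ ENNReal.ofReal ε := by
              rw [← ENNReal.ofReal_mul hC]
              refine ENNReal.ofReal_le_ofReal ?_
              calc C * min 1 (ε / (C + 1)) ≤ C * (ε / (C + 1)) := by
                    gcongr
                    exact min_le_right _ _
                _ ≤ ε := by
                    rw [mul_div_assoc', div_le_iff₀ (by positivity)]
                    nlinarith
    · rw [ENNReal.ofReal_rpow_of_pos (by positivity)]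
      exact (ENNReal.ofReal_lt_ofReal_iff hθ).2 hεθ
  have hex : ∃ n, truncModular Ω p q a M (w n) ≤ 1 := by
    have hlim : Filter.Tendsto (fun n : ℕ => ENNReal.ofReal (M ^ ((N : ℝ) / (N - 1))) *
        (ENNReal.ofReal ((1 / 2) ^ n) * X)) Filter.atTop (nhds 0) := by
      have h1 : Filter.Tendsto (fun n : ℕ => ENNReal.ofReal ((1 / 2 : ℝ) ^ n)) Filter.atTop
          (nhds 0) := by
        have := (ENNReal.continuous_ofReal.tendsto 0).comp
          (tendsto_pow_atTop_nhds_zero_of_lt_one (by norm_num : (0 : ℝ) ≤ 1 / 2) (by norm_num))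
        rwa [ENNReal.ofReal_zero] at this
      have h2 := ENNReal.Tendsto.const_mul (a := ENNReal.ofReal (M ^ ((N : ℝ) / (N - 1))))
        (ENNReal.Tendsto.mul_const h1 (Or.inr hXt)) (Or.inr ENNReal.ofReal_ne_top)
      rwa [zero_mul, mul_zero] at h2
    obtain ⟨n, hn⟩ := ((ENNReal.tendsto_nhds_zero.1 hlim) 1 one_pos).exists
    refine ⟨n, le_trans ?_ hn⟩
    refine (hd.truncModular_le hN hΩ.measurableSet hM (w n)).trans ?_
    gcongr
    exact le_add_self.trans (hXn n)
  classical
  have hw0 : w 0 = u := by ext x; simp [hw]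
  rcases Nat.eq_zero_or_pos (Nat.find hex) with h0 | hpos
  · have := Nat.find_spec hex
    rwa [h0, hw0] at this
  · exfalso
    have h1 := hgap _ (Nat.find_spec hex)
    have h2 := Nat.find_min hex (Nat.sub_lt hpos one_pos)
    rw [not_le] at h2
    have e1 : Nat.find hex - 1 + 1 = Nat.find hex := Nat.succ_pred_eq_of_pos hpos
    have e2 : w (Nat.find hex) = fun x => 1 / 2 * w (Nat.find hex - 1) x := by
      rw [← e1]
      ext x
      simp only [hw, pow_succ, Nat.add_sub_cancel]
      ring
    have h3 := hhalf M (by linarith) (w (Nat.find hex - 1))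
    rw [← e2] at h3
    have h4 : ENNReal.ofReal θ ≤ ENNReal.ofReal θ * truncModular Ω p q a M (w (Nat.find hex - 1)) :=
      le_mul_of_one_le_right zero_le h2.le
    exact absurd (h4.trans h3) (not_le.2 h1)

theorem GoodData.exists_modular_fnGstar_le_one (hd : GoodData l h A L p q a) (hN : 2 ≤ N)
    (hΩ : IsOpen Ω) (hcone : ConeProperty Ω) (hδ : 0 < δ)
    (hpq : ∀ x ∈ Ω, p x ≤ q x) (hpqδ : ∀ x ∈ Ω, δ ≤ p x * ((N + 1 : ℝ) / N) - q x) :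
    ∃ c : ℝ, 0 < c ∧ c ≤ 1 ∧ ∀ (u : EuclideanSpace ℝ (Fin N) → ℝ)
      (g : EuclideanSpace ℝ (Fin N) → EuclideanSpace ℝ (Fin N)), IsWeakGradient Ω u g →
      modular Ω (fnH p q a) (fun x => ‖g x‖) + modular Ω (fnH p q a) u ≤ ENNReal.ofReal c →
      modular Ω (fnGstar p q a) u ≤ 1 := by
  have hN' : (2 : ℝ) ≤ N := by exact_mod_cast hN
  have hs0 : 0 < (N : ℝ) / (N - 1) := div_pos (by linarith) (by linarith)
  obtain ⟨c, hc, hc1, hcb⟩ := hd.exists_truncModular_le_one hN hΩ hcone hδ hpq hpqδ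
  refine ⟨c, hc, hc1, fun u g hg hX => ?_⟩
  have hu : AEMeasurable u (volume.restrict Ω) := hg.1.aestronglyMeasurable.aemeasurable
  have hvm : AEMeasurable (fun x => rootG N (p x) (q x) (a x) |u x|) (volume.restrict Ω) :=
    hd.aemeasurable_comp hu (continuousOn_rootG hd.one_lt hd.lt_dim)
  have hm : ∀ n : ℕ, AEMeasurable (fun x =>
      ENNReal.ofReal (min (rootG N (p x) (q x) (a x) |u x|) ((n : ℝ) + 1)) ^ ((N : ℝ) / (N - 1)))
      (volume.restrict Ω) := fun n =>
    ((hvm.min aemeasurable_const).ennreal_ofReal).pow_const _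
  calc modular Ω (fnGstar p q a) u
      ≤ ∫⁻ x in Ω, Filter.liminf (fun n : ℕ => ENNReal.ofReal
          (min (rootG N (p x) (q x) (a x) |u x|) ((n : ℝ) + 1)) ^ ((N : ℝ) / (N - 1)))
          Filter.atTop := by
        refine lintegral_mono fun x => ?_
        have hv0 := rootG_nonneg (n := N) (p := p x) (q := q x) (hd.a_mem x).1 (abs_nonneg (u x))
        have h1 := rpow_add_le_rootG_rpow hd.one_lt hd.lt_dim (hd.p_mem x) (hd.q_mem x)
          (hd.a_mem x).1 (abs_nonneg (u x))
        have h2 : Filter.Tendsto (fun n : ℕ => ENNReal.ofReal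
            (min (rootG N (p x) (q x) (a x) |u x|) ((n : ℝ) + 1)) ^ ((N : ℝ) / (N - 1)))
            Filter.atTop (nhds (ENNReal.ofReal
              (rootG N (p x) (q x) (a x) |u x|) ^ ((N : ℝ) / (N - 1)))) := by
          refine tendsto_const_nhds.congr' ?_
          obtain ⟨m, hm⟩ := exists_nat_ge (rootG N (p x) (q x) (a x) |u x|)
          filter_upwards [Filter.eventually_ge_atTop m] with n hn
          have : (m : ℝ) ≤ n := by exact_mod_cast hn
          rw [min_eq_left (by linarith)]
        rw [h2.liminf_eq, ENNReal.ofReal_rpow_of_nonneg hv0 hs0.le]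
        exact ENNReal.ofReal_le_ofReal h1
    _ ≤ Filter.liminf (fun n : ℕ => truncModular Ω p q a ((n : ℝ) + 1) u) Filter.atTop :=
        lintegral_liminf_le' hm
    _ ≤ Filter.liminf (fun _ : ℕ => (1 : ℝ≥0∞)) Filter.atTop := by
        refine Filter.liminf_le_liminf (Filter.Eventually.of_forall fun n => ?_)
        exact hcb u g hg hX _ (by linarith [(Nat.cast_nonneg n : (0 : ℝ) ≤ n)])
    _ = 1 := by simp

end Core

theorem modular_congr {N : ℕ} {Ω : Set (EuclideanSpace ℝ (Fin N))} (hΩ : MeasurableSet Ω)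
    {Ψ Ψ' : EuclideanSpace ℝ (Fin N) → ℝ → ℝ} (h : ∀ x ∈ Ω, Ψ x = Ψ' x)
    (u : EuclideanSpace ℝ (Fin N) → ℝ) : modular Ω Ψ u = modular Ω Ψ' u :=
  setLIntegral_congr_fun hΩ fun x hx => by simp only [h x hx]

theorem exists_lipschitzWith_extension {N : ℕ} {s : Set (EuclideanSpace ℝ (Fin N))}
    {f : EuclideanSpace ℝ (Fin N) → ℝ} {K : NNReal} (hf : LipschitzOnWith K f s) {b c : ℝ}
    (hbc : b ≤ c) {t : Set (EuclideanSpace ℝ (Fin N))} (hts : t ⊆ s)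
    (hft : ∀ x ∈ t, f x ∈ Set.Icc b c) :
    ∃ f' : EuclideanSpace ℝ (Fin N) → ℝ, LipschitzWith K f' ∧ (∀ x, f' x ∈ Set.Icc b c) ∧
      ∀ x ∈ t, f x = f' x := by
  obtain ⟨F, hF, hFs⟩ := hf.extend_real
  refine ⟨fun x => max (min (F x) c) b, (hF.min_const c).max_const b, fun x => ?_, fun x hx => ?_⟩
  · exact ⟨le_max_right _ _, max_le (min_le_right _ _) hbc⟩
  · have h1 : f x = F x := hFs (hts hx)
    have h2 := hft x hx
    change f x = max (min (F x) c) b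
    rw [← h1, min_eq_left h2.2, max_eq_left h2.1]

theorem AssumptionA.exists_modular_fnGstar_le_one {N : ℕ} {Ω : Set (EuclideanSpace ℝ (Fin N))}
    (hΩ : IsOpen Ω) (hcone : ConeProperty Ω) {p q a : EuclideanSpace ℝ (Fin N) → ℝ}
    (hA : AssumptionA Ω p q a) (hqN : StrictlyBelow Ω q (fun _ => (N : ℝ))) :
    ∃ c : ℝ, 0 < c ∧ c ≤ 1 ∧ ∀ (u : EuclideanSpace ℝ (Fin N) → ℝ)
      (g : EuclideanSpace ℝ (Fin N) → EuclideanSpace ℝ (Fin N)), IsWeakGradient Ω u g →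
      modular Ω (fnH p q a) (fun x => ‖g x‖) + modular Ω (fnH p q a) u ≤ ENNReal.ofReal c →
      modular Ω (fnGstar p q a) u ≤ 1 := by
  have hN' : (2 : ℝ) ≤ N := by exact_mod_cast hA.two_le
  obtain ⟨δ₁, hδ₁, h1⟩ := hA.p_mem.2.1
  obtain ⟨δ₂, hδ₂, h2⟩ := hqN
  obtain ⟨δ, hδ, h3⟩ := hA.q_below
  obtain ⟨B, hB⟩ := hA.a_bdd
  obtain ⟨Kp, hKp⟩ := hA.p_lip
  obtain ⟨Kq, hKq⟩ := hA.q_lip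
  obtain ⟨Ka, hKa⟩ := hA.a_lip
  have hsub : Ω ⊆ closure Ω := subset_closure
  obtain ⟨l, hl1, hl2, hl3⟩ : ∃ l : ℝ, 1 < l ∧ l ≤ 5 / 4 ∧ l ≤ 1 + δ₁ :=
    ⟨1 + min δ₁ (1 / 4), by have : 0 < min δ₁ (1 / 4) := by positivity
                            linarith, by linarith [min_le_right δ₁ (1 / 4)],
      by linarith [min_le_left δ₁ (1 / 4)]⟩
  obtain ⟨h, hh1, hh2, hh3⟩ : ∃ h : ℝ, h < N ∧ 7 / 4 ≤ h ∧ N - δ₂ ≤ h :=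
    ⟨N - min δ₂ (1 / 4), by have : 0 < min δ₂ (1 / 4) := by positivity
                            linarith, by linarith [min_le_right δ₂ (1 / 4)],
      by linarith [min_le_left δ₂ (1 / 4)]⟩
  have hpl : ∀ x ∈ Ω, l ≤ p x := fun x hx => by linarith [h1 x (hsub hx)]
  have hqh : ∀ x ∈ Ω, q x ≤ h := fun x hx => by linarith [h2 x (hsub hx)]
  have hpq : ∀ x ∈ Ω, p x < q x := fun x hx => hA.p_lt_q x (hsub hx)
  obtain ⟨p', hp', hpm, hpe⟩ := exists_lipschitzWith_extension hKp (by linarith : l ≤ h) hsub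
    fun x hx => ⟨hpl x hx, (hpq x hx).le.trans (hqh x hx)⟩
  obtain ⟨q', hq', hqm, hqe⟩ := exists_lipschitzWith_extension hKq (by linarith : l ≤ h) hsub
    fun x hx => ⟨(hpl x hx).trans (hpq x hx).le, hqh x hx⟩
  obtain ⟨a', ha', ham, hae⟩ := exists_lipschitzWith_extension hKa (le_max_right B 0) hsub
    fun x hx => ⟨hA.a_nonneg x (hsub hx), (hB ⟨x, hx, rfl⟩).trans (le_max_left B 0)⟩
  have hd : GoodData l h (max B 0) (Kp + Kq + Ka) p' q' a' :=
    ⟨hl1, hh1, hp'.weaken (by rw [add_assoc]; exact le_self_add),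
      hq'.weaken (by rw [add_right_comm]; exact le_add_self), ha'.weaken le_add_self, hpm, hqm, ham⟩
  have eH : ∀ x ∈ Ω, fnH p q a x = fnH p' q' a' x := fun x hx => by
    ext t
    rw [fnH, fnH, hpe x hx, hqe x hx, hae x hx]
  have eG : ∀ x ∈ Ω, fnGstar p q a x = fnGstar p' q' a' x := fun x hx => by
    ext t
    rw [fnGstar, fnGstar, hpe x hx, hqe x hx, hae x hx]
  simp only [modular_congr hΩ.measurableSet eH, modular_congr hΩ.measurableSet eG]
  refine hd.exists_modular_fnGstar_le_one hA.two_le hΩ hcone hδ (fun x hx => ?_) fun x hx => ?_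
  · rw [← hpe x hx, ← hqe x hx]; exact (hpq x hx).le
  · rw [← hpe x hx, ← hqe x hx]; exact h3 x (hsub hx)

theorem critExp_le_critExp {N : ℕ} {s t : ℝ} (hs : 0 ≤ s) (hst : s ≤ t) (ht : t < N) :
    critExp N s ≤ critExp N t := by
  have hN : (0 : ℝ) ≤ N := by linarith
  have : 0 < (N : ℝ) - t := by linarith
  have ht0 : 0 ≤ t := hs.trans hst
  have hNt : 0 ≤ (N : ℝ) * t := by positivity
  unfold critExp
  gcongr

theorem bddAbove_critExp_image {N : ℕ} {Ω : Set (EuclideanSpace ℝ (Fin N))}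
    {q : EuclideanSpace ℝ (Fin N) → ℝ} (hq0 : ∀ x ∈ closure Ω, 0 ≤ q x)
    (hqN : StrictlyBelow Ω q (fun _ => (N : ℝ))) :
    BddAbove ((fun x => critExp N (q x)) '' closure Ω) := by
  obtain ⟨δ, hδ, h⟩ := hqN
  refine ⟨critExp N (N - δ), ?_⟩
  rintro _ ⟨x, hx, rfl⟩
  exact critExp_le_critExp (hq0 x hx) (by linarith [h x hx]) (by linarith)

theorem modular_fnGstar_le_rpow {N : ℕ} {Ω : Set (EuclideanSpace ℝ (Fin N))}
    (hΩ : MeasurableSet Ω) {p q a : EuclideanSpace ℝ (Fin N) → ℝ}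
    (ha : ∀ x ∈ Ω, 0 ≤ a x) {Q : ℝ}
    (hpQ : ∀ x ∈ Ω, critExp N (p x) ≤ Q) (hqQ : ∀ x ∈ Ω, critExp N (q x) ≤ Q) {s : ℝ}
    (hs : 0 < s) (hs1 : s ≤ 1) (u : EuclideanSpace ℝ (Fin N) → ℝ) :
    modular Ω (fnGstar p q a) u ≤
      ENNReal.ofReal (s⁻¹ ^ Q) * modular Ω (fnGstar p q a) (fun x => s * u x) := by
  rw [modular, modular, ← lintegral_const_mul' _ _ ENNReal.ofReal_ne_top]
  refine setLIntegral_mono' hΩ fun x hx => ?_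
  rw [← ENNReal.ofReal_mul (by positivity)]
  refine ENNReal.ofReal_le_ofReal ?_
  rw [abs_mul, abs_of_pos hs]
  have key : ∀ r ≤ Q, |u x| ^ r ≤ s⁻¹ ^ Q * (s * |u x|) ^ r := fun r hr => by
    rw [Real.mul_rpow hs.le (abs_nonneg _), ← mul_assoc]
    refine le_mul_of_one_le_left (by positivity) ?_
    calc (1 : ℝ) = s⁻¹ ^ r * s ^ r := by
          rw [← Real.mul_rpow (by positivity) hs.le, inv_mul_cancel₀ hs.ne', Real.one_rpow]
      _ ≤ s⁻¹ ^ Q * s ^ r := by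
          gcongr ?_ * _
          exact Real.rpow_le_rpow_of_exponent_le ((one_le_inv₀ hs).2 hs1) hr
  have h1 := key _ (hpQ x hx)
  have h2 := mul_le_mul_of_nonneg_left (key _ (hqQ x hx))
    (Real.rpow_nonneg (ha x hx) (critExp N (q x) / q x))
  unfold fnGstar
  linarith

end DoublePhase

theorem theorem2p7 {N : ℕ} (Ω : Set (EuclideanSpace ℝ (Fin N)))
    (hΩ : IsOpen Ω) (hcone : DoublePhase.ConeProperty Ω)
    (p q a : EuclideanSpace ℝ (Fin N) → ℝ)
    (hA : DoublePhase.AssumptionA Ω p q a)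
    (hqN : DoublePhase.StrictlyBelow Ω q (fun _ => (N : ℝ))) :
    DoublePhase.EmbedsContinuously Ω (DoublePhase.fnH p q a) (DoublePhase.fnGstar p q a) ∧
    ∃ C : ℝ, 0 < C ∧ ∀ u : EuclideanSpace ℝ (Fin N) → ℝ,
      DoublePhase.MemW Ω (DoublePhase.fnH p q a) u →
        DoublePhase.modular Ω (DoublePhase.fnGstar p q a) u ≤
          ENNReal.ofReal C *
            (DoublePhase.modular Ω (DoublePhase.fnH p q a)
                (fun x => ‖DoublePhase.weakGrad Ω u x‖) +
              DoublePhase.modular Ω (DoublePhase.fnH p q a) u + 1) ^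
              sSup ((fun x => DoublePhase.critExp N (q x)) '' closure Ω) := by
  obtain ⟨c, hc, hc1, hcore⟩ := hA.exists_modular_fnGstar_le_one hΩ hcone hqN
  have hΩm := hΩ.measurableSet
  have hsub : Ω ⊆ closure Ω := subset_closure
  have hp1 : ∀ x ∈ closure Ω, 1 ≤ p x := fun x hx => by
    obtain ⟨d, hd, h⟩ := hA.p_mem.2.1
    linarith [h x hx]
  have hq1 : ∀ x ∈ closure Ω, 1 ≤ q x := fun x hx => (hp1 x hx).trans (hA.p_lt_q x hx).le
  have ha0 : ∀ x ∈ Ω, 0 ≤ a x := fun x hx => hA.a_nonneg x (hsub hx)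
  set Q := sSup ((fun x => DoublePhase.critExp N (q x)) '' closure Ω) with hQ
  have hqQ : ∀ x ∈ Ω, DoublePhase.critExp N (q x) ≤ Q := fun x hx =>
    le_csSup (DoublePhase.bddAbove_critExp_image (fun y hy => by linarith [hq1 y hy]) hqN)
      ⟨x, hsub hx, rfl⟩
  have hpQ : ∀ x ∈ Ω, DoublePhase.critExp N (p x) ≤ Q := fun x hx =>
    (DoublePhase.critExp_le_critExp (by linarith [hp1 x (hsub hx)]) (hA.p_lt_q x (hsub hx)).le
      (hA.q_lt x (hsub hx))).trans (hqQ x hx)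
  have hscale : ∀ {s : ℝ}, 0 ≤ s → s ≤ 1 → ∀ u, DoublePhase.WeaklyDifferentiable Ω u →
      ENNReal.ofReal s * DoublePhase.modularW Ω (DoublePhase.fnH p q a) u ≤ ENNReal.ofReal c →
      DoublePhase.modular Ω (DoublePhase.fnGstar p q a) (fun x => s * u x) ≤ 1 := by
    intro s hs hs1 u hu hX
    have hg : DoublePhase.IsWeakGradient Ω u (DoublePhase.weakGrad Ω u) := by
      rw [DoublePhase.weakGrad, dif_pos hu]
      exact hu.choose_spec
    exact hcore _ _ (hg.const_mul s) ((DoublePhase.modular_add_modular_mul_le hΩm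
      (fun x hx => hp1 x (hsub hx)) (fun x hx => hq1 x (hsub hx)) ha0 hs hs1 u _).trans hX)
  have hmod : ∀ u : EuclideanSpace ℝ (Fin N) → ℝ,
      DoublePhase.MemW Ω (DoublePhase.fnH p q a) u →
        DoublePhase.modular Ω (DoublePhase.fnGstar p q a) u ≤ ENNReal.ofReal (c⁻¹ ^ Q) *
          (DoublePhase.modularW Ω (DoublePhase.fnH p q a) u + 1) ^ Q := by
    intro u hu
    have hXt : DoublePhase.modularW Ω (DoublePhase.fnH p q a) u ≠ ⊤ :=
      (ENNReal.add_lt_top.2 ⟨hu.2.2.2, hu.1.2⟩).ne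
    obtain ⟨X, hX⟩ : ∃ X, X = (DoublePhase.modularW Ω (DoublePhase.fnH p q a) u).toReal :=
      ⟨_, rfl⟩
    have hX0 : 0 ≤ X := by rw [hX]; exact ENNReal.toReal_nonneg
    have hXe : DoublePhase.modularW Ω (DoublePhase.fnH p q a) u = ENNReal.ofReal X := by
      rw [hX, ENNReal.ofReal_toReal hXt]
    have hs : 0 < c / (X + 1) := by positivity
    have hs1 : c / (X + 1) ≤ 1 := by rw [div_le_one (by positivity)]; linarith
    have h1 := hscale hs.le hs1 u hu.2.1 (by
      rw [hXe, ← ENNReal.ofReal_mul hs.le]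
      refine ENNReal.ofReal_le_ofReal ?_
      rw [div_mul_eq_mul_div, div_le_iff₀ (by positivity)]
      nlinarith)
    refine (DoublePhase.modular_fnGstar_le_rpow hΩm ha0 hpQ hqQ hs hs1 u).trans
      ((mul_le_of_le_one_right zero_le h1).trans (le_of_eq ?_))
    rw [hXe, ← ENNReal.ofReal_one, ← ENNReal.ofReal_add hX0 zero_le_one,
      ENNReal.ofReal_rpow_of_pos (by positivity), ← ENNReal.ofReal_mul (by positivity),
      ← Real.mul_rpow (by positivity) (by positivity), inv_div, div_eq_inv_mul]
  refine ⟨⟨c⁻¹, by positivity, fun u hu => ⟨⟨hu.1.1, ?_⟩, ?_⟩⟩, c⁻¹ ^ Q, by positivity, hmod⟩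
  · refine (hmod u hu).trans_lt ?_
    have hXt : DoublePhase.modularW Ω (DoublePhase.fnH p q a) u ≠ ⊤ :=
      (ENNReal.add_lt_top.2 ⟨hu.2.2.2, hu.1.2⟩).ne
    refine ENNReal.mul_lt_top ENNReal.ofReal_lt_top (lt_top_iff_ne_top.2 ?_)
    refine ENNReal.rpow_ne_top_of_ne_zero (by simp) (by simpa using hXt)
  · rw [DoublePhase.normW, DoublePhase.luxemburg]
    simp only [ENNReal.mul_iInf_of_ne (ENNReal.ofReal_pos.2 (inv_pos.2 hc)).ne'
      ENNReal.ofReal_ne_top]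
    refine le_iInf fun τ => le_iInf fun hτ => le_iInf fun hτ1 => ?_
    rw [← ENNReal.ofReal_mul (by positivity)]
    refine iInf_le_of_le (c⁻¹ * τ) (iInf_le_of_le (by positivity) (iInf_le_of_le ?_ le_rfl))
    obtain ⟨g, hg⟩ := hu.2.1
    have hwd : DoublePhase.WeaklyDifferentiable Ω (fun x => u x / τ) := by
      exact ⟨fun x => τ⁻¹ • g x, by simpa only [div_eq_inv_mul] using hg.const_mul τ⁻¹⟩
    have h1 := hscale hc.le hc1 _ hwd (mul_le_of_le_one_right zero_le hτ1)
    refine le_of_eq_of_le ?_ h1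
    congr 1
    ext x
    field_simp
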